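/- Let $d\ge 0$ be an integer, $T>0$, $t\in[0,T]$, and $H_0,H_1,\dots,H_d\in(1/2,1)$. Put $R_H(\xi,\eta)=\tfrac12\left(|\xi|^{2H}+|\eta|^{2H}-|\xi-\eta|^{2H}\right)$ for $\xi,\eta\in\mathbb R$. Let $\rho:\mathbb R^d\to\mathbb R$ be continuous with $$0\le\rho(x)\le C\prod_{i=1}^d(1+|x_i|)^{-\beta_i}\qquad(x\in\mathbb R^d)$$ for some constant $C$ and some $\beta_i\in(0,2)$ with $\beta_i<2H_i$, and suppose that $$\alpha:=\sum_{i=1}^d(2H_i-\beta_i)<2 .$$ On a probability space let $(B_s)_{0\le s\le T}$ be a $d$-dimensional standard Brownian motion and let $W=\{W(s,x):s\ge 0,\ x\in\mathbb R^d\}$ be a (jointly measurable) mean-zero Gaussian random field, independent of $B$, with covariance $$\mathbb E[W(s,x)W(r,y)]=R_{H_0}(s,r)\,\rho(x)\rho(y)\prod_{i=1}^dR_{H_i}(x_i,y_i).$$ For $\varepsilon,\eta>0$ put $\varphi_\eta=\eta^{-1}\mathbf 1_{[0,\eta]}$, $p_\varepsilon(x)=(2\pi\varepsilon)^{-d/2}e^{-|x|^2/(2\varepsilon)}$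 and $$\dot W_{\varepsilon,\eta}(s,x)=\int_0^s\int_{\mathbb R^d}\varphi_\eta(s-r)\,p_\varepsilon(x-y)\,W(dr,y)\,dy=\frac1\eta\int_{\mathbb R^d}p_\varepsilon(x-y)\left[W(s,y)-W(\max(s-\eta,0),y)\right]dy .$$ Then the approximations $V_t^{\varepsilon,\eta}=\int_t^T\dot W_{\varepsilon,\eta}(s,B_s)\,ds$ are well defined (almost surely as absolutely convergent integrals in $(s,y)$) and square integrable, they converge in $L^2(\Omega)$ as $\varepsilon,\eta\to0^+$, and their limit, denoted by $\int_t^T W(dr,B_r)$, has exponential moments of all orders: $$\mathbb E\left[\exp\Big(\lambda\int_t^T W(dr,B_r)\Big)\right]<\infty\qquad\text{for every }\lambda\in\mathbb R .$$ -/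

import Mathlib

open MeasureTheory ProbabilityTheory Filter Topology
open scoped NNReal

noncomputable section

/-- The covariance function of fractional Brownian motion with Hurst parameter `H`:
`R_H(ξ, η) = (|ξ|^{2H} + |η|^{2H} - |ξ - η|^{2H}) / 2`. -/
def fbmCov (H ξ η : ℝ) : ℝ :=
  (|ξ| ^ (2 * H) + |η| ^ (2 * H) - |ξ - η| ^ (2 * H)) / 2

/-- `B` is, up to the time horizon `T`, a `d`-dimensional standard Brownian motion: it starts from
`0`, has independent increments, `B_t - B_s` has law `N(0, (t - s) I_d)` for `s ≤ t ≤ T`, and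
almost surely has continuous paths. Nothing is required of `B` after time `T`. -/
structure IsStdBrownianUpTo {Ω : Type*} [MeasurableSpace Ω] {d : ℕ} (T : ℝ≥0)
    (B : ℝ≥0 → Ω → EuclideanSpace ℝ (Fin d)) (P : Measure Ω) : Prop where
  zero : ∀ᵐ ω ∂P, B 0 ω = 0
  indep_increments : HasIndepIncrements (fun (t : Set.Iic T) (ω : Ω) => B t ω) P
  law_increments : ∀ s t : ℝ≥0, s ≤ t → t ≤ T →
    HasLaw (fun ω => B t ω - B s ω)
      (multivariateGaussian 0 (((t : ℝ) - (s : ℝ)) • (1 : Matrix (Fin d) (Fin d) ℝ))) P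
  continuous_paths : ∀ᵐ ω ∂P, ContinuousOn (fun t => B t ω) (Set.Iic T)

/-- `W = (W(t, x))`, `t ≥ 0`, `x ∈ ℝ^d`, is a weighted fractional Brownian field with Hurst
parameters `H₀, H₁, …, H_d` and weight `ρ`: a (jointly measurable) mean-zero Gaussian random field
with `E[W(t,x) W(s,y)] = R_{H₀}(s,t) ρ(x) ρ(y) ∏ᵢ R_{Hᵢ}(xᵢ, yᵢ)`. -/
structure IsWeightedFractionalField {Ω : Type*} [MeasurableSpace Ω] {d : ℕ} (H₀ : ℝ)
    (H : Fin d → ℝ) (ρ : EuclideanSpace ℝ (Fin d) → ℝ)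
    (W : ℝ≥0 → EuclideanSpace ℝ (Fin d) → Ω → ℝ) (P : Measure Ω) : Prop where
  measurable : Measurable
    (fun q : (ℝ≥0 × EuclideanSpace ℝ (Fin d)) × Ω => W q.1.1 q.1.2 q.2)
  gaussian : IsGaussianProcess (fun (p : ℝ≥0 × EuclideanSpace ℝ (Fin d)) (ω : Ω) => W p.1 p.2 ω) P
  mean_zero : ∀ t x, ∫ ω, W t x ω ∂P = 0
  covariance : ∀ t x s y, ∫ ω, W t x ω * W s y ω ∂P =
    fbmCov H₀ s t * (ρ x * ρ y * ∏ i, fbmCov (H i) (x i) (y i))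

/-- The heat kernel `p_ε(x) = (2πε)^{-d/2} exp(-|x|² / (2ε))` on `ℝ^d`. -/
def heatKernel {d : ℕ} (ε : ℝ) (x : EuclideanSpace ℝ (Fin d)) : ℝ :=
  (2 * Real.pi * ε) ^ (-(d : ℝ) / 2) * Real.exp (-‖x‖ ^ 2 / (2 * ε))

/-- The time integral `∫_0^s φ_η(s - r) W(dr, y)` with `φ_η = η⁻¹ 1_{[0, η]}`. The integrand is
`η⁻¹` times the indicator function of `r ∈ [max (s - η) 0, s]`, so that the integral is the
increment of `W(·, y)` over this interval, divided by `η`. (`Real.toNNReal` sends a real `u`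
to `max u 0`.) -/
def timeMollified {Ω : Type*} {d : ℕ} (W : ℝ≥0 → EuclideanSpace ℝ (Fin d) → Ω → ℝ)
    (η s : ℝ) (y : EuclideanSpace ℝ (Fin d)) (ω : Ω) : ℝ :=
  (W s.toNNReal y ω - W (s - η).toNNReal y ω) / η

/-- The approximated noise
`Ẇ_{ε,η}(s, x) = ∫_0^s ∫_{ℝ^d} φ_η(s - r) p_ε(x - y) W(dr, y) dy`. -/
def approxNoise {Ω : Type*} {d : ℕ} (W : ℝ≥0 → EuclideanSpace ℝ (Fin d) → Ω → ℝ)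
    (ε η s : ℝ) (x : EuclideanSpace ℝ (Fin d)) (ω : Ω) : ℝ :=
  ∫ y, heatKernel ε (x - y) * timeMollified W η s y ω

/-- `V_t^{ε,η} = ∫_t^T Ẇ_{ε,η}(s, B_s) ds`. -/
def approxIntegral {Ω : Type*} {d : ℕ} (W : ℝ≥0 → EuclideanSpace ℝ (Fin d) → Ω → ℝ)
    (B : ℝ≥0 → Ω → EuclideanSpace ℝ (Fin d)) (t T : ℝ≥0) (ε η : ℝ) (ω : Ω) : ℝ :=
  ∫ s in (t : ℝ)..(T : ℝ), approxNoise W ε η s (B s.toNNReal ω) ω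

/-- `V` is (a version of) the nonlinear stochastic integral `∫_t^T W(dr, B_r)`, i.e. the limit in
`L²(Ω)` of `V_t^{ε,η} = ∫_t^T Ẇ_{ε,η}(s, B_s) ds` as `ε, η → 0+`. The first two conditions say that
the approximations are well defined: almost surely their `(s, y)`-integrand is Lebesgue integrable
on `[t, T] × ℝ^d`, and they belong to `L²(Ω)`. -/
structure IsNonlinearIntegral {Ω : Type*} [MeasurableSpace Ω] {d : ℕ}
    (W : ℝ≥0 → EuclideanSpace ℝ (Fin d) → Ω → ℝ)
    (B : ℝ≥0 → Ω → EuclideanSpace ℝ (Fin d)) (t T : ℝ≥0) (P : Measure Ω) (V : Ω → ℝ) : Prop where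
  approx_integrable : ∀ ε η : ℝ, 0 < ε → 0 < η → ∀ᵐ ω ∂P,
    Integrable (fun q : ℝ × EuclideanSpace ℝ (Fin d) =>
        heatKernel ε (B q.1.toNNReal ω - q.2) * timeMollified W η q.1 q.2 ω)
      ((volume.restrict (Set.Icc (t : ℝ) (T : ℝ))).prod volume)
  approx_memLp : ∀ ε η : ℝ, 0 < ε → 0 < η → MemLp (approxIntegral W B t T ε η) 2 P
  memLp : MemLp V 2 P
  tendsto : Tendsto (fun p : ℝ × ℝ => eLpNorm (approxIntegral W B t T p.1 p.2 - V) 2 P)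
    (𝓝[>] (0 : ℝ) ×ˢ 𝓝[>] (0 : ℝ)) (𝓝 0)

end

/-! The idea is to condition on the path. Given `B`, each approximation is linear in the Gaussian
field, so both claims become estimates of conditional covariances.

Convergence. By independence and Fubini, the `L²` inner product of two approximations is the
expectation of a double integral over times `s, r` in `[t, T]` and standard Gaussian vectors `z,
z'`. Its integrand is the covariance of the time-mollified noise at `(s, r)` times the spatial
covariance at the points `B_s - √ε z` and `B_r - √ε' z'`. Writing the heat kernel as a Gaussian
displacement of the path makes the reference measure independent of `ε`. The time factor is at most
a constant times `|s - r|^(2H₀ - 2)`, uniformly in the mollification (`abs_mollifiedCov_le`), and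
this is integrable because `H₀ > 1/2`; it also converges off the diagonal (`tendsto_mollifiedCov`).
The spatial factor is at most a product of two standard deviations, each of order `(1 + ‖x‖)^(α/2)`
(`weight_mul_prod_le`). Dominated convergence gives one common limit for all inner products as the
four parameters vanish independently, and a family with this property is Cauchy
(`exists_tendsto_of_tendsto_inner`).

Exponential moments. Conditionally on the path, `E exp(λ V)` becomes `E exp(λ² Var / 2)`. A Schur
test bounds the conditional variance by `K ∫₀ᵀ (1 + ‖B_s‖)^α ds`, with `K` free of the mollification
parameters (`exists_gridVariance_le`). Jensen's inequality in time reduces the claim to exponential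
moments of `(1 + ‖B_s‖)^α` at a single time. All of these are finite because `α < 2` and Gaussian
tails are quadratic-exponential (`exists_lintegral_exp_rpow_le`).

The conditional Gaussian formula is needed only for finite sums with random coefficients
(`lintegral_exp_sum_of_indep`): the field is first replaced by its values on a finite grid. The grid
is then removed by `L¹` convergence and Fatou's lemma, and the mollification by a second use of
Fatou. -/

noncomputable section

open scoped ENNReal

/-! ### Second differences of `|x|^p` and the covariance in time -/

/-- The second-order increment of `x ↦ |x| ^ p` over the rectangle `[s', s] × [r', r]`. -/
def rectInc (p s s' r r' : ℝ) : ℝ :=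
  |s - r'| ^ p + |s' - r| ^ p - |s - r| ^ p - |s' - r'| ^ p

lemma rectInc_swap (p s s' r r' : ℝ) : rectInc p s s' r r' = rectInc p r r' s s' := by
  unfold rectInc
  rw [abs_sub_comm s r', abs_sub_comm s' r, abs_sub_comm s r, abs_sub_comm s' r']
  ring

/-- The derivative of `|x| ^ p` is Hölder continuous with exponent `p - 1`. -/
lemma abs_deriv_abs_rpow_sub_le {p : ℝ} (hp : 1 < p) (hp2 : p < 2) (x y : ℝ) :
    |p * |x| ^ (p - 2) * x - p * |y| ^ (p - 2) * y| ≤ 2 * p * |x - y| ^ (p - 1) := by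
  have key : ∀ z : ℝ, 0 ≤ z → p * |z| ^ (p - 2) * z = p * z ^ (p - 1) := by
    intro z hz
    rcases hz.eq_or_lt with rfl | hz
    · simp [Real.zero_rpow (by linarith : p - 1 ≠ 0)]
    · rw [abs_of_pos hz, mul_assoc]
      congr 1
      rw [← Real.rpow_add_one hz.ne']
      congr 1; ring
  have same : ∀ u v : ℝ, 0 ≤ u → u ≤ v →
      |p * |v| ^ (p - 2) * v - p * |u| ^ (p - 2) * u| ≤ 2 * p * |v - u| ^ (p - 1) := by
    intro u v hu huv
    rw [key v (hu.trans huv), key u hu, ← mul_sub, abs_mul, abs_of_pos (by linarith : 0 < p),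
      abs_of_nonneg (sub_nonneg.2 (Real.rpow_le_rpow hu huv (by linarith))),
      abs_of_nonneg (sub_nonneg.2 huv)]
    have h := Real.rpow_add_le_add_rpow hu (sub_nonneg.2 huv) (by linarith : 0 ≤ p - 1)
      (by linarith)
    rw [add_sub_cancel] at h
    have : 0 ≤ (v - u) ^ (p - 1) := Real.rpow_nonneg (sub_nonneg.2 huv) _
    nlinarith
  -- For opposite signs the two terms add up, and each is at most `|x - y|^(p - 1)`. This case costs
  -- the factor 2; for equal signs subadditivity of `z ↦ z^(p - 1)` suffices.
  have opp : ∀ u v : ℝ, 0 ≤ u → 0 ≤ v →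
      |p * |v| ^ (p - 2) * v - p * |-u| ^ (p - 2) * (-u)| ≤ 2 * p * |v - -u| ^ (p - 1) := by
    intro u v hu hv
    have e : p * |v| ^ (p - 2) * v - p * |-u| ^ (p - 2) * (-u) = p * (v ^ (p - 1) + u ^ (p - 1)) := by
      rw [abs_neg, mul_neg, key u hu, key v hv]; ring
    have hu' : u ^ (p - 1) ≤ (v + u) ^ (p - 1) := Real.rpow_le_rpow hu (by linarith) (by linarith)
    have hv' : v ^ (p - 1) ≤ (v + u) ^ (p - 1) := Real.rpow_le_rpow hv (by linarith) (by linarith)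
    have hu0 : 0 ≤ u ^ (p - 1) := Real.rpow_nonneg hu _
    have hv0 : 0 ≤ v ^ (p - 1) := Real.rpow_nonneg hv _
    rw [e, sub_neg_eq_add, abs_of_nonneg (by positivity), abs_of_nonneg (by positivity : 0 ≤ v + u)]
    nlinarith
  have nonneg_left : ∀ u v : ℝ, 0 ≤ v →
      |p * |v| ^ (p - 2) * v - p * |u| ^ (p - 2) * u| ≤ 2 * p * |v - u| ^ (p - 1) := by
    intro u v hv
    rcases le_total 0 u with hu | hu
    · rcases le_total u v with h | h
      · exact same u v hu h
      · rw [abs_sub_comm, abs_sub_comm v u]; exact same v u hv h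
    · simpa using opp (-u) v (by linarith) hv
  rcases le_total 0 x with hx | hx
  · exact nonneg_left y x hx
  · have := nonneg_left (-y) (-x) (by linarith)
    rw [abs_neg, abs_neg] at this
    calc _ = |p * |x| ^ (p - 2) * -x - p * |y| ^ (p - 2) * -y| := by rw [← abs_neg]; congr 1; ring
      _ ≤ _ := this
      _ = _ := by rw [← abs_neg (-x - -y)]; congr 3; ring

/-- Mean value theorem for `x ↦ |x + (r - r')|^p - |x|^p`, which is differentiable everywhere
because `p > 1`. The two intervals may therefore overlap, and the resulting Hölder bound serves near
the diagonal. -/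
lemma exists_rectInc_eq {p : ℝ} (hp : 1 < p) {s s' r r' : ℝ} (hs : s' ≤ s) :
    ∃ ξ ∈ Set.Icc (s' - r) (s - r), rectInc p s s' r r' =
      (s - s') * (p * |ξ + (r - r')| ^ (p - 2) * (ξ + (r - r')) - p * |ξ| ^ (p - 2) * ξ) := by
  rcases hs.eq_or_lt with rfl | hs
  · exact ⟨s' - r, by simp, by simp [rectInc]⟩
  have hder : ∀ x, HasDerivAt (fun x => |x + (r - r')| ^ p - |x| ^ p)
      (p * |x + (r - r')| ^ (p - 2) * (x + (r - r')) - p * |x| ^ (p - 2) * x) x := fun x =>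
    (HasDerivAt.comp_add_const x (r - r') (hasDerivAt_abs_rpow _ hp)).sub (hasDerivAt_abs_rpow x hp)
  obtain ⟨ξ, hξ, h⟩ := exists_hasDerivAt_eq_slope _ _ (by linarith : s' - r < s - r)
    (fun x _ => (hder x).continuousAt.continuousWithinAt) (fun x _ => hder x)
  refine ⟨ξ, Set.Ioo_subset_Icc_self hξ, ?_⟩
  rw [h]
  have : s - r - (s' - r) = s - s' := by ring
  rw [this, mul_div_cancel₀ _ (by linarith : s - s' ≠ 0)]
  unfold rectInc
  have e1 : s - r + (r - r') = s - r' := by ring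
  have e2 : s' - r + (r - r') = s' - r' := by ring
  rw [e1, e2]; ring

lemma abs_rectInc_le {p : ℝ} (hp : 1 < p) (hp2 : p < 2) {s s' r r' : ℝ} (hs : s' ≤ s)
    (hr : r' ≤ r) : |rectInc p s s' r r'| ≤ (s - s') * (2 * p * (r - r') ^ (p - 1)) := by
  obtain ⟨ξ, -, h⟩ := exists_rectInc_eq (r := r) (r' := r') hp hs
  rw [h, abs_mul, abs_of_nonneg (sub_nonneg.2 hs)]
  refine mul_le_mul_of_nonneg_left ?_ (sub_nonneg.2 hs)
  have := abs_deriv_abs_rpow_sub_le hp hp2 (ξ + (r - r')) ξ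
  rwa [add_sub_cancel_left, abs_of_nonneg (sub_nonneg.2 hr)] at this

/-- A second application of the mean value theorem, now to `x ↦ p x^(p - 1)`. Separation of the
intervals keeps the argument positive, away from the singularity of `x^(p - 2)` at 0. -/
lemma exists_rectInc_eq_second {p : ℝ} (hp : 1 < p) {s s' r r' : ℝ} (hs : s' ≤ s)
    (hr : r' ≤ r) (hsr : r < s') :
    ∃ ζ ∈ Set.Icc (s' - r) (s - r'), rectInc p s s' r r' =
      (s - s') * (r - r') * (p * (p - 1) * ζ ^ (p - 2)) := by
  obtain ⟨ξ, hξ, h⟩ := exists_rectInc_eq (r := r) (r' := r') hp hs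
  have hξ0 : 0 < ξ := by linarith [hξ.1]
  rcases hr.eq_or_lt with rfl | hr
  · exact ⟨s' - r', ⟨le_rfl, by linarith⟩, by rw [h]; simp⟩
  have key : ∀ z : ℝ, 0 < z → p * |z| ^ (p - 2) * z = p * z ^ (p - 1) := by
    intro z hz
    rw [abs_of_pos hz, mul_assoc, ← Real.rpow_add_one hz.ne']
    congr 2; ring
  have hder : ∀ x, 0 < x → HasDerivAt (fun x => p * x ^ (p - 1)) (p * ((p - 1) * x ^ (p - 2))) x := by
    intro x hx
    have := (Real.hasDerivAt_rpow_const (x := x) (p := p - 1) (Or.inl hx.ne')).const_mul p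
    rwa [show p - 1 - 1 = p - 2 by ring] at this
  obtain ⟨ζ, hζ, h'⟩ := exists_hasDerivAt_eq_slope _ _ (by linarith : ξ < ξ + (r - r'))
    (fun x hx => (hder x (hξ0.trans_le hx.1)).continuousAt.continuousWithinAt)
    (fun x hx => hder x (hξ0.trans hx.1))
  refine ⟨ζ, ⟨by linarith [hξ.1, hζ.1], by linarith [hξ.2, hζ.2]⟩, ?_⟩
  rw [h, key _ hξ0, key _ (by linarith), mul_assoc p (p - 1), h', add_sub_cancel_left, mul_assoc,
    mul_div_cancel₀ _ (by linarith : r - r' ≠ 0)]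

/-- The covariance of the time-mollified increments of a fractional Brownian motion. -/
def mollifiedCov (H η η' s r : ℝ) : ℝ :=
  (fbmCov H (max s 0) (max r 0) - fbmCov H (max s 0) (max (r - η') 0)
    - fbmCov H (max (s - η) 0) (max r 0) + fbmCov H (max (s - η) 0) (max (r - η') 0)) / (η * η')

/-- The terms `|ξ|^(2H)` that depend on one time only cancel in the second difference, so just the
increment of `|s - r|^(2H)` over the two averaging windows remains. -/
lemma mollifiedCov_eq_rectInc (H η η' s r : ℝ) : mollifiedCov H η η' s r =
    rectInc (2 * H) (max s 0) (max (s - η) 0) (max r 0) (max (r - η') 0) / (2 * (η * η')) := by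
  unfold mollifiedCov fbmCov rectInc
  rw [← div_div _ 2]
  congr 1
  ring

lemma continuous_fbmCov {H : ℝ} (hH : 0 < H) : Continuous (fun q : ℝ × ℝ => fbmCov H q.1 q.2) := by
  have h : ∀ f : ℝ × ℝ → ℝ, Continuous f → Continuous (fun q => |f q| ^ (2 * H)) := fun f hf =>
    hf.abs.rpow_const fun _ => Or.inr (by linarith)
  unfold fbmCov
  exact (((h _ continuous_fst).add (h _ continuous_snd)).sub
    (h _ (continuous_fst.sub continuous_snd))).div_const _

lemma continuous_mollifiedCov {H : ℝ} (hH : 0 < H) (η η' : ℝ) :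
    Continuous (fun q : ℝ × ℝ => mollifiedCov H η η' q.1 q.2) := by
  have h := continuous_fbmCov hH
  have h' : ∀ f g : ℝ × ℝ → ℝ, Continuous f → Continuous g →
      Continuous (fun q => fbmCov H (f q) (g q)) := fun f g hf hg => h.comp (hf.prodMk hg)
  unfold mollifiedCov
  refine (((Continuous.sub (h' _ _ ?_ ?_) (h' _ _ ?_ ?_)).sub (h' _ _ ?_ ?_)).add
    (h' _ _ ?_ ?_)).div_const _ <;> fun_prop

lemma sub_max_bounds {η : ℝ} (hη : 0 < η) (s : ℝ) :
    max (s - η) 0 ≤ max s 0 ∧ max s 0 - max (s - η) 0 ≤ η := by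
  refine ⟨max_le_max (by linarith) le_rfl, ?_⟩
  rcases le_total 0 s with hs | hs
  · rw [max_eq_left hs]; linarith [le_max_left (s - η) 0]
  · rw [max_eq_right hs]; linarith [le_max_right (s - η) 0]

lemma mollifiedCov_swap (H η η' s r : ℝ) : mollifiedCov H η η' s r = mollifiedCov H η' η r s := by
  rw [mollifiedCov_eq_rectInc, mollifiedCov_eq_rectInc, rectInc_swap, mul_comm η]

/-- The mollified covariance is dominated by the covariance kernel of the fractional noise,
uniformly in the mollification parameters. -/
lemma abs_mollifiedCov_le {H : ℝ} (hH : H ∈ Set.Ioo (1 / 2 : ℝ) 1) {η η' s r : ℝ} (hη : 0 < η)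
    (hη' : 0 < η') (hs : 0 ≤ s) (hr : 0 ≤ r) (hsr : s ≠ r) :
    |mollifiedCov H η η' s r| ≤ 2 * H * (1 / 2) ^ (2 * H - 2) * |s - r| ^ (2 * H - 2) := by
  wlog h : r < s generalizing η η' s r
  · rw [mollifiedCov_swap, abs_sub_comm]
    exact this hη' hη hr hs hsr.symm (lt_of_le_of_ne (not_lt.1 h) hsr)
  obtain ⟨hH1, hH2⟩ := hH
  set p := 2 * H with hp
  have hp1 : 1 < p := by linarith
  have hp2 : p < 2 := by linarith
  obtain ⟨a1, a2⟩ := sub_max_bounds hη s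
  obtain ⟨b1, b2⟩ := sub_max_bounds hη' r
  have a3 := max_eq_left hs
  have b3 := max_eq_left hr
  rw [mollifiedCov_eq_rectInc, abs_div, abs_of_pos (by positivity : 0 < 2 * (η * η')), mul_assoc p,
    ← Real.mul_rpow (by norm_num) (abs_nonneg _), abs_of_pos (sub_pos.2 h),
    div_le_iff₀ (by positivity), ← hp]
  rw [a3] at a1 a2 ⊢
  rw [b3] at b1 b2 ⊢
  have hs1 : s - η ≤ max (s - η) 0 := le_max_left _ _
  set s' := max (s - η) 0
  set r' := max (r - η') 0
  have hx : 0 < 1 / 2 * (s - r) := by linarith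
  have hpow : ∀ m, 0 < m → s - r < 2 * m → m ^ (p - 2) ≤ (1 / 2 * (s - r)) ^ (p - 2) :=
    fun m hm h => Real.rpow_le_rpow_of_nonpos hx (by linarith) (by linarith)
  have hpm : ∀ m : ℝ, 0 < m → m ^ (p - 1) = m * m ^ (p - 2) := fun m hm => by
    rw [mul_comm, ← Real.rpow_add_one hm.ne']; congr 1; ring
  -- A window longer than half the gap is handled by the first-order bound: `η^(p - 1) = η · η^(p -
  -- 2)`, and `η^(p - 2)` is at most `((s - r)/2)^(p - 2)` because `p < 2`. The swap makes `η`, not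
  -- `η'`, carry the power `p - 1`.
  rcases lt_or_ge (s - r) (2 * η) with c1 | c1
  · have := abs_rectInc_le hp1 hp2 b1 a1
    rw [← rectInc_swap] at this
    refine this.trans ?_
    have h1 : (s - s') ^ (p - 1) ≤ η ^ (p - 1) :=
      Real.rpow_le_rpow (sub_nonneg.2 a1) a2 (by linarith)
    calc (r - r') * (2 * p * (s - s') ^ (p - 1)) ≤ η' * (2 * p * (η * (1 / 2 * (s - r)) ^ (p - 2))) := by
          refine mul_le_mul b2 (mul_le_mul_of_nonneg_left (h1.trans ?_) (by positivity)) ?_ hη'.le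
          · rw [hpm η hη]; exact mul_le_mul_of_nonneg_left (hpow η hη c1) hη.le
          · have := Real.rpow_nonneg (sub_nonneg.2 a1) (p - 1); positivity
      _ = _ := by ring
  rcases lt_or_ge (s - r) (2 * η') with c2 | c2
  · refine (abs_rectInc_le hp1 hp2 a1 b1).trans ?_
    have h1 : (r - r') ^ (p - 1) ≤ η' ^ (p - 1) :=
      Real.rpow_le_rpow (sub_nonneg.2 b1) b2 (by linarith)
    calc (s - s') * (2 * p * (r - r') ^ (p - 1)) ≤ η * (2 * p * (η' * (1 / 2 * (s - r)) ^ (p - 2))) := by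
          refine mul_le_mul a2 (mul_le_mul_of_nonneg_left (h1.trans ?_) (by positivity)) ?_ hη.le
          · rw [hpm η' hη']; exact mul_le_mul_of_nonneg_left (hpow η' hη' c2) hη'.le
          · have := Real.rpow_nonneg (sub_nonneg.2 b1) (p - 1); positivity
      _ = _ := by ring
  -- Now the window behind `s` is at most half the gap, so the windows are disjoint and the
  -- intermediate point is at least `(s - r)/2`. The factor `p (p - 1)` is estimated by `2p` to
  -- match the other cases.
  obtain ⟨ζ, hζ, e⟩ := exists_rectInc_eq_second hp1 a1 b1 (by linarith : r < s')
  have hζ' : 1 / 2 * (s - r) ≤ ζ := by linarith [hζ.1]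
  have hz : ζ ^ (p - 2) ≤ (1 / 2 * (s - r)) ^ (p - 2) :=
    Real.rpow_le_rpow_of_nonpos hx hζ' (by linarith)
  have hz0 : 0 ≤ ζ ^ (p - 2) := Real.rpow_nonneg (hx.le.trans hζ') _
  have hss := sub_nonneg.2 a1
  have hrr := sub_nonneg.2 b1
  rw [e, abs_of_nonneg (by have : 0 ≤ p - 1 := by linarith
                           positivity)]
  calc (s - s') * (r - r') * (p * (p - 1) * ζ ^ (p - 2))
      ≤ η * η' * (p * 2 * (1 / 2 * (s - r)) ^ (p - 2)) := by
        refine mul_le_mul (mul_le_mul a2 b2 hrr hη.le) ?_ ?_ (by positivity)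
        · refine mul_le_mul (mul_le_mul_of_nonneg_left (by linarith) (by linarith)) hz hz0
            (by linarith)
        · have : 0 ≤ p - 1 := by linarith
          positivity
    _ = _ := by ring

/-- The mollified covariance converges to the covariance kernel of the fractional noise. -/
lemma tendsto_mollifiedCov {H : ℝ} (hH : H ∈ Set.Ioo (1 / 2 : ℝ) 1) {s r : ℝ} (hs : 0 < s)
    (hr : 0 < r) (hsr : s ≠ r) :
    Tendsto (fun q : ℝ × ℝ => mollifiedCov H q.1 q.2 s r) (𝓝[>] 0 ×ˢ 𝓝[>] 0)
      (𝓝 (H * (2 * H - 1) * |s - r| ^ (2 * H - 2))) := by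
  wlog h : r < s generalizing s r
  · rw [abs_sub_comm]
    have := this hr hs hsr.symm (lt_of_le_of_ne (not_lt.1 h) hsr)
    refine (this.comp tendsto_prod_swap).congr fun q => ?_
    rw [mollifiedCov_swap]; rfl
  obtain ⟨hH1, hH2⟩ := hH
  have key : ∀ η η' : ℝ, 0 < η → 0 < η' → η < s → η' < r → η < s - r →
      ∃ ζ ∈ Set.Icc (s - η - r) (s - (r - η')),
        mollifiedCov H η η' s r = H * (2 * H - 1) * ζ ^ (2 * H - 2) := by
    intro η η' h1 h2 h3 h4 h5
    rw [mollifiedCov_eq_rectInc, max_eq_left hs.le, max_eq_left hr.le,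
      max_eq_left (by linarith : 0 ≤ s - η), max_eq_left (by linarith : 0 ≤ r - η')]
    obtain ⟨ζ, hζ, e⟩ := exists_rectInc_eq_second (p := 2 * H) (by linarith)
      (by linarith : s - η ≤ s) (by linarith : r - η' ≤ r) (by linarith : r < s - η)
    refine ⟨ζ, hζ, ?_⟩
    rw [e]; field_simp; ring
  -- The clamps at time 0 are inactive once `η < s` and `η' < r`. The intermediate point is then
  -- squeezed to `s - r`, and `p (p - 1) / 2` with `p = 2H` gives the constant `H (2H - 1)`.
  choose! ζ hζ e using key
  have hf : ∀ᶠ q : ℝ × ℝ in 𝓝[>] 0 ×ˢ 𝓝[>] 0,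
      0 < q.1 ∧ 0 < q.2 ∧ q.1 < s ∧ q.2 < r ∧ q.1 < s - r := by
    have h1 : ∀ᶠ x : ℝ in 𝓝[>] 0, 0 < x ∧ x < s ∧ x < s - r := by
      filter_upwards [self_mem_nhdsWithin, mem_nhdsWithin_of_mem_nhds (gt_mem_nhds hs),
        mem_nhdsWithin_of_mem_nhds (gt_mem_nhds (sub_pos.2 h))] with x a b c using ⟨a, b, c⟩
    have h2 : ∀ᶠ x : ℝ in 𝓝[>] 0, 0 < x ∧ x < r := by
      filter_upwards [self_mem_nhdsWithin, mem_nhdsWithin_of_mem_nhds (gt_mem_nhds hr)]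
        with x a b using ⟨a, b⟩
    filter_upwards [h1.prod_mk h2] with q hq using ⟨hq.1.1, hq.2.1, hq.1.2.1, hq.2.2, hq.1.2.2⟩
  have hid : Tendsto (fun x : ℝ => x) (𝓝[>] 0) (𝓝 0) := tendsto_id.mono_left nhdsWithin_le_nhds
  have hlim : Tendsto (fun q : ℝ × ℝ => ζ q.1 q.2) (𝓝[>] 0 ×ˢ 𝓝[>] 0) (𝓝 (s - r)) := by
    have l1 : Tendsto (fun q : ℝ × ℝ => s - q.1 - r) (𝓝[>] 0 ×ˢ 𝓝[>] 0) (𝓝 (s - r)) := by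
      simpa using ((tendsto_const_nhds (x := s)).sub (hid.comp tendsto_fst)).sub_const r
    have l2 : Tendsto (fun q : ℝ × ℝ => s - (r - q.2)) (𝓝[>] 0 ×ˢ 𝓝[>] 0) (𝓝 (s - r)) := by
      simpa using (tendsto_const_nhds (x := s)).sub ((tendsto_const_nhds (x := r)).sub
        (hid.comp tendsto_snd))
    refine tendsto_of_tendsto_of_tendsto_of_le_of_le' l1 l2 ?_ ?_
    · filter_upwards [hf] with q ⟨h1, h2, h3, h4, h5⟩ using (hζ _ _ h1 h2 h3 h4 h5).1
    · filter_upwards [hf] with q ⟨h1, h2, h3, h4, h5⟩ using (hζ _ _ h1 h2 h3 h4 h5).2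
  rw [abs_of_pos (sub_pos.2 h)]
  refine ((hlim.rpow_const (Or.inl (sub_pos.2 h).ne')).const_mul _).congr' ?_
  filter_upwards [hf] with q ⟨h1, h2, h3, h4, h5⟩ using (e _ _ h1 h2 h3 h4 h5).symm

/-- On the diagonal the singular kernel says nothing. This bound blows up as `η → 0`, and it is used
only for integrability at fixed `η`, never in a limit of the mollification. -/
lemma mollifiedCov_self_le {H : ℝ} (hH : H ∈ Set.Ioo (1 / 2 : ℝ) 1) {η : ℝ} (hη : 0 < η)
    (s : ℝ) : mollifiedCov H η η s s ≤ η ^ (2 * H) / (η * η) := by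
  obtain ⟨a1, a2⟩ := sub_max_bounds hη s
  have h : rectInc (2 * H) (max s 0) (max (s - η) 0) (max s 0) (max (s - η) 0) =
      2 * (max s 0 - max (s - η) 0) ^ (2 * H) := by
    unfold rectInc
    rw [abs_sub_comm (max (s - η) 0) (max s 0), abs_of_nonneg (sub_nonneg.2 a1)]
    simp [Real.zero_rpow (by linarith [hH.1] : 2 * H ≠ 0)]
    ring
  rw [mollifiedCov_eq_rectInc, h, mul_div_mul_left _ _ two_ne_zero]
  have := sub_nonneg.2 a1
  gcongr
  linarith [hH.1]

lemma integrableOn_abs_rpow {q : ℝ} (hq : -1 < q) (T : ℝ) (hT : 0 ≤ T) :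
    IntegrableOn (fun x : ℝ => |x| ^ q) (Set.Icc (-T) T) := by
  have h1 : IntervalIntegrable (fun x : ℝ => |x| ^ q) volume 0 T := by
    refine (intervalIntegral.intervalIntegrable_rpow' hq (a := 0) (b := T)).congr ?_
    intro x hx
    rw [Set.uIoc_of_le hT] at hx
    simp [abs_of_pos hx.1]
  have h2 : IntervalIntegrable (fun x : ℝ => |x| ^ q) volume (-T) 0 := by
    have := (IntervalIntegrable.iff_comp_neg).1 h1
    simpa using this.symm
  have h3 := h2.trans h1
  rwa [intervalIntegrable_iff_integrableOn_Icc_of_le (by linarith)] at h3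

/-- The singular kernel `|s - r| ^ q` with `q > -1` has bounded integrals over `[0, T]`. -/
lemma exists_lintegral_abs_sub_rpow_le {q : ℝ} (hq : -1 < q) (T : ℝ) (hT : 0 ≤ T) :
    ∃ M : ℝ, 0 ≤ M ∧ ∀ s ∈ Set.Icc 0 T,
      ∫⁻ r in Set.Icc 0 T, ENNReal.ofReal (|s - r| ^ q) ≤ ENNReal.ofReal M := by
  have hfin : ∫⁻ u in Set.Icc (-T) T, ENNReal.ofReal (|u| ^ q) ≠ ∞ := by
    have := (integrableOn_abs_rpow hq T hT).lintegral_lt_top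
    exact this.ne
  refine ⟨(∫⁻ u in Set.Icc (-T) T, ENNReal.ofReal (|u| ^ q)).toReal, ENNReal.toReal_nonneg,
    fun s hs => ?_⟩
  rw [ENNReal.ofReal_toReal hfin, ← lintegral_indicator measurableSet_Icc,
    ← lintegral_indicator measurableSet_Icc]
  -- The reflection `r ↦ s - r` carries `[0, T]` into `[-T, T]`, whatever `s` in `[0, T]` is; this
  -- makes the bound uniform.
  rw [← lintegral_sub_left_eq_self (μ := (volume : Measure ℝ))
    ((Set.Icc (-T) T).indicator fun u => ENNReal.ofReal (|u| ^ q)) s]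
  refine lintegral_mono fun r => ?_
  by_cases hr : r ∈ Set.Icc 0 T
  · rw [Set.indicator_of_mem hr, Set.indicator_of_mem]
    exact ⟨by linarith [hs.1, hr.2], by linarith [hs.2, hr.1]⟩
  · rw [Set.indicator_of_notMem hr]; exact zero_le

/-! ### Heat kernel smoothing as a Gaussian displacement -/

section HeatKernel

variable {d : ℕ}

lemma heatKernel_nonneg {ε : ℝ} (hε : 0 ≤ ε) (x : EuclideanSpace ℝ (Fin d)) :
    0 ≤ heatKernel ε x := by
  unfold heatKernel; positivity

lemma continuous_heatKernel (ε : ℝ) :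
    Continuous (heatKernel ε : EuclideanSpace ℝ (Fin d) → ℝ) := by
  unfold heatKernel; fun_prop

lemma heatKernel_smul {ε : ℝ} (hε : 0 < ε) (z : EuclideanSpace ℝ (Fin d)) :
    heatKernel ε (Real.sqrt ε • z) = ε ^ (-(d : ℝ) / 2) * heatKernel 1 z := by
  unfold heatKernel
  rw [norm_smul, mul_pow, Real.norm_of_nonneg (Real.sqrt_nonneg _), Real.sq_sqrt hε.le,
    Real.mul_rpow (by positivity) hε.le, mul_one, mul_one, ← mul_assoc,
    mul_comm (ε ^ (-(d : ℝ) / 2))]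
  congr 2
  field_simp

variable (d) in
/-- The law with density `heatKernel 1`. -/
def heatMeasure : Measure (EuclideanSpace ℝ (Fin d)) :=
  volume.withDensity fun z => ENNReal.ofReal (heatKernel 1 z)

lemma integrable_exp_neg_mul_sq_norm {b : ℝ} (hb : 0 < b) :
    Integrable (fun z : EuclideanSpace ℝ (Fin d) => Real.exp (-b * ‖z‖ ^ 2)) := by
  have := (GaussianFourier.integrable_cexp_neg_mul_sq_norm_add (V := EuclideanSpace ℝ (Fin d))
    (b := (b : ℂ)) (by simpa using hb) 0 0).norm
  refine this.congr (ae_of_all _ fun z => ?_)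
  simp only [Complex.norm_exp]
  simp [← Complex.ofReal_pow]

lemma integrable_heatKernel_one :
    Integrable (heatKernel 1 : EuclideanSpace ℝ (Fin d) → ℝ) := by
  refine ((integrable_exp_neg_mul_sq_norm (d := d) (b := 1 / 2) (by norm_num)).const_mul
    ((2 * Real.pi * 1) ^ (-(d : ℝ) / 2))).congr (ae_of_all _ fun z => ?_)
  simp only [heatKernel]
  congr 2; ring

lemma integral_heatKernel_one :
    ∫ z : EuclideanSpace ℝ (Fin d), heatKernel 1 z = 1 := by
  have h := GaussianFourier.integral_rexp_neg_mul_sq_norm (V := EuclideanSpace ℝ (Fin d))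
    (b := 1 / 2) (by norm_num)
  have e : ∀ z : EuclideanSpace ℝ (Fin d), heatKernel 1 z =
      (2 * Real.pi * 1) ^ (-(d : ℝ) / 2) * Real.exp (-(1 / 2) * ‖z‖ ^ 2) := by
    intro z; simp only [heatKernel]; congr 2; ring
  simp_rw [e]
  rw [integral_const_mul, h, finrank_euclideanSpace_fin,
    show Real.pi / (1 / 2) = 2 * Real.pi * 1 by ring, ← Real.rpow_add (by positivity)]
  rw [show -(d : ℝ) / 2 + (d : ℝ) / 2 = 0 by ring, Real.rpow_zero]

instance : IsProbabilityMeasure (heatMeasure d) := by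
  refine ⟨?_⟩
  rw [heatMeasure, withDensity_apply _ MeasurableSet.univ, Measure.restrict_univ,
    ← ofReal_integral_eq_lintegral_ofReal integrable_heatKernel_one
      (ae_of_all _ fun z => heatKernel_nonneg zero_le_one z), integral_heatKernel_one,
    ENNReal.ofReal_one]

lemma lintegral_heatMeasure (F : EuclideanSpace ℝ (Fin d) → ℝ≥0∞) (hF : Measurable F) :
    ∫⁻ z, F z ∂(heatMeasure d) = ∫⁻ z, ENNReal.ofReal (heatKernel 1 z) * F z := by
  rw [heatMeasure, lintegral_withDensity_eq_lintegral_mul _ _ hF]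
  · rfl
  · exact (continuous_heatKernel 1).measurable.ennreal_ofReal

lemma lintegral_one_add_norm_heatMeasure_lt_top :
    ∫⁻ z, ENNReal.ofReal (1 + ‖z‖) ∂(heatMeasure d) < ∞ := by
  rw [lintegral_heatMeasure _ (by fun_prop)]
  have hint := ((integrable_exp_neg_mul_sq_norm (d := d) (b := 1 / 4) (by norm_num)).const_mul
    (3 * (2 * Real.pi * 1) ^ (-(d : ℝ) / 2))).lintegral_lt_top
  refine lt_of_le_of_lt (lintegral_mono fun z => ?_) hint
  rw [← ENNReal.ofReal_mul (heatKernel_nonneg zero_le_one z)]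
  refine ENNReal.ofReal_le_ofReal ?_
  unfold heatKernel
  have h1 : 1 + ‖z‖ ≤ 3 * Real.exp (1 / 4 * ‖z‖ ^ 2) := by
    have := Real.add_one_le_exp (1 / 4 * ‖z‖ ^ 2)
    nlinarith [sq_nonneg (‖z‖ - 2 / 3)]
  have h2 : Real.exp (-‖z‖ ^ 2 / (2 * 1)) * Real.exp (1 / 4 * ‖z‖ ^ 2) =
      Real.exp (-(1 / 4) * ‖z‖ ^ 2) := by
    rw [← Real.exp_add]; congr 1; ring
  have hc : 0 ≤ (2 * Real.pi * 1) ^ (-(d : ℝ) / 2) := by positivity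
  calc _ ≤ (2 * Real.pi * 1) ^ (-(d : ℝ) / 2) * Real.exp (-‖z‖ ^ 2 / (2 * 1)) *
        (3 * Real.exp (1 / 4 * ‖z‖ ^ 2)) := by gcongr
    _ = 3 * (2 * Real.pi * 1) ^ (-(d : ℝ) / 2) *
        (Real.exp (-‖z‖ ^ 2 / (2 * 1)) * Real.exp (1 / 4 * ‖z‖ ^ 2)) := by ring
    _ = _ := by rw [h2]

/-- Substitution `y = x - √ε z`: the Jacobian of the dilation cancels the scaling factor of the
kernel. The smoothing parameter moves from the measure into the integrand. -/
lemma lintegral_heatKernel_sub_mul {ε : ℝ} (hε : 0 < ε) (x : EuclideanSpace ℝ (Fin d))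
    (F : EuclideanSpace ℝ (Fin d) → ℝ≥0∞) (hF : Measurable F) :
    ∫⁻ y, ENNReal.ofReal (heatKernel ε (x - y)) * F y =
      ∫⁻ z, F (x - Real.sqrt ε • z) ∂(heatMeasure d) := by
  have hs : 0 < Real.sqrt ε := Real.sqrt_pos.2 hε
  have hk : Measurable fun z : EuclideanSpace ℝ (Fin d) => ENNReal.ofReal (heatKernel ε z) :=
    (continuous_heatKernel ε).measurable.ennreal_ofReal
  rw [lintegral_heatMeasure _ (by fun_prop),
    ← lintegral_sub_left_eq_self (μ := volume)
      (fun y => ENNReal.ofReal (heatKernel ε (x - y)) * F y) x]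
  simp only [sub_sub_cancel]
  have hmap := Measure.map_addHaar_smul (volume : Measure (EuclideanSpace ℝ (Fin d))) hs.ne'
  rw [finrank_euclideanSpace_fin] at hmap
  have hcoef : |(Real.sqrt ε ^ d)⁻¹| = ε ^ (-(d : ℝ) / 2) := by
    rw [abs_of_pos (by positivity), Real.sqrt_eq_rpow, ← Real.rpow_natCast, ← Real.rpow_mul hε.le,
      ← Real.rpow_neg hε.le]
    congr 1; ring
  rw [hcoef] at hmap
  have hpos : 0 < ε ^ (-(d : ℝ) / 2) := Real.rpow_pos_of_pos hε _
  have h := lintegral_map (μ := volume) (f := fun u => ENNReal.ofReal (heatKernel ε u) * F (x - u))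
    (g := fun z : EuclideanSpace ℝ (Fin d) => Real.sqrt ε • z) (by fun_prop) (by fun_prop)
  rw [hmap, lintegral_smul_measure] at h
  simp_rw [heatKernel_smul hε, ENNReal.ofReal_mul hpos.le, mul_assoc] at h
  rw [lintegral_const_mul _ (by
    have : Measurable fun z : EuclideanSpace ℝ (Fin d) => ENNReal.ofReal (heatKernel 1 z) :=
      (continuous_heatKernel 1).measurable.ennreal_ofReal
    fun_prop), smul_eq_mul] at h
  exact (ENNReal.mul_right_inj (by simpa using hpos) ENNReal.ofReal_ne_top).1 h

/-- Integrating against the heat kernel centred at a curve amounts to a Gaussian perturbation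
of the curve. -/
lemma withDensity_heatKernel_eq_map {ε : ℝ} (hε : 0 < ε) (τ : Measure ℝ) [SFinite τ]
    {b : ℝ → EuclideanSpace ℝ (Fin d)} (hb : Measurable b) :
    (τ.prod volume).withDensity (fun a => ENNReal.ofReal (heatKernel ε (b a.1 - a.2))) =
      (τ.prod (heatMeasure d)).map (fun a => (a.1, b a.1 - Real.sqrt ε • a.2)) := by
  have hk : Measurable fun a : ℝ × EuclideanSpace ℝ (Fin d) =>
      ENNReal.ofReal (heatKernel ε (b a.1 - a.2)) := by
    have := (continuous_heatKernel (d := d) ε).measurable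
    fun_prop
  refine Measure.ext_of_lintegral _ fun F hF => ?_
  rw [lintegral_withDensity_eq_lintegral_mul _ hk hF, lintegral_map hF (by fun_prop),
    lintegral_prod _ (hk.mul hF).aemeasurable, lintegral_prod _ (by fun_prop)]
  refine lintegral_congr fun s => ?_
  exact lintegral_heatKernel_sub_mul hε (b s) (fun y => F (s, y)) (by fun_prop)

end HeatKernel

/-! ### Subquadratic exponential moments of Gaussian vectors -/

lemma exists_mul_rpow_le_mul_sq_add {q : ℝ} (hq0 : 0 ≤ q) (hq : q < 2) {c : ℝ} (hc : 0 ≤ c) {δ : ℝ}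
    (hδ : 0 < δ) : ∃ K : ℝ, ∀ x : ℝ, 0 ≤ x → c * x ^ q ≤ δ * x ^ 2 + K := by
  have ht : Tendsto (fun R : ℝ => c * R ^ (-(2 - q))) atTop (𝓝 0) := by
    simpa using (tendsto_rpow_neg_atTop (by linarith : 0 < 2 - q)).const_mul c
  -- Beyond `R` the quadratic term wins because `q < 2`; below `R` the constant `c R^q` is enough.
  obtain ⟨R, hR, hR0⟩ := ((ht.eventually (gt_mem_nhds hδ)).and (eventually_gt_atTop 0)).exists
  refine ⟨c * R ^ q, fun x hx => ?_⟩
  rcases le_total x R with h | h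
  · have : x ^ q ≤ R ^ q := Real.rpow_le_rpow hx h hq0
    nlinarith [sq_nonneg x, mul_le_mul_of_nonneg_left this hc, mul_nonneg hδ.le (sq_nonneg x)]
  · have hx0 : 0 < x := hR0.trans_le h
    have e : x ^ q = x ^ 2 * x ^ (-(2 - q)) := by
      rw [← Real.rpow_natCast x 2, ← Real.rpow_add hx0]; congr 1; push_cast; ring
    have h1 : x ^ (-(2 - q)) ≤ R ^ (-(2 - q)) :=
      Real.rpow_le_rpow_of_nonpos hR0 h (by linarith)
    have h2 : 0 ≤ c * R ^ q := mul_nonneg hc (Real.rpow_nonneg hR0.le _)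
    calc c * x ^ q = x ^ 2 * (c * x ^ (-(2 - q))) := by rw [e]; ring
      _ ≤ x ^ 2 * δ := by
        refine mul_le_mul_of_nonneg_left ?_ (sq_nonneg x)
        exact (mul_le_mul_of_nonneg_left h1 hc).trans hR.le
      _ ≤ _ := by linarith

section Gaussian

variable {d : ℕ}

/-- Writing all the laws as dilations of a single Gaussian measure lets one integral control every
time in `[0, T]`. -/
lemma multivariateGaussian_smul_one {s : ℝ} (hs : 0 ≤ s) :
    multivariateGaussian 0 (s • (1 : Matrix (Fin d) (Fin d) ℝ)) =
      (stdGaussian (EuclideanSpace ℝ (Fin d))).map (fun x => Real.sqrt s • x) := by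
  have hps : (s • (1 : Matrix (Fin d) (Fin d) ℝ)).PosSemidef := Matrix.PosSemidef.one.smul hs
  have : IsProbabilityMeasure ((stdGaussian (EuclideanSpace ℝ (Fin d))).map
      (fun x => Real.sqrt s • x)) := Measure.isProbabilityMeasure_map (by fun_prop)
  refine Measure.ext_of_charFun ?_
  ext x
  rw [charFun_multivariateGaussian hps, charFun_map_smul, charFun_stdGaussian]
  congr 1
  simp only [inner_zero_right, Complex.ofReal_zero, zero_mul, zero_sub, Matrix.smul_mulVec,
    Matrix.one_mulVec, dotProduct_smul, norm_smul, Real.norm_eq_abs, abs_of_nonneg (Real.sqrt_nonneg s)]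
  rw [neg_div]
  congr 2
  rw [← Complex.ofReal_pow, mul_pow, Real.sq_sqrt hs, EuclideanSpace.real_norm_sq_eq]
  simp [dotProduct, sq]

/-- Subquadratic exponential moments of a centred Gaussian vector with covariance `s • 1` are
bounded uniformly in `s ∈ [0, T]`. -/
lemma exists_lintegral_exp_rpow_le {T q : ℝ} (hT : 0 ≤ T) (hq0 : 0 ≤ q) (hq : q < 2) {c : ℝ}
    (hc : 0 ≤ c) : ∃ D : ℝ, ∀ s ∈ Set.Icc 0 T,
      ∫⁻ x, ENNReal.ofReal (Real.exp (c * (1 + ‖x‖) ^ q))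
        ∂(multivariateGaussian 0 (s • (1 : Matrix (Fin d) (Fin d) ℝ))) ≤ ENNReal.ofReal D := by
  obtain ⟨C, hC, hint⟩ :=
    IsGaussian.exists_integrable_exp_sq (stdGaussian (EuclideanSpace ℝ (Fin d)))
  -- Here `C` is the exponent from Fernique's theorem. The choice of `δ` gives `2 δ T ≤ C`, so that
  -- `δ (1 + √s ‖x‖)² ≤ 2δ + C ‖x‖²` for all `s ≤ T`; `T + 1` avoids a division by zero at `T = 0`.
  have hδ : 0 < C / (2 * (T + 1)) := by positivity
  obtain ⟨K, hK⟩ := exists_mul_rpow_le_mul_sq_add hq0 hq hc hδ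
  set δ := C / (2 * (T + 1)) with hδ_def
  refine ⟨∫ x, Real.exp (2 * δ + K) * Real.exp (C * ‖x‖ ^ 2)
    ∂(stdGaussian (EuclideanSpace ℝ (Fin d))), fun s hs => ?_⟩
  rw [ofReal_integral_eq_lintegral_ofReal (hint.const_mul _) (ae_of_all _ fun x => by positivity),
    multivariateGaussian_smul_one hs.1,
    lintegral_map (Continuous.measurable (by
      refine ENNReal.continuous_ofReal.comp (Real.continuous_exp.comp (continuous_const.mul ?_))
      exact (continuous_const.add continuous_norm).rpow_const fun x => Or.inr hq0)) (by fun_prop)]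
  refine lintegral_mono fun x => ENNReal.ofReal_le_ofReal ?_
  rw [← Real.exp_add]
  refine Real.exp_le_exp.2 ((hK _ (by positivity)).trans ?_)
  rw [norm_smul, Real.norm_of_nonneg (Real.sqrt_nonneg _)]
  have h1 : (1 + Real.sqrt s * ‖x‖) ^ 2 ≤ 2 + 2 * (T * ‖x‖ ^ 2) := by
    have h2 : (Real.sqrt s * ‖x‖) ^ 2 ≤ T * ‖x‖ ^ 2 := by
      rw [mul_pow, Real.sq_sqrt hs.1]
      exact mul_le_mul_of_nonneg_right hs.2 (sq_nonneg _)
    nlinarith [sq_nonneg (Real.sqrt s * ‖x‖ - 1)]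
  have h3 : δ * (2 * T) ≤ C := by
    rw [hδ_def, div_mul_eq_mul_div, div_le_iff₀ (by positivity)]
    nlinarith
  nlinarith [mul_le_mul_of_nonneg_left h1 hδ.le, mul_le_mul_of_nonneg_right h3 (sq_nonneg ‖x‖)]

end Gaussian

/-! ### A continuous modification of the Brownian motion -/

section Modification

variable {Ω : Type*} [MeasurableSpace Ω] {P : Measure Ω} {d : ℕ} {T : ℝ≥0}
  {B : ℝ≥0 → Ω → EuclideanSpace ℝ (Fin d)}

lemma IsStdBrownianUpTo.hasLaw (hB : IsStdBrownianUpTo T B P) {s : ℝ≥0} (hs : s ≤ T) :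
    HasLaw (B s) (multivariateGaussian 0 ((s : ℝ) • (1 : Matrix (Fin d) (Fin d) ℝ))) P := by
  have h := hB.law_increments 0 s zero_le hs
  rw [NNReal.coe_zero, sub_zero] at h
  refine h.congr ?_
  filter_upwards [hB.zero] with ω hω
  simp [hω]

/-- A modification of a Brownian motion on `[0, T]`, extended to `ℝ` by constants, all of whose
paths are continuous. -/
lemma IsStdBrownianUpTo.exists_continuous_modification (hB : IsStdBrownianUpTo T B P) :
    ∃ b : ℝ → Ω → EuclideanSpace ℝ (Fin d), (∀ ω, Continuous fun s => b s ω) ∧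
      (∀ s, Measurable (b s)) ∧ (∀ᵐ ω ∂P, ∀ s : ℝ≥0, s ≤ T → B s ω = b s ω) ∧
      ∀ s : ℝ, b s = b (min s.toNNReal T : ℝ≥0) := by
  have hae : ∀ s : Set.Iic T, AEMeasurable (B s) P := fun s => (hB.hasLaw s.2).aemeasurable
  obtain ⟨D, hDc, hDd⟩ := TopologicalSpace.exists_countable_dense (Set.Iic T)
  -- The variables `B s` are only almost everywhere measurable. On `G` the path is continuous and
  -- agrees with measurable versions along a countable dense set of times, so every value is a limit
  -- of measurable ones; off `G` the path is set to 0.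
  have h1 : ∀ᵐ ω ∂P, ∀ q ∈ D, B q ω = (hae q).mk _ ω :=
    (ae_ball_iff hDc).2 fun q _ => (hae q).ae_eq_mk
  obtain ⟨G, hG, hGm, hGp⟩ := (h1.and hB.continuous_paths).exists_measurable_mem
  have hclamp : ∀ s : ℝ, min s.toNNReal T ≤ T := fun s => min_le_right _ _
  have hself : ∀ s : ℝ≥0, s ≤ T → min (s : ℝ).toNNReal T = s := fun s hs => by
    rw [Real.toNNReal_coe, min_eq_left hs]
  refine ⟨fun s => G.indicator (B (min s.toNNReal T)), fun ω => ?_, fun s => ?_, ?_, fun s => ?_⟩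
  · by_cases hω : ω ∈ G
    · simp only [Set.indicator_of_mem hω]
      exact (hGp ω hω).2.comp_continuous (by fun_prop) fun s => hclamp s
    · simp only [Set.indicator_of_notMem hω]
      exact continuous_const
  · obtain ⟨x, hxD, hx⟩ := mem_closure_iff_seq_limit.1 (hDd ⟨min s.toNNReal T, hclamp s⟩)
    refine measurable_of_tendsto_metrizable (f := fun n => G.indicator ((hae (x n)).mk _))
      (fun n => (hae (x n)).measurable_mk.indicator hGm) ?_
    rw [tendsto_pi_nhds]
    intro ω
    by_cases hω : ω ∈ G
    · simp only [Set.indicator_of_mem hω]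
      have hc : ContinuousWithinAt (fun t => B t ω) (Set.Iic T) (min s.toNNReal T) :=
        (hGp ω hω).2 _ (hclamp s)
      have hx' : Tendsto (fun n => (x n : ℝ≥0)) atTop (𝓝[Set.Iic T] (min s.toNNReal T)) :=
        tendsto_nhdsWithin_iff.2 ⟨(continuous_subtype_val.tendsto _).comp hx,
          Eventually.of_forall fun n => (x n).2⟩
      refine (hc.tendsto.comp hx').congr fun n => ?_
      exact (hGp ω hω).1 _ (hxD n)
    · simp only [Set.indicator_of_notMem hω]
      exact tendsto_const_nhds
  · filter_upwards [hG] with ω hω s hs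
    rw [hself s hs, Set.indicator_of_mem hω]
  · simp only
    rw [hself _ (hclamp s)]

end Modification

/-! ### Fubini for independent factors and Cauchy–Schwarz -/

section Independent

variable {Ω R : Type*} {mB mW mΩ : MeasurableSpace Ω} [MeasurableSpace R] {P : Measure Ω}
  {μ : Measure R} {κ Ξ : R → Ω → ℝ}

lemma ProbabilityTheory.Indep.indepFun {β γ : Type*} [MeasurableSpace β] [MeasurableSpace γ]
    (hind : Indep mB mW P) {f : Ω → β} {g : Ω → γ} (hf : Measurable[mB] f)
    (hg : Measurable[mW] g) : IndepFun f g P :=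
  (IndepFun_iff_Indep _ _ _).2 <| indep_of_indep_of_le_left
    (indep_of_indep_of_le_right hind (measurable_iff_comap_le.1 hg)) (measurable_iff_comap_le.1 hf)

/-- Tonelli puts the parameter outside; at each fixed parameter the two factors are independent, so
the expectation factorises. -/
lemma lintegral_prod_mul_of_indep [SFinite P] [SFinite μ] (hmB : mB ≤ mΩ) (hmW : mW ≤ mΩ) (hind : Indep mB mW P)
    (hκ : ∀ c, Measurable[mB] (κ c)) (hκm : Measurable fun q : Ω × R => κ q.2 q.1)
    (hΞ : ∀ c, Measurable[mW] (Ξ c)) (hΞm : Measurable fun q : Ω × R => Ξ q.2 q.1) :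
    ∫⁻ q, ‖κ q.2 q.1 * Ξ q.2 q.1‖ₑ ∂(P.prod μ) =
      ∫⁻ q, ‖κ q.2 q.1‖ₑ * ∫⁻ ω, ‖Ξ q.2 ω‖ₑ ∂P ∂(P.prod μ) := by
  have hΞi : Measurable fun c => ∫⁻ ω, ‖Ξ c ω‖ₑ ∂P :=
    Measurable.lintegral_prod_left' (f := fun q : Ω × R => ‖Ξ q.2 q.1‖ₑ) hΞm.enorm
  have hm : Measurable fun q : Ω × R => κ q.2 q.1 * Ξ q.2 q.1 := hκm.mul hΞm
  have hm' : Measurable fun q : Ω × R => ‖κ q.2 q.1‖ₑ * ∫⁻ ω, ‖Ξ q.2 ω‖ₑ ∂P :=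
    hκm.enorm.mul (hΞi.comp measurable_snd)
  rw [lintegral_prod_symm _ hm.enorm.aemeasurable,
    lintegral_prod_symm _ hm'.aemeasurable]
  refine lintegral_congr fun c => ?_
  simp only [enorm_mul]
  rw [lintegral_mul_const _ (((hκ c).mono hmB le_rfl).enorm)]
  exact lintegral_mul_eq_lintegral_mul_lintegral_of_independent_measurableSpace hmB hmW hind
    (measurable_enorm.comp (hκ c)) (measurable_enorm.comp (hΞ c))

/-- Fubini's theorem for products of independent integrands: the second factor may be replaced by
its expectation. -/
lemma integral_prod_mul_of_indep [SFinite P] [SFinite μ] (hmB : mB ≤ mΩ) (hmW : mW ≤ mΩ) (hind : Indep mB mW P)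
    (hκ : ∀ c, Measurable[mB] (κ c)) (hκm : Measurable fun q : Ω × R => κ q.2 q.1)
    (hΞ : ∀ c, Measurable[mW] (Ξ c)) (hΞm : Measurable fun q : Ω × R => Ξ q.2 q.1)
    (hfin : ∫⁻ q, ‖κ q.2 q.1‖ₑ * ∫⁻ ω, ‖Ξ q.2 ω‖ₑ ∂P ∂(P.prod μ) < ∞) :
    Integrable (fun q : Ω × R => κ q.2 q.1 * Ξ q.2 q.1) (P.prod μ) ∧
    ∫ q, κ q.2 q.1 * Ξ q.2 q.1 ∂(P.prod μ) =
      ∫ q, κ q.2 q.1 * ∫ ω, Ξ q.2 ω ∂P ∂(P.prod μ) := by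
  have hint : Integrable (fun q : Ω × R => κ q.2 q.1 * Ξ q.2 q.1) (P.prod μ) := by
    refine ⟨(hκm.mul hΞm).aestronglyMeasurable, ?_⟩
    rw [HasFiniteIntegral, lintegral_prod_mul_of_indep hmB hmW hind hκ hκm hΞ hΞm]
    exact hfin
  have hΞi : StronglyMeasurable fun c => ∫ ω, Ξ c ω ∂P :=
    StronglyMeasurable.integral_prod_left' (f := fun q : Ω × R => Ξ q.2 q.1) hΞm.stronglyMeasurable
  have hint2 : Integrable (fun q : Ω × R => κ q.2 q.1 * ∫ ω, Ξ q.2 ω ∂P) (P.prod μ) := by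
    refine ⟨(hκm.mul (hΞi.measurable.comp measurable_snd)).aestronglyMeasurable, ?_⟩
    refine lt_of_le_of_lt (lintegral_mono fun q => ?_) hfin
    rw [enorm_mul]
    gcongr
    exact enorm_integral_le_lintegral_enorm _
  refine ⟨hint, ?_⟩
  rw [integral_prod_symm _ hint, integral_prod_symm _ hint2]
  refine integral_congr_ae (ae_of_all _ fun c => ?_)
  simp only
  rw [integral_mul_const]
  exact (hind.indepFun (hκ c) (hΞ c)).integral_fun_mul_eq_mul_integral
    ((hκ c).mono hmB le_rfl).aestronglyMeasurable ((hΞ c).mono hmW le_rfl).aestronglyMeasurable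

lemma integral_abs_mul_le_of_sq_le {X Y : Ω → ℝ} (hX : MemLp X 2 P) (hY : MemLp Y 2 P) {a b : ℝ}
    (ha : 0 ≤ a) (hb : 0 ≤ b) (hXa : ∫ ω, X ω * X ω ∂P ≤ a ^ 2) (hYb : ∫ ω, Y ω * Y ω ∂P ≤ b ^ 2) :
    ∫ ω, |X ω * Y ω| ∂P ≤ a * b := by
  have h := integral_mul_le_Lp_mul_Lq_of_nonneg (μ := P) (f := fun ω => |X ω|) (g := fun ω => |Y ω|)
    Real.HolderConjugate.two_two (ae_of_all _ fun _ => abs_nonneg _)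
    (ae_of_all _ fun _ => abs_nonneg _) (by simpa using hX.norm)
    (by simpa using hY.norm)
  simp_rw [abs_mul]
  refine h.trans ?_
  have key : ∀ Z : Ω → ℝ, ∀ c : ℝ, 0 ≤ c → ∫ ω, Z ω * Z ω ∂P ≤ c ^ 2 →
      (∫ ω, |Z ω| ^ (2 : ℝ) ∂P) ^ (1 / 2 : ℝ) ≤ c := by
    intro Z c hc hZ
    have e : ∀ ω, |Z ω| ^ (2 : ℝ) = Z ω * Z ω := fun ω => by
      rw [Real.rpow_two, sq_abs, sq]
    simp_rw [e]
    rw [← Real.sqrt_eq_rpow]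
    exact Real.sqrt_le_iff.2 ⟨hc, hZ⟩
  exact mul_le_mul (key X a ha hXa) (key Y b hb hYb)
    (Real.rpow_nonneg (integral_nonneg fun ω => Real.rpow_nonneg (abs_nonneg _) _) _) ha

lemma lintegral_enorm_mul_le_of_sq_le {X Y : Ω → ℝ} (hX : MemLp X 2 P) (hY : MemLp Y 2 P) {a b : ℝ}
    (ha : 0 ≤ a) (hb : 0 ≤ b) (hXa : ∫ ω, X ω * X ω ∂P ≤ a ^ 2) (hYb : ∫ ω, Y ω * Y ω ∂P ≤ b ^ 2) :
    ∫⁻ ω, ‖X ω * Y ω‖ₑ ∂P ≤ ENNReal.ofReal (a * b) := by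
  have hXY : Integrable (fun ω => X ω * Y ω) P := hX.integrable_mul hY
  rw [← ofReal_integral_norm_eq_lintegral_enorm hXY]
  exact ENNReal.ofReal_le_ofReal (integral_abs_mul_le_of_sq_le hX hY ha hb hXa hYb)

lemma lintegral_enorm_le_of_sq_le [IsProbabilityMeasure P] {X : Ω → ℝ} (hX : MemLp X 2 P) {a : ℝ} (ha : 0 ≤ a)
    (hXa : ∫ ω, X ω * X ω ∂P ≤ a ^ 2) : ∫⁻ ω, ‖X ω‖ₑ ∂P ≤ ENNReal.ofReal a := by
  simpa using lintegral_enorm_mul_le_of_sq_le hX (memLp_const (1 : ℝ)) ha zero_le_one hXa (by simp)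

end Independent

/-! ### Covariance and growth of the weighted field -/

section Field

/-- The σ-algebra generated by a random field. -/
@[reducible] def fieldSigma {Ω : Type*} {d : ℕ} (W : ℝ≥0 → EuclideanSpace ℝ (Fin d) → Ω → ℝ) : MeasurableSpace Ω :=
  MeasurableSpace.comap (fun ω (p : ℝ≥0 × EuclideanSpace ℝ (Fin d)) => W p.1 p.2 ω) inferInstance

lemma measurable_fieldSigma_timeMollified {Ω : Type*} {d : ℕ}
    (W : ℝ≥0 → EuclideanSpace ℝ (Fin d) → Ω → ℝ) (η s : ℝ)
    (y : EuclideanSpace ℝ (Fin d)) : Measurable[fieldSigma W] (timeMollified W η s y) := by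
  have h : ∀ u : ℝ≥0, Measurable[fieldSigma W] (W u y) := fun u =>
    (measurable_pi_apply (u, y)).comp (comap_measurable
      (fun ω (p : ℝ≥0 × EuclideanSpace ℝ (Fin d)) => W p.1 p.2 ω))
  exact ((h _).sub (h _)).div_const η

variable {Ω : Type*} [MeasurableSpace Ω] {P : Measure Ω} {d : ℕ} {H₀ : ℝ}
  {H : Fin d → ℝ} {ρ : EuclideanSpace ℝ (Fin d) → ℝ}
  {W : ℝ≥0 → EuclideanSpace ℝ (Fin d) → Ω → ℝ}

/-- The spatial covariance of a weighted fractional field. -/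
def spaceCov (H : Fin d → ℝ) (ρ : EuclideanSpace ℝ (Fin d) → ℝ)
    (y z : EuclideanSpace ℝ (Fin d)) : ℝ :=
  ρ y * ρ z * ∏ i, fbmCov (H i) (y i) (z i)

lemma continuous_spaceCov (hH : ∀ i, H i ∈ Set.Ioo (1 / 2 : ℝ) 1) (hρ : Continuous ρ) :
    Continuous fun q : EuclideanSpace ℝ (Fin d) × EuclideanSpace ℝ (Fin d) =>
      spaceCov H ρ q.1 q.2 := by
  unfold spaceCov
  refine ((hρ.comp continuous_fst).mul (hρ.comp continuous_snd)).mul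
    (continuous_finsetProd _ fun i _ => ?_)
  have := continuous_fbmCov (H := H i) (by linarith [(hH i).1])
  exact this.comp (f := fun q : EuclideanSpace ℝ (Fin d) × EuclideanSpace ℝ (Fin d) =>
    (q.1 i, q.2 i)) (by fun_prop)

lemma fbmCov_comm (H x y : ℝ) : fbmCov H x y = fbmCov H y x := by
  unfold fbmCov
  rw [abs_sub_comm x y, add_comm (|x| ^ (2 * H))]

lemma fbmCov_self {H : ℝ} (hH : 0 < H) (x : ℝ) : fbmCov H x x = (|x| ^ H) ^ 2 := by
  unfold fbmCov
  rw [sub_self, abs_zero, Real.zero_rpow (by linarith), ← Real.rpow_natCast, ← Real.rpow_mul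
    (abs_nonneg x), mul_comm H]
  push_cast; ring

lemma spaceCov_self (hH : ∀ i, H i ∈ Set.Ioo (1 / 2 : ℝ) 1) (x : EuclideanSpace ℝ (Fin d)) :
    spaceCov H ρ x x = (ρ x * ∏ i, |x i| ^ (H i)) ^ 2 := by
  unfold spaceCov
  rw [Finset.prod_congr rfl fun i _ => fbmCov_self (by linarith [(hH i).1] : 0 < H i) (x i),
    Finset.prod_pow]
  ring

/-- The standard deviation of a weighted fractional field grows at most like
`‖x‖ ^ (∑ i, (2 * H i - β i) / 2)`. -/
lemma weight_mul_prod_le {β : Fin d → ℝ} (hβ : ∀ i, β i ∈ Set.Ioo (0 : ℝ) 2)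
    (hβH : ∀ i, β i < 2 * H i) (hH : ∀ i, H i ∈ Set.Ioo (1 / 2 : ℝ) 1) {C : ℝ}
    (hρ : ∀ x, 0 ≤ ρ x ∧ ρ x ≤ C * ∏ i, (1 + |x i|) ^ (-β i)) :
    0 ≤ C ∧ ∀ x, 0 ≤ ρ x * ∏ i, |x i| ^ (H i) ∧
      ρ x * ∏ i, |x i| ^ (H i) ≤ C * (1 + ‖x‖) ^ ((∑ i, (2 * H i - β i)) / 2) := by
  -- Evaluate the bound on `ρ` at the origin, where every decay factor equals 1.
  have hC : 0 ≤ C := by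
    have := (hρ 0).1.trans (hρ 0).2
    simpa using this
  refine ⟨hC, fun x => ⟨mul_nonneg (hρ x).1 (Finset.prod_nonneg fun i _ => by positivity), ?_⟩⟩
  calc ρ x * ∏ i, |x i| ^ (H i)
      ≤ (C * ∏ i, (1 + |x i|) ^ (-β i)) * ∏ i, |x i| ^ (H i) :=
        mul_le_mul_of_nonneg_right (hρ x).2 (Finset.prod_nonneg fun i _ => by positivity)
    _ = C * ∏ i, ((1 + |x i|) ^ (-β i) * |x i| ^ (H i)) := by
        rw [mul_assoc, Finset.prod_mul_distrib]
    _ ≤ C * ∏ i, (1 + ‖x‖) ^ ((2 * H i - β i) / 2) := by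
        refine mul_le_mul_of_nonneg_left (Finset.prod_le_prod (fun i _ => by positivity)
          fun i _ => ?_) hC
        have hx : 0 < 1 + |x i| := by positivity
        have hxi : |x i| ≤ ‖x‖ := by simpa using PiLp.norm_apply_le x i
        calc (1 + |x i|) ^ (-β i) * |x i| ^ (H i)
            ≤ (1 + |x i|) ^ (-β i) * (1 + |x i|) ^ (H i) := by
              gcongr
              · linarith [(hH i).1]
              · linarith
          _ = (1 + |x i|) ^ (-β i + H i) := (Real.rpow_add hx _ _).symm
          -- The exponent `H i - β i` may be negative, which would prevent replacing `|x i|` by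
          -- `‖x‖`. Giving up `β i / 2` yields the nonnegative exponent `(2 H i - β i)/2`, and these
          -- sum to `α/2`.
          _ ≤ (1 + |x i|) ^ ((2 * H i - β i) / 2) :=
              Real.rpow_le_rpow_of_exponent_le (by linarith [abs_nonneg (x i)])
                (by linarith [(hβ i).1])
          _ ≤ _ := Real.rpow_le_rpow hx.le (by linarith) (by linarith [hβH i])
    _ = _ := by
        rw [← Real.rpow_sum_of_pos (by positivity), Finset.sum_div]

lemma IsWeightedFractionalField.fieldSigma_le (hW : IsWeightedFractionalField H₀ H ρ W P) :
    fieldSigma W ≤ ‹MeasurableSpace Ω› := by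
  refine Measurable.comap_le (measurable_pi_lambda _ fun p => ?_)
  exact hW.measurable.comp (measurable_const.prodMk measurable_id)

lemma IsWeightedFractionalField.measurable_timeMollified (hW : IsWeightedFractionalField H₀ H ρ W P)
    (η : ℝ) : Measurable fun q : (ℝ × EuclideanSpace ℝ (Fin d)) × Ω =>
      timeMollified W η q.1.1 q.1.2 q.2 := by
  unfold timeMollified
  have h : ∀ f : (ℝ × EuclideanSpace ℝ (Fin d)) × Ω → ℝ≥0, Measurable f →
      Measurable fun q => W (f q) q.1.2 q.2 := fun f hf =>
    hW.measurable.comp (f := fun q : (ℝ × EuclideanSpace ℝ (Fin d)) × Ω => ((f q, q.1.2), q.2))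
      (by fun_prop)
  refine Measurable.div_const ((h _ ?_).sub (h _ ?_)) η <;> fun_prop

lemma IsWeightedFractionalField.memLp (hW : IsWeightedFractionalField H₀ H ρ W P) (s : ℝ≥0)
    (y : EuclideanSpace ℝ (Fin d)) : MemLp (W s y) 2 P :=
  (hW.gaussian.hasGaussianLaw_eval (s, y)).memLp_two

lemma IsWeightedFractionalField.memLp_timeMollified (hW : IsWeightedFractionalField H₀ H ρ W P)
    (η s : ℝ) (y : EuclideanSpace ℝ (Fin d)) : MemLp (timeMollified W η s y) 2 P := by
  have := ((hW.memLp s.toNNReal y).sub (hW.memLp (s - η).toNNReal y)).const_mul η⁻¹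
  refine this.ae_eq (ae_of_all _ fun ω => ?_)
  simp only [timeMollified, Pi.sub_apply]
  ring

lemma IsWeightedFractionalField.integral_timeMollified_mul
    (hW : IsWeightedFractionalField H₀ H ρ W P) (η η' s r : ℝ) (y z : EuclideanSpace ℝ (Fin d)) :
    ∫ ω, timeMollified W η s y ω * timeMollified W η' r z ω ∂P =
      mollifiedCov H₀ η η' s r * spaceCov H ρ y z := by
  have hi : ∀ u v : ℝ≥0, Integrable (fun ω => W u y ω * W v z ω) P := fun u v =>
    (hW.memLp u y).integrable_mul (hW.memLp v z)
  have e : ∀ ω, timeMollified W η s y ω * timeMollified W η' r z ω =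
      (W s.toNNReal y ω * W r.toNNReal z ω - W s.toNNReal y ω * W (r - η').toNNReal z ω
      - W (s - η).toNNReal y ω * W r.toNNReal z ω
      + W (s - η).toNNReal y ω * W (r - η').toNNReal z ω) / (η * η') := by
    intro ω; simp only [timeMollified]; rw [div_mul_div_comm]; congr 1; ring
  simp_rw [e]
  have hsub : ∀ f g : Ω → ℝ, Integrable f P → Integrable g P →
      Integrable (fun ω => f ω - g ω) P := fun f g hf hg => hf.sub hg
  rw [integral_div, integral_add (hsub _ _ (hsub _ _ (hi _ _) (hi _ _)) (hi _ _)) (hi _ _),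
    integral_sub (hsub _ _ (hi _ _) (hi _ _)) (hi _ _), integral_sub (hi _ _) (hi _ _)]
  simp only [hW.covariance, Real.coe_toNNReal', fbmCov_comm H₀ (max r 0),
    fbmCov_comm H₀ (max (r - η') 0)]
  unfold mollifiedCov spaceCov
  ring

/-- Since `R_{H₀}(1, 1) = 1`, the spatial kernel is the covariance of the field at time 1.
Cauchy–Schwarz for `W 1 y` and `W 1 z` then replaces any direct analysis of the product of the
`fbmCov (H i)`. -/
lemma IsWeightedFractionalField.abs_spaceCov_le (hW : IsWeightedFractionalField H₀ H ρ W P)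
    (hH₀ : H₀ ∈ Set.Ioo (1 / 2 : ℝ) 1) (hH : ∀ i, H i ∈ Set.Ioo (1 / 2 : ℝ) 1)
    {g : EuclideanSpace ℝ (Fin d) → ℝ} (hg : ∀ x, 0 ≤ ρ x * ∏ i, |x i| ^ (H i) ∧
      ρ x * ∏ i, |x i| ^ (H i) ≤ g x) (y z : EuclideanSpace ℝ (Fin d)) :
    |spaceCov H ρ y z| ≤ g y * g z := by
  have h1 : fbmCov H₀ 1 1 = 1 := by
    rw [fbmCov_self (by linarith [hH₀.1])]; simp
  have hc : ∀ y z, ∫ ω, W 1 y ω * W 1 z ω ∂P = spaceCov H ρ y z := by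
    intro y z
    rw [hW.covariance, NNReal.coe_one, h1, one_mul, spaceCov]
  have hs : ∀ x, ∫ ω, W 1 x ω * W 1 x ω ∂P ≤ g x ^ 2 := fun x => by
    rw [hc, spaceCov_self hH]
    exact pow_le_pow_left₀ (hg x).1 (hg x).2 2
  rw [← hc]
  exact (abs_integral_le_integral_abs).trans (integral_abs_mul_le_of_sq_le (hW.memLp 1 y)
    (hW.memLp 1 z) ((hg y).1.trans (hg y).2) ((hg z).1.trans (hg z).2) (hs y) (hs z))

lemma IsWeightedFractionalField.integral_timeMollified_sq_le
    (hW : IsWeightedFractionalField H₀ H ρ W P)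
    (hH₀ : H₀ ∈ Set.Ioo (1 / 2 : ℝ) 1) (hH : ∀ i, H i ∈ Set.Ioo (1 / 2 : ℝ) 1)
    {g : EuclideanSpace ℝ (Fin d) → ℝ} (hg : ∀ x, 0 ≤ ρ x * ∏ i, |x i| ^ (H i) ∧
      ρ x * ∏ i, |x i| ^ (H i) ≤ g x) {η : ℝ} (hη : 0 < η) (s : ℝ)
    (y : EuclideanSpace ℝ (Fin d)) :
    ∫ ω, timeMollified W η s y ω * timeMollified W η s y ω ∂P ≤
      (Real.sqrt (η ^ (2 * H₀) / (η * η)) * g y) ^ 2 := by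
  rw [hW.integral_timeMollified_mul, mul_pow, Real.sq_sqrt (by positivity), spaceCov_self hH]
  have h2 : (ρ y * ∏ i, |y i| ^ (H i)) ^ 2 ≤ g y ^ 2 := pow_le_pow_left₀ (hg y).1 (hg y).2 2
  exact mul_le_mul (mollifiedCov_self_le hH₀ hη s) h2 (sq_nonneg _) (by positivity)

end Field

/-! ### Tame paths and the dominating function -/

/-- A random curve in `ℝ^d`, with continuous paths and measurable with respect to `mB`, such that
`(1 + ‖b s‖) ^ (2 * γ)` has exponential moments of all orders, uniformly in `s ∈ [0, T]`. -/
structure IsTamePath {Ω : Type*} (mB : MeasurableSpace Ω) [mΩ : MeasurableSpace Ω] {d : ℕ}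
    (P : Measure Ω) (T γ : ℝ) (b : ℝ → Ω → EuclideanSpace ℝ (Fin d)) : Prop where
  le : mB ≤ mΩ
  continuous : ∀ ω, Continuous fun s => b s ω
  measurable : ∀ s, Measurable[mB] (b s)
  exp_moment : ∀ c : ℝ, 0 ≤ c → ∃ D : ℝ, ∀ s ∈ Set.Icc 0 T,
    ∫⁻ ω, ENNReal.ofReal (Real.exp (c * (1 + ‖b s ω‖) ^ (2 * γ))) ∂P ≤ ENNReal.ofReal D

/-- The product of Lebesgue measure on `[t, T]` and the standard Gaussian measure. -/
abbrev timeHeat (d : ℕ) (t T : ℝ) : Measure (ℝ × EuclideanSpace ℝ (Fin d)) :=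
  (volume.restrict (Set.Icc t T)).prod (heatMeasure d)

/-- Lebesgue measure on `[t, T] × ℝ^d`. -/
abbrev timeSpace (d : ℕ) (t T : ℝ) : Measure (ℝ × EuclideanSpace ℝ (Fin d)) :=
  (volume.restrict (Set.Icc t T)).prod volume

section Weight

variable {d : ℕ}

/-- The growth weight `(1 + ‖x‖) ^ γ`. -/
def growth (γ : ℝ) (x : EuclideanSpace ℝ (Fin d)) : ℝ := (1 + ‖x‖) ^ γ

lemma growth_nonneg (γ : ℝ) (x : EuclideanSpace ℝ (Fin d)) : 0 ≤ growth γ x := by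
  unfold growth; positivity

lemma continuous_growth {γ : ℝ} (hγ : 0 ≤ γ) :
    Continuous (growth γ : EuclideanSpace ℝ (Fin d) → ℝ) :=
  (continuous_const.add continuous_norm).rpow_const fun _ => Or.inr hγ

@[fun_prop]
lemma measurable_growth (γ : ℝ) :
    Measurable (growth γ : EuclideanSpace ℝ (Fin d) → ℝ) := by
  unfold growth; fun_prop

/-- Submultiplicativity of `1 + ‖·‖` separates the path from the displacement. As `γ < 1`, the
displacement enters at most linearly, so a first Gaussian moment is all that is required. -/
lemma growth_sub_smul_le {γ : ℝ} (hγ : γ ∈ Set.Ico (0 : ℝ) 1) {ε : ℝ} (x z : EuclideanSpace ℝ (Fin d)) :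
    growth γ (x - Real.sqrt ε • z) ≤ (1 + Real.sqrt ε) * (growth γ x * (1 + ‖z‖)) := by
  have hs := Real.sqrt_nonneg ε
  have h1 : 1 + ‖x - Real.sqrt ε • z‖ ≤ (1 + ‖x‖) * (1 + Real.sqrt ε * ‖z‖) := by
    have := norm_sub_le x (Real.sqrt ε • z)
    rw [norm_smul, Real.norm_of_nonneg hs] at this
    nlinarith [mul_nonneg (norm_nonneg x) (mul_nonneg hs (norm_nonneg z))]
  have h2 : (1 + Real.sqrt ε * ‖z‖) ^ γ ≤ 1 + Real.sqrt ε * ‖z‖ := by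
    have h0 : 1 ≤ 1 + Real.sqrt ε * ‖z‖ := by
      linarith [mul_nonneg hs (norm_nonneg z)]
    simpa using Real.rpow_le_rpow_of_exponent_le h0 hγ.2.le
  have h3 : 1 + Real.sqrt ε * ‖z‖ ≤ (1 + Real.sqrt ε) * (1 + ‖z‖) := by
    nlinarith [norm_nonneg z]
  unfold growth
  calc _ ≤ ((1 + ‖x‖) * (1 + Real.sqrt ε * ‖z‖)) ^ γ :=
        Real.rpow_le_rpow (by positivity) h1 hγ.1
    _ = (1 + ‖x‖) ^ γ * (1 + Real.sqrt ε * ‖z‖) ^ γ :=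
        Real.mul_rpow (by positivity) (by positivity)
    _ ≤ (1 + ‖x‖) ^ γ * ((1 + Real.sqrt ε) * (1 + ‖z‖)) := by
        gcongr; exact h2.trans h3
    _ = _ := by ring

end Weight

section Path

variable {Ω : Type*} {mB : MeasurableSpace Ω} [mΩ : MeasurableSpace Ω] {d : ℕ} {P : Measure Ω}
  {T γ : ℝ} {b : ℝ → Ω → EuclideanSpace ℝ (Fin d)}

lemma IsTamePath.measurable_uncurry (hb : IsTamePath mB P T γ b) :
    Measurable (Function.uncurry b) :=
  measurable_uncurry_of_continuous_of_measurable hb.continuous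
    fun s => (hb.measurable s).mono hb.le le_rfl

lemma IsTamePath.exists_lintegral_growth_le (hb : IsTamePath mB P T γ b) :
    ∃ D : ℝ, ∀ s ∈ Set.Icc 0 T, ∀ r ∈ Set.Icc 0 T,
      ∫⁻ ω, ENNReal.ofReal (growth γ (b s ω) * growth γ (b r ω)) ∂P ≤ ENNReal.ofReal D := by
  obtain ⟨D, hD⟩ := hb.exp_moment 1 zero_le_one
  refine ⟨2 * max D 0, fun s hs r hr => ?_⟩
  have hm : ∀ s, Measurable (b s) := fun s => (hb.measurable s).mono hb.le le_rfl
  have hsq : ∀ x : EuclideanSpace ℝ (Fin d), growth γ x ^ 2 ≤ Real.exp (1 * (1 + ‖x‖) ^ (2 * γ)) := by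
    intro x
    have e : growth γ x ^ 2 = (1 + ‖x‖) ^ (2 * γ) := by
      rw [growth, ← Real.rpow_natCast, ← Real.rpow_mul (by positivity)]; push_cast; ring_nf
    rw [e, one_mul]
    linarith [Real.add_one_le_exp ((1 + ‖x‖) ^ (2 * γ))]
  calc ∫⁻ ω, ENNReal.ofReal (growth γ (b s ω) * growth γ (b r ω)) ∂P
      ≤ ∫⁻ ω, (ENNReal.ofReal (Real.exp (1 * (1 + ‖b s ω‖) ^ (2 * γ))) +
          ENNReal.ofReal (Real.exp (1 * (1 + ‖b r ω‖) ^ (2 * γ)))) ∂P := by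
        refine lintegral_mono fun ω => ?_
        rw [← ENNReal.ofReal_add (Real.exp_nonneg _) (Real.exp_nonneg _)]
        refine ENNReal.ofReal_le_ofReal ?_
        have h1 := hsq (b s ω)
        have h2 := hsq (b r ω)
        nlinarith [sq_nonneg (growth γ (b s ω) - growth γ (b r ω)), sq_nonneg (growth γ (b s ω)),
          sq_nonneg (growth γ (b r ω))]
    _ ≤ ENNReal.ofReal D + ENNReal.ofReal D := by
        rw [lintegral_add_left (by have := hm s; fun_prop)]
        exact add_le_add (hD s hs) (hD r hr)
    _ ≤ _ := by
        rw [two_mul, ENNReal.ofReal_add (le_max_right _ _) (le_max_right _ _)]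
        gcongr <;> exact le_max_left _ _

/-- The dominating function for the second moments. -/
def dominant (γ : ℝ) (b : ℝ → Ω → EuclideanSpace ℝ (Fin d)) (k : ℝ × ℝ → ℝ)
    (q : Ω × ((ℝ × EuclideanSpace ℝ (Fin d)) × (ℝ × EuclideanSpace ℝ (Fin d)))) : ℝ :=
  k (q.2.1.1, q.2.2.1) * ((growth γ (b q.2.1.1 q.1) * growth γ (b q.2.2.1 q.1)) *
    ((1 + ‖q.2.1.2‖) * (1 + ‖q.2.2.2‖)))

lemma IsTamePath.measurable_comp {R : Type*} [MeasurableSpace R] (hb : IsTamePath mB P T γ b)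
    {f : R → ℝ} {g : R → Ω} (hf : Measurable f) (hg : Measurable g) :
    Measurable fun q => b (f q) (g q) :=
  hb.measurable_uncurry.comp (hf.prodMk hg)

lemma IsTamePath.measurable_dominant (hb : IsTamePath mB P T γ b) {k : ℝ × ℝ → ℝ}
    (hk : Measurable k) : Measurable (dominant γ b k) := by
  unfold dominant
  have h1 : Measurable fun q : Ω × ((ℝ × EuclideanSpace ℝ (Fin d)) × (ℝ × EuclideanSpace ℝ (Fin d))) =>
    b q.2.1.1 q.1 := hb.measurable_comp (by fun_prop) (by fun_prop)
  have h2 : Measurable fun q : Ω × ((ℝ × EuclideanSpace ℝ (Fin d)) × (ℝ × EuclideanSpace ℝ (Fin d))) =>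
    b q.2.2.1 q.1 := hb.measurable_comp (by fun_prop) (by fun_prop)
  exact (hk.comp (by fun_prop)).mul
    ((((measurable_growth γ).comp h1).mul ((measurable_growth γ).comp h2)).mul (by fun_prop))

/-- By Tonelli the integral splits: the expectation of the growth factors is bounded uniformly in
the two times, each Gaussian variable contributes its first moment, and only the time integral of
`k` remains. -/
lemma IsTamePath.integrable_dominant [SFinite P] (hb : IsTamePath mB P T γ b) {t : ℝ} (ht : 0 ≤ t)
    {k : ℝ × ℝ → ℝ} (hk : Measurable k) (hk0 : ∀ x, 0 ≤ k x)
    (hkT : ∫⁻ x, ENNReal.ofReal (k x)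
      ∂((volume.restrict (Set.Icc t T)).prod (volume.restrict (Set.Icc t T))) < ∞) :
    Integrable (dominant γ b k) (P.prod ((timeHeat d t T).prod (timeHeat d t T))) := by
  obtain ⟨D, hD⟩ := hb.exists_lintegral_growth_le
  have hm := hb.measurable_dominant hk
  refine ⟨hm.aestronglyMeasurable, ?_⟩
  have h0 : ∀ q, 0 ≤ dominant γ b k q := fun q => by
    have := growth_nonneg γ (b q.2.1.1 q.1)
    have := growth_nonneg γ (b q.2.2.1 q.1)
    have := hk0 (q.2.1.1, q.2.2.1)
    unfold dominant; positivity
  have hbm : ∀ s, Measurable (b s) := fun s => (hb.measurable s).mono hb.le le_rfl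
  rw [hasFiniteIntegral_iff_ofReal (ae_of_all _ h0), lintegral_prod_symm _ (by fun_prop),
    lintegral_prod _ (by fun_prop), lintegral_prod _ (by fun_prop)]
  have hG : ∫⁻ z, ENNReal.ofReal (1 + ‖z‖) ∂(heatMeasure d) ≠ ∞ :=
    lintegral_one_add_norm_heatMeasure_lt_top.ne
  set G := ∫⁻ z, ENNReal.ofReal (1 + ‖z‖) ∂(heatMeasure d) with hG_def
  have hIcc : ∀ᵐ s ∂(volume.restrict (Set.Icc t T)), s ∈ Set.Icc 0 T := by
    filter_upwards [ae_restrict_mem measurableSet_Icc] with s hs using ⟨ht.trans hs.1, hs.2⟩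
  have inner : ∀ᵐ s ∂(volume.restrict (Set.Icc t T)), ∀ z : EuclideanSpace ℝ (Fin d),
      ∫⁻ y : ℝ × EuclideanSpace ℝ (Fin d), ∫⁻ ω, ENNReal.ofReal (dominant γ b k (ω, ((s, z), y))) ∂P
        ∂(timeHeat d t T) ≤
      ENNReal.ofReal (1 + ‖z‖) * (G * ENNReal.ofReal D *
        ∫⁻ r in Set.Icc t T, ENNReal.ofReal (k (s, r))) := by
    filter_upwards [hIcc] with s hs z
    rw [lintegral_prod _ (by fun_prop), ← lintegral_const_mul' _ _ (by finiteness),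
      ← lintegral_const_mul' _ _ (by finiteness)]
    refine lintegral_mono_ae ?_
    filter_upwards [hIcc] with r hr
    rw [hG_def, ← mul_assoc, ← mul_assoc, mul_comm (ENNReal.ofReal (1 + ‖z‖)), mul_assoc, mul_assoc,
      ← lintegral_mul_const' _ _ (by finiteness)]
    refine lintegral_mono fun z' => ?_
    simp only [dominant]
    have e : ∀ ω, ENNReal.ofReal (k (s, r) * ((growth γ (b s ω) * growth γ (b r ω)) *
        ((1 + ‖z‖) * (1 + ‖z'‖)))) = ENNReal.ofReal (growth γ (b s ω) * growth γ (b r ω)) *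
        (ENNReal.ofReal (k (s, r)) * (ENNReal.ofReal (1 + ‖z‖) * ENNReal.ofReal (1 + ‖z'‖))) := by
      intro ω
      have h1 := growth_nonneg γ (b s ω)
      have h2 := growth_nonneg γ (b r ω)
      rw [← ENNReal.ofReal_mul (by positivity), ← ENNReal.ofReal_mul (hk0 _),
        ← ENNReal.ofReal_mul (by positivity)]
      congr 1; ring
    simp_rw [e]
    rw [lintegral_mul_const' _ _ (by finiteness)]
    refine (mul_le_mul_left (hD s hs r hr) _).trans (le_of_eq ?_)
    ring
  calc _ ≤ ∫⁻ s in Set.Icc t T, ∫⁻ z, ENNReal.ofReal (1 + ‖z‖) * (G * ENNReal.ofReal D *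
        ∫⁻ r in Set.Icc t T, ENNReal.ofReal (k (s, r))) ∂(heatMeasure d) := by
        refine lintegral_mono_ae ?_
        filter_upwards [inner] with s hs
        exact lintegral_mono fun z => hs z
    _ = G * (G * ENNReal.ofReal D) * ∫⁻ x, ENNReal.ofReal (k x)
      ∂((volume.restrict (Set.Icc t T)).prod (volume.restrict (Set.Icc t T))) := by
        rw [lintegral_prod _ (by fun_prop), ← lintegral_const_mul' _ _ (by finiteness)]
        refine lintegral_congr fun s => ?_
        rw [lintegral_mul_const _ (by fun_prop), ← hG_def, mul_assoc, mul_assoc, mul_assoc]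
    _ < ∞ := by finiteness

end Path

/-! ### Change of variables for a pair of smoothed curves -/

section ChangeOfVariables

variable {d : ℕ}

/-- The curve `x`, perturbed by a multiple of the space variable. -/
def perturb (ε : ℝ) (x : ℝ → EuclideanSpace ℝ (Fin d)) (a : ℝ × EuclideanSpace ℝ (Fin d)) :
    ℝ × EuclideanSpace ℝ (Fin d) :=
  (a.1, x a.1 - Real.sqrt ε • a.2)

lemma measurable_perturb (ε : ℝ) {x : ℝ → EuclideanSpace ℝ (Fin d)} (hx : Measurable x) :
    Measurable (perturb ε x) := by
  unfold perturb; fun_prop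

lemma measurable_heatKernel_sub (ε : ℝ) {x : ℝ → EuclideanSpace ℝ (Fin d)} (hx : Measurable x) :
    Measurable fun a : ℝ × EuclideanSpace ℝ (Fin d) => heatKernel ε (x a.1 - a.2) := by
  have := (continuous_heatKernel (d := d) ε).measurable
  fun_prop

lemma prod_withDensity_heatKernel_eq_map {ε ε' : ℝ} (hε : 0 < ε) (hε' : 0 < ε') (t T : ℝ)
    {x x' : ℝ → EuclideanSpace ℝ (Fin d)} (hx : Measurable x) (hx' : Measurable x') :
    ((timeSpace d t T).prod (timeSpace d t T)).withDensity (fun c =>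
      ENNReal.ofReal (heatKernel ε (x c.1.1 - c.1.2) * heatKernel ε' (x' c.2.1 - c.2.2))) =
    ((timeHeat d t T).prod (timeHeat d t T)).map (Prod.map (perturb ε x) (perturb ε' x')) := by
  rw [← Measure.map_prod_map _ _ (measurable_perturb ε hx) (measurable_perturb ε' hx')]
  have h1 := withDensity_heatKernel_eq_map hε (volume.restrict (Set.Icc t T)) hx
  have h2 := withDensity_heatKernel_eq_map hε' (volume.restrict (Set.Icc t T)) hx'
  unfold perturb
  rw [← h1, ← h2, prod_withDensity (measurable_heatKernel_sub ε hx).ennreal_ofReal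
    (measurable_heatKernel_sub ε' hx').ennreal_ofReal]
  congr 1
  ext c
  rw [ENNReal.ofReal_mul (heatKernel_nonneg hε.le _)]

lemma lintegral_heatKernel_mul_heatKernel {ε ε' : ℝ} (hε : 0 < ε) (hε' : 0 < ε') (t T : ℝ)
    {x x' : ℝ → EuclideanSpace ℝ (Fin d)} (hx : Measurable x) (hx' : Measurable x')
    {F : (ℝ × EuclideanSpace ℝ (Fin d)) × (ℝ × EuclideanSpace ℝ (Fin d)) → ℝ≥0∞}
    (hF : Measurable F) :
    ∫⁻ c, ENNReal.ofReal (heatKernel ε (x c.1.1 - c.1.2) * heatKernel ε' (x' c.2.1 - c.2.2)) * F c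
      ∂((timeSpace d t T).prod (timeSpace d t T)) =
    ∫⁻ c, F (perturb ε x c.1, perturb ε' x' c.2) ∂((timeHeat d t T).prod (timeHeat d t T)) := by
  have hk : Measurable fun c : (ℝ × EuclideanSpace ℝ (Fin d)) × (ℝ × EuclideanSpace ℝ (Fin d)) =>
      ENNReal.ofReal (heatKernel ε (x c.1.1 - c.1.2) * heatKernel ε' (x' c.2.1 - c.2.2)) :=
    (((measurable_heatKernel_sub ε hx).comp measurable_fst).mul
      ((measurable_heatKernel_sub ε' hx').comp measurable_snd)).ennreal_ofReal
  have h := lintegral_withDensity_eq_lintegral_mul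
    ((timeSpace d t T).prod (timeSpace d t T)) hk hF
  simp only [Pi.mul_apply] at h
  rw [← h, prod_withDensity_heatKernel_eq_map hε hε' t T hx hx',
    lintegral_map hF ((measurable_perturb ε hx).prodMap (measurable_perturb ε' hx'))]
  rfl

lemma integral_heatKernel_mul_heatKernel {ε ε' : ℝ} (hε : 0 < ε) (hε' : 0 < ε') (t T : ℝ)
    {x x' : ℝ → EuclideanSpace ℝ (Fin d)} (hx : Measurable x) (hx' : Measurable x')
    {F : (ℝ × EuclideanSpace ℝ (Fin d)) × (ℝ × EuclideanSpace ℝ (Fin d)) → ℝ}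
    (hF : Measurable F) :
    ∫ c, heatKernel ε (x c.1.1 - c.1.2) * heatKernel ε' (x' c.2.1 - c.2.2) * F c
      ∂((timeSpace d t T).prod (timeSpace d t T)) =
    ∫ c, F (perturb ε x c.1, perturb ε' x' c.2) ∂((timeHeat d t T).prod (timeHeat d t T)) := by
  have hk : Measurable fun c : (ℝ × EuclideanSpace ℝ (Fin d)) × (ℝ × EuclideanSpace ℝ (Fin d)) =>
      ENNReal.ofReal (heatKernel ε (x c.1.1 - c.1.2) * heatKernel ε' (x' c.2.1 - c.2.2)) :=
    (((measurable_heatKernel_sub ε hx).comp measurable_fst).mul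
      ((measurable_heatKernel_sub ε' hx').comp measurable_snd)).ennreal_ofReal
  have h := integral_withDensity_eq_integral_toReal_smul
    (μ := (timeSpace d t T).prod (timeSpace d t T)) hk (ae_of_all _ fun _ => ENNReal.ofReal_lt_top) F
  simp only [smul_eq_mul] at h
  rw [prod_withDensity_heatKernel_eq_map hε hε' t T hx hx', integral_map
    ((measurable_perturb ε hx).prodMap (measurable_perturb ε' hx')).aemeasurable
    hF.aestronglyMeasurable] at h
  refine Eq.trans ?_ h.symm
  refine integral_congr_ae (ae_of_all _ fun c => ?_)
  simp only
  rw [ENNReal.toReal_ofReal (mul_nonneg (heatKernel_nonneg hε.le _) (heatKernel_nonneg hε'.le _))]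

end ChangeOfVariables

/-! ### Covariances of the approximations and their limit -/

/-- A weighted fractional field together with an independent tame path. -/
structure IsFieldAlongPath {Ω : Type*} (mB : MeasurableSpace Ω) [mΩ : MeasurableSpace Ω] {d : ℕ}
    (P : Measure Ω) (H₀ : ℝ) (H : Fin d → ℝ) (ρ : EuclideanSpace ℝ (Fin d) → ℝ)
    (W : ℝ≥0 → EuclideanSpace ℝ (Fin d) → Ω → ℝ) (b : ℝ → Ω → EuclideanSpace ℝ (Fin d))
    (t T γ C : ℝ) : Prop where
  field : IsWeightedFractionalField H₀ H ρ W P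
  path : IsTamePath mB P T γ b
  indep : Indep mB (fieldSigma W) P
  hurst_time : H₀ ∈ Set.Ioo (1 / 2 : ℝ) 1
  hurst_space : ∀ i, H i ∈ Set.Ioo (1 / 2 : ℝ) 1
  continuous_weight : Continuous ρ
  const_nonneg : 0 ≤ C
  growth_exponent : γ ∈ Set.Ico (0 : ℝ) 1
  deviation_le : ∀ x, 0 ≤ ρ x * ∏ i, |x i| ^ (H i) ∧ ρ x * ∏ i, |x i| ^ (H i) ≤ C * growth γ x
  start_nonneg : 0 ≤ t

/-- The integral of the mollified noise along a path, as an integral over `[t, T] × ℝ^d`. -/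
def pathIntegral {Ω : Type*} {d : ℕ} (W : ℝ≥0 → EuclideanSpace ℝ (Fin d) → Ω → ℝ)
    (b : ℝ → Ω → EuclideanSpace ℝ (Fin d)) (t T ε η : ℝ) (ω : Ω) : ℝ :=
  ∫ a, heatKernel ε (b a.1 ω - a.2) * timeMollified W η a.1 a.2 ω ∂(timeSpace d t T)

/-- The singular kernel dominating the mollified covariances. -/
def singularKernel (H : ℝ) (x : ℝ × ℝ) : ℝ :=
  2 * H * (1 / 2) ^ (2 * H - 2) * |x.1 - x.2| ^ (2 * H - 2)

lemma measurable_singularKernel (H : ℝ) : Measurable (singularKernel H) := by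
  unfold singularKernel; fun_prop

lemma singularKernel_nonneg {H : ℝ} (hH : 0 ≤ H) (x : ℝ × ℝ) : 0 ≤ singularKernel H x := by
  unfold singularKernel; positivity

lemma exists_lintegral_singularKernel_le {H : ℝ} (hH : H ∈ Set.Ioo (1 / 2 : ℝ) 1) {T : ℝ}
    (hT : 0 ≤ T) : ∃ M : ℝ, 0 ≤ M ∧ ∀ s ∈ Set.Icc 0 T,
      ∫⁻ r in Set.Icc 0 T, ENNReal.ofReal (singularKernel H (s, r)) ≤ ENNReal.ofReal M := by
  obtain ⟨M, hM0, hM⟩ := exists_lintegral_abs_sub_rpow_le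
    (by linarith [hH.1] : -1 < 2 * H - 2) T hT
  have h0 : 0 ≤ 2 * H * (1 / 2) ^ (2 * H - 2) := by
    have := hH.1
    positivity
  refine ⟨2 * H * (1 / 2) ^ (2 * H - 2) * M, by positivity, fun s hs => ?_⟩
  unfold singularKernel
  simp_rw [ENNReal.ofReal_mul h0]
  rw [lintegral_const_mul' _ _ (by finiteness)]
  gcongr
  exact hM s hs

lemma lintegral_singularKernel_lt_top {H : ℝ} (hH : H ∈ Set.Ioo (1 / 2 : ℝ) 1) {t T : ℝ}
    (ht : 0 ≤ t) : ∫⁻ x, ENNReal.ofReal (singularKernel H x)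
      ∂((volume.restrict (Set.Icc t T)).prod (volume.restrict (Set.Icc t T))) < ∞ := by
  have hm := measurable_singularKernel H
  rcases lt_or_ge T 0 with hT | hT
  · simp [Set.Icc_eq_empty (by linarith : ¬ t ≤ T)]
  obtain ⟨M, -, hM⟩ := exists_lintegral_singularKernel_le hH hT
  rw [lintegral_prod _ (by fun_prop)]
  calc _ ≤ ∫⁻ s in Set.Icc t T, ENNReal.ofReal M := by
        refine lintegral_mono_ae ?_
        filter_upwards [ae_restrict_mem measurableSet_Icc] with s hs
        refine le_trans ?_ (hM s ⟨ht.trans hs.1, hs.2⟩)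
        exact lintegral_mono_set (Set.Icc_subset_Icc_left ht)
    _ < ∞ := by
        rw [lintegral_const]
        finiteness

/-- The bound and the limit of the mollified covariance are only available off the diagonal, the
limit also only at positive times; what is excluded is a null set. -/
lemma ae_time_ne_and_pos {Ω : Type*} [MeasurableSpace Ω] {P : Measure Ω} [SFinite P] {d : ℕ}
    {t T : ℝ} (ht : 0 ≤ t) :
    ∀ᵐ q ∂(P.prod ((timeHeat d t T).prod (timeHeat d t T))),
      0 < q.2.1.1 ∧ 0 < q.2.2.1 ∧ q.2.1.1 ≠ q.2.2.1 := by
  have h1 : ∀ᵐ s ∂(volume.restrict (Set.Icc t T)), 0 < s := by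
    filter_upwards [ae_restrict_mem measurableSet_Icc,
      ae_restrict_of_ae (Measure.ae_ne volume (0 : ℝ))] with s hs hs0
    exact lt_of_le_of_ne (ht.trans hs.1) (Ne.symm hs0)
  have h2 : ∀ᵐ x ∂((volume.restrict (Set.Icc t T)).prod (volume.restrict (Set.Icc t T))),
      0 < x.1 ∧ 0 < x.2 ∧ x.1 ≠ x.2 := by
    have hms : MeasurableSet {x : ℝ × ℝ | 0 < x.1 ∧ 0 < x.2 ∧ x.1 ≠ x.2} :=
      (measurableSet_lt measurable_const measurable_fst).inter
        ((measurableSet_lt measurable_const measurable_snd).inter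
          (measurableSet_eq_fun measurable_fst measurable_snd).compl)
    refine (Measure.ae_prod_mem_iff_ae_ae_mem hms).2 ?_
    filter_upwards [h1] with s hs
    filter_upwards [h1, ae_restrict_of_ae (Measure.ae_ne volume s)] with r hr hrs
    exact ⟨hs, hr, Ne.symm hrs⟩
  have hq : Measure.QuasiMeasurePreserving
      (fun q : Ω × ((ℝ × EuclideanSpace ℝ (Fin d)) × (ℝ × EuclideanSpace ℝ (Fin d))) =>
        (q.2.1.1, q.2.2.1)) (P.prod ((timeHeat d t T).prod (timeHeat d t T)))
      ((volume.restrict (Set.Icc t T)).prod (volume.restrict (Set.Icc t T))) :=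
    (measurePreserving_fst.prod measurePreserving_fst).quasiMeasurePreserving.comp
      Measure.quasiMeasurePreserving_snd
  exact hq.ae h2

lemma dominant_mul {Ω : Type*} {d : ℕ} (γ : ℝ) (b : ℝ → Ω → EuclideanSpace ℝ (Fin d)) (k : ℝ × ℝ → ℝ)
    (q : Ω × ((ℝ × EuclideanSpace ℝ (Fin d)) × (ℝ × EuclideanSpace ℝ (Fin d)))) :
    dominant γ b k q = k (q.2.1.1, q.2.2.1) * dominant γ b 1 q := by
  simp [dominant]

lemma dominant_nonneg {Ω : Type*} {d : ℕ} (γ : ℝ) (b : ℝ → Ω → EuclideanSpace ℝ (Fin d)) {k : ℝ × ℝ → ℝ}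
    (hk : ∀ x, 0 ≤ k x)
    (q : Ω × ((ℝ × EuclideanSpace ℝ (Fin d)) × (ℝ × EuclideanSpace ℝ (Fin d)))) :
    0 ≤ dominant γ b k q := by
  have := growth_nonneg γ (b q.2.1.1 q.1)
  have := growth_nonneg γ (b q.2.2.1 q.1)
  have := hk (q.2.1.1, q.2.2.1)
  unfold dominant; positivity

namespace IsFieldAlongPath

variable {Ω : Type*} {mB : MeasurableSpace Ω} [mΩ : MeasurableSpace Ω] {d : ℕ} {P : Measure Ω}
  {H₀ : ℝ} {H : Fin d → ℝ} {ρ : EuclideanSpace ℝ (Fin d) → ℝ}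
  {W : ℝ≥0 → EuclideanSpace ℝ (Fin d) → Ω → ℝ} {b : ℝ → Ω → EuclideanSpace ℝ (Fin d)}
  {t T γ C : ℝ}

lemma measurable_path (h : IsFieldAlongPath mB P H₀ H ρ W b t T γ C) (ω : Ω) :
    Measurable fun s => b s ω := (h.path.continuous ω).measurable

lemma abs_spaceCov_le (h : IsFieldAlongPath mB P H₀ H ρ W b t T γ C) {ε ε' : ℝ}
    (q : Ω × ((ℝ × EuclideanSpace ℝ (Fin d)) × (ℝ × EuclideanSpace ℝ (Fin d)))) :
    |spaceCov H ρ (b q.2.1.1 q.1 - Real.sqrt ε • q.2.1.2) (b q.2.2.1 q.1 - Real.sqrt ε' • q.2.2.2)| ≤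
      C ^ 2 * ((1 + Real.sqrt ε) * (1 + Real.sqrt ε')) * dominant γ b 1 q := by
  refine (h.field.abs_spaceCov_le h.hurst_time h.hurst_space h.deviation_le _ _).trans ?_
  have h1 := growth_sub_smul_le h.growth_exponent (ε := ε) (b q.2.1.1 q.1) q.2.1.2
  have h2 := growth_sub_smul_le h.growth_exponent (ε := ε') (b q.2.2.1 q.1) q.2.2.2
  have h3 := mul_le_mul h1 h2 (growth_nonneg _ _) ((growth_nonneg _ _).trans h1)
  calc _ = C ^ 2 * (growth γ (b q.2.1.1 q.1 - Real.sqrt ε • q.2.1.2) *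
        growth γ (b q.2.2.1 q.1 - Real.sqrt ε' • q.2.2.2)) := by ring
    _ ≤ _ := mul_le_mul_of_nonneg_left h3 (sq_nonneg C)
    _ = _ := by simp only [dominant, Pi.one_apply]; ring

/-- The integrand of the covariance of two mollified integrals. -/
def covIntegrand (H₀ : ℝ) (H : Fin d → ℝ) (ρ : EuclideanSpace ℝ (Fin d) → ℝ)
    (b : ℝ → Ω → EuclideanSpace ℝ (Fin d)) (p p' : ℝ × ℝ)
    (q : Ω × ((ℝ × EuclideanSpace ℝ (Fin d)) × (ℝ × EuclideanSpace ℝ (Fin d)))) : ℝ :=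
  mollifiedCov H₀ p.2 p'.2 q.2.1.1 q.2.2.1 *
    spaceCov H ρ (b q.2.1.1 q.1 - Real.sqrt p.1 • q.2.1.2) (b q.2.2.1 q.1 - Real.sqrt p'.1 • q.2.2.2)

lemma measurable_covIntegrand (h : IsFieldAlongPath mB P H₀ H ρ W b t T γ C) (p p' : ℝ × ℝ) :
    Measurable (covIntegrand H₀ H ρ b p p') := by
  have h1 : Measurable fun q : Ω × ((ℝ × EuclideanSpace ℝ (Fin d)) × (ℝ × EuclideanSpace ℝ (Fin d))) =>
    b q.2.1.1 q.1 := h.path.measurable_comp (by fun_prop) (by fun_prop)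
  have h2 : Measurable fun q : Ω × ((ℝ × EuclideanSpace ℝ (Fin d)) × (ℝ × EuclideanSpace ℝ (Fin d))) =>
    b q.2.2.1 q.1 := h.path.measurable_comp (by fun_prop) (by fun_prop)
  have h3 := (continuous_mollifiedCov (by linarith [h.hurst_time.1] : 0 < H₀) p.2 p'.2).measurable
  have h4 := (continuous_spaceCov h.hurst_space h.continuous_weight).measurable
  exact (h3.comp (f := fun q : Ω × ((ℝ × EuclideanSpace ℝ (Fin d)) ×
      (ℝ × EuclideanSpace ℝ (Fin d))) => (q.2.1.1, q.2.2.1)) (by fun_prop)).mul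
    (h4.comp ((h1.sub (by fun_prop)).prodMk (h2.sub (by fun_prop))))

lemma abs_covIntegrand_le (h : IsFieldAlongPath mB P H₀ H ρ W b t T γ C) {p p' : ℝ × ℝ}
    (hp : 0 < p.2) (hp' : 0 < p'.2)
    (q : Ω × ((ℝ × EuclideanSpace ℝ (Fin d)) × (ℝ × EuclideanSpace ℝ (Fin d))))
    (hq : 0 < q.2.1.1 ∧ 0 < q.2.2.1 ∧ q.2.1.1 ≠ q.2.2.1) :
    |covIntegrand H₀ H ρ b p p' q| ≤ C ^ 2 * ((1 + Real.sqrt p.1) * (1 + Real.sqrt p'.1)) *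
      dominant γ b (singularKernel H₀) q := by
  rw [covIntegrand, abs_mul, dominant_mul]
  have h1 := abs_mollifiedCov_le h.hurst_time hp hp' hq.1.le hq.2.1.le hq.2.2
  have h2 := h.abs_spaceCov_le (ε := p.1) (ε' := p'.1) q
  calc _ ≤ singularKernel H₀ (q.2.1.1, q.2.2.1) *
        (C ^ 2 * ((1 + Real.sqrt p.1) * (1 + Real.sqrt p'.1)) * dominant γ b 1 q) :=
        mul_le_mul h1 h2 (abs_nonneg _) (singularKernel_nonneg (by linarith [h.hurst_time.1]) _)
    _ = _ := by ring

lemma integrable_dominant_singularKernel [SFinite P]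
    (h : IsFieldAlongPath mB P H₀ H ρ W b t T γ C) :
    Integrable (dominant γ b (singularKernel H₀))
      (P.prod ((timeHeat d t T).prod (timeHeat d t T))) :=
  h.path.integrable_dominant h.start_nonneg (measurable_singularKernel H₀)
    (singularKernel_nonneg (by linarith [h.hurst_time.1]))
    (lintegral_singularKernel_lt_top h.hurst_time h.start_nonneg)

lemma integrable_covIntegrand [SFinite P] (h : IsFieldAlongPath mB P H₀ H ρ W b t T γ C)
    {p p' : ℝ × ℝ} (hp : 0 < p.2) (hp' : 0 < p'.2) :
    Integrable (covIntegrand H₀ H ρ b p p')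
      (P.prod ((timeHeat d t T).prod (timeHeat d t T))) := by
  refine (h.integrable_dominant_singularKernel.const_mul
    (C ^ 2 * ((1 + Real.sqrt p.1) * (1 + Real.sqrt p'.1)))).mono'
    (h.measurable_covIntegrand p p').aestronglyMeasurable ?_
  filter_upwards [ae_time_ne_and_pos h.start_nonneg] with q hq
  exact h.abs_covIntegrand_le hp hp' q hq

/-- The double integral representing the covariance of two mollified integrals. -/
def covLimit (H₀ : ℝ) (H : Fin d → ℝ) (ρ : EuclideanSpace ℝ (Fin d) → ℝ)
    (b : ℝ → Ω → EuclideanSpace ℝ (Fin d))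
    (q : Ω × ((ℝ × EuclideanSpace ℝ (Fin d)) × (ℝ × EuclideanSpace ℝ (Fin d)))) : ℝ :=
  H₀ * (2 * H₀ - 1) * |q.2.1.1 - q.2.2.1| ^ (2 * H₀ - 2) *
    spaceCov H ρ (b q.2.1.1 q.1) (b q.2.2.1 q.1)

lemma tendsto_integral_covIntegrand [SFinite P] (h : IsFieldAlongPath mB P H₀ H ρ W b t T γ C) :
    Tendsto (fun x : (ℝ × ℝ) × (ℝ × ℝ) => ∫ q, covIntegrand H₀ H ρ b x.1 x.2 q
        ∂(P.prod ((timeHeat d t T).prod (timeHeat d t T))))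
      ((𝓝[>] 0 ×ˢ 𝓝[>] 0) ×ˢ (𝓝[>] 0 ×ˢ 𝓝[>] 0))
      (𝓝 (∫ q, covLimit H₀ H ρ b q ∂(P.prod ((timeHeat d t T).prod (timeHeat d t T))))) := by
  have hsmall : ∀ᶠ x : ℝ in 𝓝[>] 0, 0 < x ∧ x < 1 := by
    filter_upwards [self_mem_nhdsWithin, mem_nhdsWithin_of_mem_nhds (gt_mem_nhds one_pos)]
      with x a b using ⟨a, b⟩
  have hsmall' : ∀ᶠ x : (ℝ × ℝ) × (ℝ × ℝ) in (𝓝[>] 0 ×ˢ 𝓝[>] 0) ×ˢ (𝓝[>] 0 ×ˢ 𝓝[>] 0),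
      ((0 < x.1.1 ∧ x.1.1 < 1) ∧ (0 < x.1.2 ∧ x.1.2 < 1)) ∧
      ((0 < x.2.1 ∧ x.2.1 < 1) ∧ (0 < x.2.2 ∧ x.2.2 < 1)) :=
    (hsmall.prod_mk hsmall).prod_mk (hsmall.prod_mk hsmall)
  refine tendsto_integral_filter_of_dominated_convergence
    -- Each factor `1 + √ε` is at most 2 once the parameters are below 1.
    (fun q => C ^ 2 * (2 * 2) * dominant γ b (singularKernel H₀) q)
    (Eventually.of_forall fun x => (h.measurable_covIntegrand _ _).aestronglyMeasurable) ?_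
    (h.integrable_dominant_singularKernel.const_mul _) ?_
  · filter_upwards [hsmall'] with x hx
    filter_upwards [ae_time_ne_and_pos h.start_nonneg] with q hq
    refine (h.abs_covIntegrand_le hx.1.2.1 hx.2.2.1 q hq).trans ?_
    have h1 : Real.sqrt x.1.1 ≤ 1 := Real.sqrt_le_one.2 hx.1.1.2.le
    have h2 : Real.sqrt x.2.1 ≤ 1 := Real.sqrt_le_one.2 hx.2.1.2.le
    have h3 := Real.sqrt_nonneg x.1.1
    have h4 := Real.sqrt_nonneg x.2.1
    have h5 := dominant_nonneg γ b (singularKernel_nonneg (by linarith [h.hurst_time.1] : 0 ≤ H₀)) q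
    gcongr <;> linarith
  · filter_upwards [ae_time_ne_and_pos h.start_nonneg] with q hq
    have hid : Tendsto (fun x : ℝ => x) (𝓝[>] 0) (𝓝 0) := tendsto_id.mono_left nhdsWithin_le_nhds
    have hsq : Tendsto (fun x : ℝ => Real.sqrt x) (𝓝[>] 0) (𝓝 0) := by
      have := (Real.continuous_sqrt.tendsto 0).comp hid
      rwa [Real.sqrt_zero] at this
    have l1 := (tendsto_mollifiedCov h.hurst_time hq.1 hq.2.1 hq.2.2).comp
      (((tendsto_snd.comp tendsto_fst).prodMk (tendsto_snd.comp tendsto_snd) :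
        Tendsto (fun x : (ℝ × ℝ) × (ℝ × ℝ) => (x.1.2, x.2.2))
        ((𝓝[>] 0 ×ˢ 𝓝[>] 0) ×ˢ (𝓝[>] 0 ×ˢ 𝓝[>] 0)) (𝓝[>] 0 ×ˢ 𝓝[>] 0)))
    have l2 : Tendsto (fun x : (ℝ × ℝ) × (ℝ × ℝ) =>
        (b q.2.1.1 q.1 - Real.sqrt x.1.1 • q.2.1.2, b q.2.2.1 q.1 - Real.sqrt x.2.1 • q.2.2.2))
        ((𝓝[>] 0 ×ˢ 𝓝[>] 0) ×ˢ (𝓝[>] 0 ×ˢ 𝓝[>] 0)) (𝓝 (b q.2.1.1 q.1, b q.2.2.1 q.1)) := by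
      have a1 := ((hsq.comp (tendsto_fst.comp tendsto_fst :
        Tendsto (fun x : (ℝ × ℝ) × (ℝ × ℝ) => x.1.1)
        ((𝓝[>] 0 ×ˢ 𝓝[>] 0) ×ˢ (𝓝[>] 0 ×ˢ 𝓝[>] 0)) (𝓝[>] 0))).smul_const q.2.1.2).const_sub
          (b q.2.1.1 q.1)
      have a2 := ((hsq.comp (tendsto_fst.comp tendsto_snd :
        Tendsto (fun x : (ℝ × ℝ) × (ℝ × ℝ) => x.2.1)
        ((𝓝[>] 0 ×ˢ 𝓝[>] 0) ×ˢ (𝓝[>] 0 ×ˢ 𝓝[>] 0)) (𝓝[>] 0))).smul_const q.2.2.2).const_sub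
          (b q.2.2.1 q.1)
      rw [zero_smul, sub_zero] at a1 a2
      exact a1.prodMk_nhds a2
    have l3 := ((continuous_spaceCov h.hurst_space h.continuous_weight).tendsto _).comp l2
    exact l1.mul l3

end IsFieldAlongPath

/-! ### Square integrability of the approximations -/

namespace IsFieldAlongPath

variable {Ω : Type*} {mB : MeasurableSpace Ω} [mΩ : MeasurableSpace Ω] {d : ℕ} {P : Measure Ω}
  {H₀ : ℝ} {H : Fin d → ℝ} {ρ : EuclideanSpace ℝ (Fin d) → ℝ}
  {W : ℝ≥0 → EuclideanSpace ℝ (Fin d) → Ω → ℝ} {b : ℝ → Ω → EuclideanSpace ℝ (Fin d)}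
  {t T γ C : ℝ}

lemma integrable_dominant_one [SFinite P] (h : IsFieldAlongPath mB P H₀ H ρ W b t T γ C) :
    Integrable (dominant γ b 1) (P.prod ((timeHeat d t T).prod (timeHeat d t T))) := by
  refine h.path.integrable_dominant h.start_nonneg measurable_const (fun _ => zero_le_one) ?_
  simp only [Pi.one_apply, ENNReal.ofReal_one, lintegral_const, one_mul]
  finiteness

/-- The `L²` norm of the time-mollified field at a point `(s, y)` is at most this constant times
`growth γ y`. -/
def deviationConst (H₀ C η : ℝ) : ℝ := Real.sqrt (η ^ (2 * H₀) / (η * η)) * C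

lemma deviationConst_nonneg (h : IsFieldAlongPath mB P H₀ H ρ W b t T γ C) (η : ℝ) :
    0 ≤ deviationConst H₀ C η :=
  mul_nonneg (Real.sqrt_nonneg _) h.const_nonneg

lemma integral_timeMollified_sq_le (h : IsFieldAlongPath mB P H₀ H ρ W b t T γ C) {η : ℝ}
    (hη : 0 < η) (s : ℝ) (y : EuclideanSpace ℝ (Fin d)) :
    ∫ ω, timeMollified W η s y ω * timeMollified W η s y ω ∂P ≤
      (deviationConst H₀ C η * growth γ y) ^ 2 := by
  have := h.field.integral_timeMollified_sq_le h.hurst_time h.hurst_space h.deviation_le hη s y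
  rwa [← mul_assoc] at this

lemma measurable_heatKernel_comp (h : IsFieldAlongPath mB P H₀ H ρ W b t T γ C) {R : Type*}
    [MeasurableSpace R] (ε : ℝ) {f : R → ℝ × EuclideanSpace ℝ (Fin d)} {g : R → Ω}
    (hf : Measurable f) (hg : Measurable g) :
    Measurable fun q => heatKernel ε (b (f q).1 (g q) - (f q).2) :=
  (continuous_heatKernel ε).measurable.comp
    ((h.path.measurable_comp (measurable_fst.comp hf) hg).sub (measurable_snd.comp hf))

lemma measurable_heatKernel_adapted (h : IsFieldAlongPath mB P H₀ H ρ W b t T γ C) (ε : ℝ)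
    (a : ℝ × EuclideanSpace ℝ (Fin d)) :
    Measurable[mB] fun ω => heatKernel ε (b a.1 ω - a.2) :=
  (continuous_heatKernel ε).measurable.comp ((h.path.measurable a.1).sub_const a.2)

lemma measurable_timeMollified_comp (h : IsFieldAlongPath mB P H₀ H ρ W b t T γ C) {R : Type*}
    [MeasurableSpace R] (η : ℝ) {f : R → ℝ × EuclideanSpace ℝ (Fin d)} {g : R → Ω}
    (hf : Measurable f) (hg : Measurable g) :
    Measurable fun q => timeMollified W η (f q).1 (f q).2 (g q) :=
  (h.field.measurable_timeMollified η).comp (hf.prodMk hg)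

/-- A product of two space-time integrals is an integral over pairs of points. Independence replaces
the product of field values by its covariance, and the heat kernels then become Gaussian
displacements of the path. -/
lemma integrable_and_integral_mul [IsProbabilityMeasure P]
    (h : IsFieldAlongPath mB P H₀ H ρ W b t T γ C)
    {p p' : ℝ × ℝ} (hp : 0 < p.1 ∧ 0 < p.2) (hp' : 0 < p'.1 ∧ 0 < p'.2) :
    Integrable (fun q : Ω × ((ℝ × EuclideanSpace ℝ (Fin d)) × (ℝ × EuclideanSpace ℝ (Fin d))) =>
      (heatKernel p.1 (b q.2.1.1 q.1 - q.2.1.2) * heatKernel p'.1 (b q.2.2.1 q.1 - q.2.2.2)) *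
      (timeMollified W p.2 q.2.1.1 q.2.1.2 q.1 * timeMollified W p'.2 q.2.2.1 q.2.2.2 q.1))
      (P.prod ((timeSpace d t T).prod (timeSpace d t T))) ∧
    ∫ ω, pathIntegral W b t T p.1 p.2 ω * pathIntegral W b t T p'.1 p'.2 ω ∂P =
      ∫ q, covIntegrand H₀ H ρ b p p' q ∂(P.prod ((timeHeat d t T).prod (timeHeat d t T))) := by
  obtain ⟨ε, η⟩ := p
  obtain ⟨ε', η'⟩ := p'
  obtain ⟨hε, hη⟩ := hp
  obtain ⟨hε', hη'⟩ := hp'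
  dsimp only at hε hη hε' hη' ⊢
  let κ : (ℝ × EuclideanSpace ℝ (Fin d)) × (ℝ × EuclideanSpace ℝ (Fin d)) → Ω → ℝ := fun c ω =>
    heatKernel ε (b c.1.1 ω - c.1.2) * heatKernel ε' (b c.2.1 ω - c.2.2)
  let Ξ : (ℝ × EuclideanSpace ℝ (Fin d)) × (ℝ × EuclideanSpace ℝ (Fin d)) → Ω → ℝ := fun c ω =>
    timeMollified W η c.1.1 c.1.2 ω * timeMollified W η' c.2.1 c.2.2 ω
  have hκ : ∀ c, Measurable[mB] (κ c) := fun c =>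
    (h.measurable_heatKernel_adapted ε c.1).mul (h.measurable_heatKernel_adapted ε' c.2)
  have hκm : Measurable fun q : Ω × ((ℝ × EuclideanSpace ℝ (Fin d)) × (ℝ × EuclideanSpace ℝ (Fin d))) => κ q.2 q.1 :=
    (h.measurable_heatKernel_comp ε (measurable_fst.comp measurable_snd) measurable_fst).mul
      (h.measurable_heatKernel_comp ε' (measurable_snd.comp measurable_snd) measurable_fst)
  have hΞ : ∀ c, Measurable[fieldSigma W] (Ξ c) := fun c =>
    (measurable_fieldSigma_timeMollified W η _ _).mul
      (measurable_fieldSigma_timeMollified W η' _ _)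
  have hΞm : Measurable fun q : Ω × ((ℝ × EuclideanSpace ℝ (Fin d)) × (ℝ × EuclideanSpace ℝ (Fin d))) => Ξ q.2 q.1 :=
    (h.measurable_timeMollified_comp η (measurable_fst.comp measurable_snd) measurable_fst).mul
      (h.measurable_timeMollified_comp η' (measurable_snd.comp measurable_snd) measurable_fst)
  have hκ0 : ∀ c ω, 0 ≤ κ c ω := fun c ω =>
    mul_nonneg (heatKernel_nonneg hε.le _) (heatKernel_nonneg hε'.le _)
  let K : ℝ := deviationConst H₀ C η * deviationConst H₀ C η'
  have hK : 0 ≤ K := mul_nonneg (h.deviationConst_nonneg _) (h.deviationConst_nonneg _)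
  have hΞle : ∀ c : (ℝ × EuclideanSpace ℝ (Fin d)) × (ℝ × EuclideanSpace ℝ (Fin d)), ∫⁻ ω, ‖Ξ c ω‖ₑ ∂P ≤
      ENNReal.ofReal (K * (growth γ c.1.2 * growth γ c.2.2)) := fun c => by
    refine (lintegral_enorm_mul_le_of_sq_le (h.field.memLp_timeMollified η _ _)
      (h.field.memLp_timeMollified η' _ _)
      (mul_nonneg (h.deviationConst_nonneg η) (growth_nonneg γ c.1.2))
      (mul_nonneg (h.deviationConst_nonneg η') (growth_nonneg γ c.2.2))
      (h.integral_timeMollified_sq_le hη _ _) (h.integral_timeMollified_sq_le hη' _ _)).trans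
      (le_of_eq ?_)
    congr 1; simp only [K]; ring
  have hmeasE : Measurable fun c => ∫⁻ ω, ‖Ξ c ω‖ₑ ∂P :=
    Measurable.lintegral_prod_left' (f := fun q : Ω × ((ℝ × EuclideanSpace ℝ (Fin d)) × (ℝ × EuclideanSpace ℝ (Fin d))) => ‖Ξ q.2 q.1‖ₑ) hΞm.enorm
  -- Absolute integrability involves the expectation of an absolute value, which the singular kernel
  -- does not control. At fixed `η, η'` the Cauchy–Schwarz bound by standard deviations is enough,
  -- with the constant time kernel 1.
  have hfin : ∫⁻ q, ‖κ q.2 q.1‖ₑ * ∫⁻ ω, ‖Ξ q.2 ω‖ₑ ∂P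
      ∂(P.prod ((timeSpace d t T).prod (timeSpace d t T))) < ∞ := by
    have hdom := (h.integrable_dominant_one.const_mul
      (K * ((1 + Real.sqrt ε) * (1 + Real.sqrt ε')))).lintegral_lt_top
    refine lt_of_le_of_lt ?_ hdom
    have hdm := h.path.measurable_dominant (k := 1) measurable_const
    have hκE : Measurable fun q : Ω × ((ℝ × EuclideanSpace ℝ (Fin d)) ×
        (ℝ × EuclideanSpace ℝ (Fin d))) => ‖κ q.2 q.1‖ₑ * ∫⁻ ω, ‖Ξ q.2 ω‖ₑ ∂P :=
      hκm.enorm.mul (hmeasE.comp measurable_snd)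
    rw [lintegral_prod _ (hdm.const_mul _).ennreal_ofReal.aemeasurable,
      lintegral_prod _ hκE.aemeasurable]
    refine lintegral_mono fun ω => ?_
    calc _ ≤ ∫⁻ c : (ℝ × EuclideanSpace ℝ (Fin d)) × (ℝ × EuclideanSpace ℝ (Fin d)), ENNReal.ofReal (κ c ω) *
          ENNReal.ofReal (K * (growth γ c.1.2 * growth γ c.2.2))
          ∂((timeSpace d t T).prod (timeSpace d t T)) := by
          refine lintegral_mono fun c => ?_
          simp only
          rw [Real.enorm_of_nonneg (hκ0 c ω)]
          gcongr
          exact hΞle c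
      _ = _ := lintegral_heatKernel_mul_heatKernel hε hε' t T (h.measurable_path ω)
          (h.measurable_path ω) (by fun_prop)
      _ ≤ _ := by
          refine lintegral_mono fun c => ENNReal.ofReal_le_ofReal ?_
          have h1 := growth_sub_smul_le h.growth_exponent (ε := ε) (b c.1.1 ω) c.1.2
          have h2 := growth_sub_smul_le h.growth_exponent (ε := ε') (b c.2.1 ω) c.2.2
          have h3 := mul_le_mul h1 h2 (growth_nonneg _ _) ((growth_nonneg _ _).trans h1)
          refine (mul_le_mul_of_nonneg_left h3 hK).trans (le_of_eq ?_)
          simp only [dominant, Pi.one_apply]; ring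
  obtain ⟨hint, heq⟩ := integral_prod_mul_of_indep h.path.le h.field.fieldSigma_le h.indep hκ hκm
    hΞ hΞm hfin
  refine ⟨hint, ?_⟩
  have e1 : ∀ ω, ∫ c, κ c ω * Ξ c ω ∂((timeSpace d t T).prod (timeSpace d t T)) =
      pathIntegral W b t T ε η ω * pathIntegral W b t T ε' η' ω := by
    intro ω
    unfold pathIntegral
    rw [← integral_prod_mul]
    refine integral_congr_ae (ae_of_all _ fun c => ?_)
    simp only [κ, Ξ]; ring
  have e2 : ∀ c, ∫ ω, Ξ c ω ∂P = mollifiedCov H₀ η η' c.1.1 c.2.1 * spaceCov H ρ c.1.2 c.2.2 :=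
    fun c => h.field.integral_timeMollified_mul η η' _ _ _ _
  have hcm : Measurable fun c : (ℝ × EuclideanSpace ℝ (Fin d)) × (ℝ × EuclideanSpace ℝ (Fin d)) =>
      mollifiedCov H₀ η η' c.1.1 c.2.1 * spaceCov H ρ c.1.2 c.2.2 := by
    have h3 := (continuous_mollifiedCov (by linarith [h.hurst_time.1] : 0 < H₀) η η').measurable
    have h4 := (continuous_spaceCov h.hurst_space h.continuous_weight).measurable
    exact (h3.comp (f := fun c : (ℝ × EuclideanSpace ℝ (Fin d)) × (ℝ × EuclideanSpace ℝ (Fin d)) => (c.1.1, c.2.1)) (by fun_prop)).mul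
      (h4.comp (f := fun c : (ℝ × EuclideanSpace ℝ (Fin d)) × (ℝ × EuclideanSpace ℝ (Fin d)) => (c.1.2, c.2.2)) (by fun_prop))
  have hΞi : StronglyMeasurable fun c => ∫ ω, Ξ c ω ∂P :=
    StronglyMeasurable.integral_prod_left' (f := fun q : Ω × ((ℝ × EuclideanSpace ℝ (Fin d)) × (ℝ × EuclideanSpace ℝ (Fin d))) => Ξ q.2 q.1)
      hΞm.stronglyMeasurable
  have hint2 : Integrable (fun q : Ω × ((ℝ × EuclideanSpace ℝ (Fin d)) × (ℝ × EuclideanSpace ℝ (Fin d))) => κ q.2 q.1 * ∫ ω, Ξ q.2 ω ∂P)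
      (P.prod ((timeSpace d t T).prod (timeSpace d t T))) := by
    refine ⟨(hκm.mul (hΞi.measurable.comp measurable_snd)).aestronglyMeasurable, ?_⟩
    refine lt_of_le_of_lt (lintegral_mono fun q => ?_) hfin
    rw [enorm_mul]
    gcongr
    exact enorm_integral_le_lintegral_enorm _
  rw [integral_prod _ hint, integral_prod _ hint2] at heq
  simp_rw [e1, e2] at heq
  rw [heq, integral_prod _ (h.integrable_covIntegrand hη hη')]
  refine integral_congr_ae (ae_of_all _ fun ω => ?_)
  exact integral_heatKernel_mul_heatKernel hε hε' t T (h.measurable_path ω) (h.measurable_path ω)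
    hcm

lemma stronglyMeasurable_pathIntegral (h : IsFieldAlongPath mB P H₀ H ρ W b t T γ C) (ε η : ℝ) :
    StronglyMeasurable (pathIntegral W b t T ε η) := by
  have hm : Measurable fun q : Ω × (ℝ × EuclideanSpace ℝ (Fin d)) =>
      heatKernel ε (b q.2.1 q.1 - q.2.2) * timeMollified W η q.2.1 q.2.2 q.1 :=
    (h.measurable_heatKernel_comp ε measurable_snd measurable_fst).mul
      (h.measurable_timeMollified_comp η measurable_snd measurable_fst)
  exact hm.stronglyMeasurable.integral_prod_right'

lemma memLp_pathIntegral [IsProbabilityMeasure P] (h : IsFieldAlongPath mB P H₀ H ρ W b t T γ C)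
    {ε η : ℝ} (hε : 0 < ε) (hη : 0 < η) : MemLp (pathIntegral W b t T ε η) 2 P := by
  rw [memLp_two_iff_integrable_sq (h.stronglyMeasurable_pathIntegral ε η).aestronglyMeasurable]
  have hi := (h.integrable_and_integral_mul (p := (ε, η)) (p' := (ε, η)) ⟨hε, hη⟩
    ⟨hε, hη⟩).1.integral_prod_left
  refine hi.congr (ae_of_all _ fun ω => ?_)
  simp only [pathIntegral, sq]
  rw [← integral_prod_mul]
  refine integral_congr_ae (ae_of_all _ fun c => ?_)
  simp only; ring

/-- With equal parameters the integrand over pairs of points is a tensor square. Its absolute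
integral is the square of the absolute integral of one factor, and it is finite for almost every
`ω`. -/
lemma ae_integrable [IsProbabilityMeasure P] (h : IsFieldAlongPath mB P H₀ H ρ W b t T γ C)
    {ε η : ℝ} (hε : 0 < ε) (hη : 0 < η) : ∀ᵐ ω ∂P, Integrable (fun a =>
      heatKernel ε (b a.1 ω - a.2) * timeMollified W η a.1 a.2 ω) (timeSpace d t T) := by
  filter_upwards [(h.integrable_and_integral_mul (p := (ε, η)) (p' := (ε, η)) ⟨hε, hη⟩
    ⟨hε, hη⟩).1.prod_right_ae] with ω hω
  have hm : Measurable fun a : ℝ × EuclideanSpace ℝ (Fin d) =>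
      heatKernel ε (b a.1 ω - a.2) * timeMollified W η a.1 a.2 ω :=
    (h.measurable_heatKernel_comp ε measurable_id measurable_const).mul
      (h.measurable_timeMollified_comp η measurable_id measurable_const)
  refine ⟨hm.aestronglyMeasurable, ?_⟩
  have hfin := hω.2
  rw [HasFiniteIntegral] at hfin ⊢
  have e : ∀ c : (ℝ × EuclideanSpace ℝ (Fin d)) × (ℝ × EuclideanSpace ℝ (Fin d)),
      ‖(heatKernel ε (b c.1.1 ω - c.1.2) * heatKernel ε (b c.2.1 ω - c.2.2)) *
      (timeMollified W η c.1.1 c.1.2 ω * timeMollified W η c.2.1 c.2.2 ω)‖ₑ =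
      ‖heatKernel ε (b c.1.1 ω - c.1.2) * timeMollified W η c.1.1 c.1.2 ω‖ₑ *
      ‖heatKernel ε (b c.2.1 ω - c.2.2) * timeMollified W η c.2.1 c.2.2 ω‖ₑ := by
    intro c; rw [← enorm_mul]; congr 1; ring
  simp_rw [e] at hfin
  rw [lintegral_prod_mul hm.enorm.aemeasurable hm.enorm.aemeasurable] at hfin
  by_contra hcon
  rw [not_lt, top_le_iff] at hcon
  rw [hcon] at hfin
  simp at hfin

end IsFieldAlongPath

/-! ### Passage to the limit: Gram matrices and Fatou -/

/-- A family in a Hilbert space whose Gram matrix converges along a filter is convergent. -/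
lemma exists_tendsto_of_tendsto_inner {ι E : Type*} [NormedAddCommGroup E] [InnerProductSpace ℝ E]
    [CompleteSpace E] {l : Filter ι} [l.NeBot] {f : ι → E} {L : ℝ}
    (hf : Tendsto (fun x : ι × ι => inner ℝ (f x.1) (f x.2)) (l ×ˢ l) (𝓝 L)) :
    ∃ v, Tendsto f l (𝓝 v) := by
  rw [← cauchy_map_iff_exists_tendsto, cauchy_map_iff]
  refine ⟨inferInstance, ?_⟩
  -- Restriction to the diagonal shows that the squared norms have the same limit `L`, so `‖f x - f
  -- y‖² → L - 2L + L = 0`.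
  have h1 : Tendsto (fun x : ι × ι => inner ℝ (f x.1) (f x.1)) (l ×ˢ l) (𝓝 L) :=
    hf.comp (tendsto_fst.prodMk tendsto_fst)
  have h2 : Tendsto (fun x : ι × ι => inner ℝ (f x.2) (f x.2)) (l ×ˢ l) (𝓝 L) :=
    hf.comp (tendsto_snd.prodMk tendsto_snd)
  have h3 : Tendsto (fun x : ι × ι => ‖f x.1 - f x.2‖ ^ 2) (l ×ˢ l) (𝓝 0) := by
    have := (h1.sub (hf.const_mul 2)).add h2
    rw [show L - 2 * L + L = 0 by ring] at this
    refine this.congr fun x => ?_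
    rw [norm_sub_sq_real, real_inner_self_eq_norm_sq, real_inner_self_eq_norm_sq]
  have h4 : Tendsto (fun x : ι × ι => ‖f x.1 - f x.2‖) (l ×ˢ l) (𝓝 0) := by
    have := (Real.continuous_sqrt.tendsto 0).comp h3
    rw [Real.sqrt_zero] at this
    refine this.congr fun x => ?_
    simp [Real.sqrt_sq (norm_nonneg _)]
  rw [Metric.uniformity_eq_comap_nhds_zero, tendsto_comap_iff]
  simpa [Function.comp_def, dist_eq_norm] using h4

lemma IsFieldAlongPath.exists_tendsto_pathIntegral {Ω : Type*} {mB : MeasurableSpace Ω}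
    [mΩ : MeasurableSpace Ω] {d : ℕ} {P : Measure Ω} [IsProbabilityMeasure P]
    {H₀ : ℝ} {H : Fin d → ℝ} {ρ : EuclideanSpace ℝ (Fin d) → ℝ}
    {W : ℝ≥0 → EuclideanSpace ℝ (Fin d) → Ω → ℝ} {b : ℝ → Ω → EuclideanSpace ℝ (Fin d)}
    {t T γ C : ℝ} (h : IsFieldAlongPath mB P H₀ H ρ W b t T γ C) :
    ∃ V : Ω → ℝ, MemLp V 2 P ∧
      Tendsto (fun p : ℝ × ℝ => eLpNorm (pathIntegral W b t T p.1 p.2 - V) 2 P)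
        (𝓝[>] (0 : ℝ) ×ˢ 𝓝[>] (0 : ℝ)) (𝓝 0) := by
  classical
  -- Membership in `L²` is known only for positive parameters; the value 0 elsewhere is irrelevant
  -- along the filter.
  let f : ℝ × ℝ → Lp ℝ 2 P := fun p =>
    if hp : 0 < p.1 ∧ 0 < p.2 then (h.memLp_pathIntegral hp.1 hp.2).toLp _ else 0
  have hpos : ∀ᶠ p : ℝ × ℝ in 𝓝[>] 0 ×ˢ 𝓝[>] 0, 0 < p.1 ∧ 0 < p.2 :=
    (eventually_mem_nhdsWithin (s := Set.Ioi (0 : ℝ))).prod_mk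
      (eventually_mem_nhdsWithin (s := Set.Ioi (0 : ℝ)))
  have hinner : Tendsto (fun x : (ℝ × ℝ) × (ℝ × ℝ) => inner ℝ (f x.1) (f x.2))
      ((𝓝[>] 0 ×ˢ 𝓝[>] 0) ×ˢ (𝓝[>] 0 ×ˢ 𝓝[>] 0)) (𝓝 (∫ q, covLimit H₀ H ρ b q
        ∂(P.prod ((timeHeat d t T).prod (timeHeat d t T))))) := by
    refine h.tendsto_integral_covIntegrand.congr' ?_
    filter_upwards [hpos.prod_mk hpos] with x hx
    rw [← (h.integrable_and_integral_mul hx.1 hx.2).2, L2.inner_def]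
    simp only [f, dif_pos hx.1, dif_pos hx.2]
    refine integral_congr_ae ?_
    filter_upwards [(h.memLp_pathIntegral hx.1.1 hx.1.2).coeFn_toLp,
      (h.memLp_pathIntegral hx.2.1 hx.2.2).coeFn_toLp] with ω h1 h2
    rw [h1, h2]
    simp [mul_comm]
  obtain ⟨V, hV⟩ := exists_tendsto_of_tendsto_inner hinner
  refine ⟨V, Lp.memLp V, ?_⟩
  rw [Lp.tendsto_Lp_iff_tendsto_eLpNorm'] at hV
  refine hV.congr' ?_
  filter_upwards [hpos] with p hp
  refine eLpNorm_congr_ae ?_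
  simp only [f, dif_pos hp]
  filter_upwards [(h.memLp_pathIntegral hp.1 hp.2).coeFn_toLp] with ω h1
  simp [h1]

/-- Fatou's lemma along an almost surely convergent subsequence. Uniform bounds on exponential
moments thus survive weak modes of convergence without uniform integrability of the exponentials. -/
lemma lintegral_exp_le_of_tendstoInMeasure {Ω : Type*} [MeasurableSpace Ω] {P : Measure Ω}
    {Y : ℕ → Ω → ℝ} {V : Ω → ℝ} (hY : ∀ n, AEMeasurable (Y n) P)
    (h : TendstoInMeasure P Y atTop V) (lam : ℝ) {D : ℝ≥0∞}
    (hD : ∀ᶠ n in atTop, ∫⁻ ω, ENNReal.ofReal (Real.exp (lam * Y n ω)) ∂P ≤ D) :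
    ∫⁻ ω, ENNReal.ofReal (Real.exp (lam * V ω)) ∂P ≤ D := by
  obtain ⟨ns, hns, hlim⟩ := h.exists_seq_tendsto_ae
  calc ∫⁻ ω, ENNReal.ofReal (Real.exp (lam * V ω)) ∂P
      = ∫⁻ ω, liminf (fun i => ENNReal.ofReal (Real.exp (lam * Y (ns i) ω))) atTop ∂P := by
        refine lintegral_congr_ae ?_
        filter_upwards [hlim] with ω hω
        refine (Tendsto.liminf_eq ?_).symm
        exact (ENNReal.continuous_ofReal.tendsto _).comp
          ((Real.continuous_exp.tendsto _).comp (hω.const_mul lam))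
    _ ≤ liminf (fun i => ∫⁻ ω, ENNReal.ofReal (Real.exp (lam * Y (ns i) ω)) ∂P) atTop :=
        lintegral_liminf_le' fun i => by have := hY (ns i); fun_prop
    _ ≤ D := by
        refine liminf_le_of_frequently_le' (Eventually.frequently ?_)
        exact hns.tendsto_atTop.eventually hD

/-! ### Exponential moments of conditionally Gaussian sums -/

section GaussianSum

variable {Ω ι : Type*} {mB mW mΩ : MeasurableSpace Ω} {P : Measure Ω}

lemma lintegral_exp_of_hasGaussianLaw {X : Ω → ℝ} (hX : HasGaussianLaw X P)
    (h0 : ∫ ω, X ω ∂P = 0) (lam : ℝ) :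
    ∫⁻ ω, ENNReal.ofReal (Real.exp (lam * X ω)) ∂P =
      ENNReal.ofReal (Real.exp (lam ^ 2 / 2 * ∫ ω, X ω * X ω ∂P)) := by
  have hm : AEMeasurable X P := hX.aemeasurable
  have hlaw := hX.map_eq_gaussianReal
  have hint : Integrable (fun ω => Real.exp (lam * X ω)) P := by
    have := integrable_exp_mul_gaussianReal (μ := ∫ ω, X ω ∂P) (v := (Var[X; P]).toNNReal) lam
    rw [← hlaw] at this
    exact this.comp_aemeasurable hm
  rw [← ofReal_integral_eq_lintegral_ofReal hint (ae_of_all _ fun _ => Real.exp_nonneg _)]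
  have hmgf := mgf_gaussianReal hlaw lam
  rw [mgf] at hmgf
  rw [hmgf, h0, Real.coe_toNNReal _ (variance_nonneg _ _), variance_of_integral_eq_zero hm h0]
  congr 2
  simp_rw [sq]
  ring

/-- The exponential moments of a sum of centred jointly Gaussian variables with random coefficients
independent of them. -/
lemma lintegral_exp_sum_of_indep [IsProbabilityMeasure P] [Fintype ι] (hmB : mB ≤ mΩ) (hmW : mW ≤ mΩ)
    (hind : Indep mB mW P) {c X : ι → Ω → ℝ} (hc : ∀ i, Measurable[mB] (c i))
    (hXm : ∀ i, Measurable[mW] (X i))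
    (hX : ∀ u : ι → ℝ, HasGaussianLaw (fun ω => ∑ i, u i * X i ω) P)
    (hX2 : ∀ i, MemLp (X i) 2 P) (hX0 : ∀ i, ∫ ω, X i ω ∂P = 0) (lam : ℝ) :
    ∫⁻ ω, ENNReal.ofReal (Real.exp (lam * ∑ i, c i ω * X i ω)) ∂P =
      ∫⁻ ω, ENNReal.ofReal (Real.exp (lam ^ 2 / 2 *
        ∑ i, ∑ j, c i ω * c j ω * ∫ ω', X i ω' * X j ω' ∂P)) ∂P := by
  have hcm : Measurable[mB] fun ω i => c i ω := @measurable_pi_lambda Ω ι (fun _ => ℝ) mB _ _ hc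
  have hXm' : Measurable[mW] fun ω i => X i ω := @measurable_pi_lambda Ω ι (fun _ => ℝ) mW _ _ hXm
  have hcM : Measurable fun ω i => c i ω := hcm.mono hmB le_rfl
  have hXM : Measurable fun ω i => X i ω := hXm'.mono hmW le_rfl
  have hmap := (hind.indepFun hcm hXm').map_prod_eq_prod_map_map hcM.aemeasurable hXM.aemeasurable
  have hF : Measurable fun q : (ι → ℝ) × (ι → ℝ) =>
      ENNReal.ofReal (Real.exp (lam * ∑ i, q.1 i * q.2 i)) := by fun_prop
  have hG : Measurable fun u : ι → ℝ => ENNReal.ofReal (Real.exp (lam ^ 2 / 2 *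
        ∑ i, ∑ j, u i * u j * ∫ ω', X i ω' * X j ω' ∂P)) := by fun_prop
  have h1 : ∫⁻ ω, ENNReal.ofReal (Real.exp (lam * ∑ i, c i ω * X i ω)) ∂P =
      ∫⁻ q, ENNReal.ofReal (Real.exp (lam * ∑ i, q.1 i * q.2 i))
        ∂(P.map fun ω => ((fun i => c i ω), fun i => X i ω)) := by
    rw [lintegral_map hF (hcM.prodMk hXM)]
  have : IsProbabilityMeasure (P.map fun ω i => X i ω) :=
    Measure.isProbabilityMeasure_map hXM.aemeasurable
  have h2 : ∫⁻ ω, ENNReal.ofReal (Real.exp (lam ^ 2 / 2 *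
        ∑ i, ∑ j, c i ω * c j ω * ∫ ω', X i ω' * X j ω' ∂P)) ∂P =
      ∫⁻ u, ENNReal.ofReal (Real.exp (lam ^ 2 / 2 *
        ∑ i, ∑ j, u i * u j * ∫ ω', X i ω' * X j ω' ∂P)) ∂(P.map fun ω i => c i ω) := by
    rw [lintegral_map hG hcM]
  rw [h1, h2, hmap, lintegral_prod _ hF.aemeasurable]
  -- The joint law is a product, so the coefficients can be frozen at `u`. What remains is the
  -- moment generating function of one centred Gaussian variable.
  refine lintegral_congr fun u => ?_
  have hFu : Measurable fun y : ι → ℝ => ENNReal.ofReal (Real.exp (lam * ∑ i, u i * y i)) := by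
    fun_prop
  rw [lintegral_map hFu hXM]
  have hi : ∀ i j, Integrable (fun ω => X i ω * X j ω) P := fun i j =>
    (hX2 i).integrable_mul (hX2 j)
  have h0 : ∫ ω, ∑ i, u i * X i ω ∂P = 0 := by
    rw [integral_finsetSum _ fun i _ => ((hX2 i).integrable (by norm_num)).const_mul _]
    simp [integral_const_mul, hX0]
  rw [lintegral_exp_of_hasGaussianLaw (hX u) h0]
  congr 3
  have e : ∀ ω, (∑ i, u i * X i ω) * ∑ i, u i * X i ω =
      ∑ i, ∑ j, u i * u j * (X i ω * X j ω) := by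
    intro ω
    rw [Finset.sum_mul_sum]
    refine Finset.sum_congr rfl fun i _ => Finset.sum_congr rfl fun j _ => ?_
    ring
  simp_rw [e]
  rw [integral_finsetSum _ fun i _ => integrable_finsetSum _ fun j _ => (hi i j).const_mul _]
  refine Finset.sum_congr rfl fun i _ => ?_
  rw [integral_finsetSum _ fun j _ => (hi i j).const_mul _]
  simp_rw [integral_const_mul]

end GaussianSum

/-- No measurability of `f` is asked for: only its finitely many values on the range of `π` matter.
-/
lemma integral_comp_simpleFunc {α β : Type*} [MeasurableSpace α] (ν : Measure α) [IsFiniteMeasure ν]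
    (π : SimpleFunc α β) (f : β → ℝ) :
    ∫ a, f (π a) ∂ν = ∑ c : π.range, ν.real (π ⁻¹' {(c : β)}) * f c := by
  classical
  have e : ∀ a, f (π a) = ∑ c : π.range, (π ⁻¹' {(c : β)}).indicator (fun _ => f c) a := by
    intro a
    rw [Finset.sum_eq_single (⟨π a, π.mem_range_self a⟩ : π.range)]
    · simp
    · intro c _ hc
      refine Set.indicator_of_notMem (fun h => hc ?_) _
      exact Subtype.ext h.symm
    · simp
  simp_rw [e]
  rw [integral_finsetSum _ fun c _ =>
    (integrable_const _).indicator (π.measurableSet_fiber _)]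
  refine Finset.sum_congr rfl fun c _ => ?_
  rw [integral_indicator_const _ (π.measurableSet_fiber _), smul_eq_mul]

/-! ### Space-time grids -/

section TimeGrid

/-- The projection of `[0, T]` onto the grid of mesh `1 / (n + 1)`. -/
def timeGrid (T : ℝ) (n : ℕ) : SimpleFunc ℝ ℝ where
  -- The cap only makes the range finite on all of `ℝ`; it is inactive for `s` in `[0, T]`. Rounding
  -- down keeps the grid points inside `[0, T]`.
  toFun s := (min ⌊((n : ℝ) + 1) * s⌋₊ ⌈((n : ℝ) + 1) * T⌉₊ : ℕ) / ((n : ℝ) + 1)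
  measurableSet_fiber' x := by
    refine Measurable.div_const ?_ _ (measurableSet_singleton x)
    exact measurable_from_nat.comp ((Nat.measurable_floor.comp (by fun_prop)).min measurable_const)
  finite_range' := by
    refine ((Set.finite_Iic ⌈((n : ℝ) + 1) * T⌉₊).image
      fun k : ℕ => (k : ℝ) / ((n : ℝ) + 1)).subset ?_
    rintro _ ⟨s, rfl⟩
    exact ⟨_, Set.mem_Iic.2 (min_le_right _ _), rfl⟩

lemma timeGrid_mem {T : ℝ} {n : ℕ} {s : ℝ} (hs : s ∈ Set.Icc 0 T) :
    timeGrid T n s ∈ Set.Icc 0 T ∧ |timeGrid T n s - s| ≤ 1 / ((n : ℝ) + 1) := by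
  have hn : (0 : ℝ) < (n : ℝ) + 1 := by positivity
  have h0 : 0 ≤ ((n : ℝ) + 1) * s := mul_nonneg hn.le hs.1
  have hle : ⌊((n : ℝ) + 1) * s⌋₊ ≤ ⌈((n : ℝ) + 1) * T⌉₊ :=
    (Nat.floor_le_ceil _).trans (Nat.ceil_le_ceil (mul_le_mul_of_nonneg_left hs.2 hn.le))
  have e : timeGrid T n s = (⌊((n : ℝ) + 1) * s⌋₊ : ℝ) / ((n : ℝ) + 1) := by
    change ((min ⌊((n : ℝ) + 1) * s⌋₊ ⌈((n : ℝ) + 1) * T⌉₊ : ℕ) : ℝ) / ((n : ℝ) + 1) = _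
    rw [min_eq_left hle]
  have h1 := Nat.floor_le h0
  have h2 := Nat.lt_floor_add_one (((n : ℝ) + 1) * s)
  have h3 : timeGrid T n s ≤ s := by
    rw [e, div_le_iff₀ hn]; linarith
  have h4 : s - 1 / ((n : ℝ) + 1) ≤ timeGrid T n s := by
    rw [e, le_div_iff₀ hn, sub_mul, one_div, inv_mul_cancel₀ hn.ne']; linarith
  refine ⟨⟨by rw [e]; positivity, h3.trans hs.2⟩, ?_⟩
  rw [abs_le]
  constructor <;> linarith [one_div_pos.2 hn]

lemma tendsto_timeGrid {T s : ℝ} (hs : s ∈ Set.Icc 0 T) :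
    Tendsto (fun n => timeGrid T n s) atTop (𝓝 s) := by
  rw [tendsto_iff_dist_tendsto_zero]
  exact squeeze_zero (fun _ => dist_nonneg) (fun n => (timeGrid_mem hs).2)
    tendsto_one_div_add_atTop_nhds_zero_nat

/-- Distinct times may fall on the same grid point, where the singular bound is unavailable. At
fixed `η` uniform continuity on the compact square costs only an additive 1; how fine the grid must
be depends on `η`, but the error term does not. -/
lemma eventually_abs_mollifiedCov_timeGrid_le {H : ℝ} (hH : 0 < H) (η T : ℝ) :
    ∀ᶠ n in atTop, ∀ s ∈ Set.Icc 0 T, ∀ r ∈ Set.Icc 0 T,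
      |mollifiedCov H η η (timeGrid T n s) (timeGrid T n r)| ≤ |mollifiedCov H η η s r| + 1 := by
  have huc := (isCompact_Icc.prod isCompact_Icc).uniformContinuousOn_of_continuous
    (s := Set.Icc 0 T ×ˢ Set.Icc 0 T) (continuous_mollifiedCov hH η η).continuousOn
  obtain ⟨δ, hδ, hd⟩ := Metric.uniformContinuousOn_iff.1 huc 1 one_pos
  filter_upwards [tendsto_one_div_add_atTop_nhds_zero_nat.eventually (gt_mem_nhds hδ)]
    with n hn s hs r hr
  have h1 := timeGrid_mem (n := n) hs
  have h2 := timeGrid_mem (n := n) hr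
  have h := hd (timeGrid T n s, timeGrid T n r) ⟨h1.1, h2.1⟩ (s, r) ⟨hs, hr⟩ (by
    rw [Prod.dist_eq]
    exact max_lt (h1.2.trans_lt hn) (h2.2.trans_lt hn))
  rw [Real.dist_eq] at h
  have h3 := abs_sub_abs_le_abs_sub (mollifiedCov H η η (timeGrid T n s) (timeGrid T n r))
    (mollifiedCov H η η s r)
  linarith

end TimeGrid

section SpaceTimeGrid

variable {d : ℕ}

/-- A simple function approximating the identity of `ℝ^d`. -/
def spaceGrid (d n : ℕ) : SimpleFunc (EuclideanSpace ℝ (Fin d)) (EuclideanSpace ℝ (Fin d)) :=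
  SimpleFunc.approxOn id measurable_id Set.univ 0 (Set.mem_univ 0) n

lemma tendsto_spaceGrid (y : EuclideanSpace ℝ (Fin d)) :
    Tendsto (fun n => spaceGrid d n y) atTop (𝓝 y) :=
  SimpleFunc.tendsto_approxOn measurable_id (Set.mem_univ 0) (by simp)

lemma growth_spaceGrid_le {γ : ℝ} (hγ : γ ∈ Set.Ico (0 : ℝ) 1) (n : ℕ)
    (y : EuclideanSpace ℝ (Fin d)) : growth γ (spaceGrid d n y) ≤ 2 * growth γ y := by
  have h : ‖spaceGrid d n y‖ ≤ ‖y‖ + ‖y‖ :=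
    SimpleFunc.norm_approxOn_zero_le measurable_id (Set.mem_univ 0) y n
  have h2 : (2 : ℝ) ^ γ ≤ 2 := by
    simpa using Real.rpow_le_rpow_of_exponent_le one_le_two hγ.2.le
  unfold growth
  calc (1 + ‖spaceGrid d n y‖) ^ γ ≤ (2 * (1 + ‖y‖)) ^ γ :=
        Real.rpow_le_rpow (by positivity) (by linarith) hγ.1
    _ = 2 ^ γ * (1 + ‖y‖) ^ γ := Real.mul_rpow zero_le_two (by positivity)
    _ ≤ _ := by gcongr

/-- A simple function approximating the identity of `[0, T] × ℝ^d`. -/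
def grid (d : ℕ) (T : ℝ) (n : ℕ) :
    SimpleFunc (ℝ × EuclideanSpace ℝ (Fin d)) (ℝ × EuclideanSpace ℝ (Fin d)) :=
  ((timeGrid T n).comp Prod.fst measurable_fst).pair ((spaceGrid d n).comp Prod.snd measurable_snd)

lemma grid_apply (T : ℝ) (n : ℕ) (a : ℝ × EuclideanSpace ℝ (Fin d)) :
    grid d T n a = (timeGrid T n a.1, spaceGrid d n a.2) := rfl

end SpaceTimeGrid

/-! ### The discretised integral and its conditional variance -/

/-- The occupation measure of a random curve on `[t, T]`, smoothed by the heat kernel. -/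
def pathMeasure {Ω : Type*} {d : ℕ} (b : ℝ → Ω → EuclideanSpace ℝ (Fin d)) (t T ε : ℝ) (ω : Ω) :
    Measure (ℝ × EuclideanSpace ℝ (Fin d)) :=
  (timeHeat d t T).map (perturb ε fun s => b s ω)

instance {Ω : Type*} {d : ℕ} (b : ℝ → Ω → EuclideanSpace ℝ (Fin d)) (t T ε : ℝ) (ω : Ω) :
    IsFiniteMeasure (pathMeasure b t T ε ω) := by
  unfold pathMeasure; infer_instance

/-- The σ-algebra on `Ω` is left arbitrary so that the lemma also applies to the one generated by
the path: the cell masses are then coefficients independent of the field. -/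
lemma measurable_pathMeasure_real {Ω : Type*} [MeasurableSpace Ω] {d : ℕ}
    {b : ℝ → Ω → EuclideanSpace ℝ (Fin d)} (hc : ∀ ω, Continuous fun s => b s ω)
    (hm : ∀ s, Measurable (b s)) (t T ε : ℝ) {A : Set (ℝ × EuclideanSpace ℝ (Fin d))}
    (hA : MeasurableSet A) : Measurable fun ω => (pathMeasure b t T ε ω).real A := by
  have hu : Measurable (Function.uncurry b) := measurable_uncurry_of_continuous_of_measurable hc hm
  have hp : Measurable fun q : Ω × (ℝ × EuclideanSpace ℝ (Fin d)) =>
      perturb ε (fun s => b s q.1) q.2 := by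
    have hb : Measurable fun q : Ω × (ℝ × EuclideanSpace ℝ (Fin d)) => b q.2.1 q.1 :=
      hu.comp (f := fun q : Ω × (ℝ × EuclideanSpace ℝ (Fin d)) => (q.2.1, q.1)) (by fun_prop)
    unfold perturb
    fun_prop
  have h := measurable_measure_prodMk_left (ν := timeHeat d t T) (hp hA)
  refine Measurable.ennreal_toReal (f := fun ω => pathMeasure b t T ε ω A) ?_
  convert h using 2 with ω
  rw [pathMeasure, Measure.map_apply (measurable_perturb ε (hc ω).measurable) hA]
  rfl

/-- The mollified integral with the field evaluated at grid points. -/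
def gridIntegral {Ω : Type*} {d : ℕ} (W : ℝ≥0 → EuclideanSpace ℝ (Fin d) → Ω → ℝ)
    (b : ℝ → Ω → EuclideanSpace ℝ (Fin d)) (t T ε η : ℝ) (n : ℕ) (ω : Ω) : ℝ :=
  ∫ a, timeMollified W η (grid d T n a).1 (grid d T n a).2 ω ∂(pathMeasure b t T ε ω)

/-- The conditional variance of `gridIntegral` given the path. -/
def gridVariance {Ω : Type*} {d : ℕ} (H₀ : ℝ) (H : Fin d → ℝ) (ρ : EuclideanSpace ℝ (Fin d) → ℝ)
    (b : ℝ → Ω → EuclideanSpace ℝ (Fin d)) (t T ε η : ℝ) (n : ℕ) (ω : Ω) : ℝ :=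
  ∫ a, ∫ a', mollifiedCov H₀ η η (grid d T n a).1 (grid d T n a').1 *
    spaceCov H ρ (grid d T n a).2 (grid d T n a').2
    ∂(pathMeasure b t T ε ω) ∂(pathMeasure b t T ε ω)

lemma gridIntegral_eq_sum {Ω : Type*} {d : ℕ} (W : ℝ≥0 → EuclideanSpace ℝ (Fin d) → Ω → ℝ)
    (b : ℝ → Ω → EuclideanSpace ℝ (Fin d)) (t T ε η : ℝ) (n : ℕ) (ω : Ω) :
    gridIntegral W b t T ε η n ω = ∑ c : (grid d T n).range,
      (pathMeasure b t T ε ω).real (grid d T n ⁻¹' {c.1}) * timeMollified W η c.1.1 c.1.2 ω :=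
  integral_comp_simpleFunc (pathMeasure b t T ε ω) (grid d T n)
    fun c => timeMollified W η c.1 c.2 ω

lemma gridVariance_eq_sum {Ω : Type*} {d : ℕ} (H₀ : ℝ) (H : Fin d → ℝ) (ρ : EuclideanSpace ℝ (Fin d) → ℝ)
    (b : ℝ → Ω → EuclideanSpace ℝ (Fin d)) (t T ε η : ℝ) (n : ℕ) (ω : Ω) :
    gridVariance H₀ H ρ b t T ε η n ω = ∑ c : (grid d T n).range, ∑ c' : (grid d T n).range,
      (pathMeasure b t T ε ω).real (grid d T n ⁻¹' {c.1}) *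
      (pathMeasure b t T ε ω).real (grid d T n ⁻¹' {c'.1}) *
      (mollifiedCov H₀ η η c.1.1 c'.1.1 * spaceCov H ρ c.1.2 c'.1.2) := by
  unfold gridVariance
  rw [integral_comp_simpleFunc (pathMeasure b t T ε ω) (grid d T n) fun c =>
    ∫ a', mollifiedCov H₀ η η c.1 (grid d T n a').1 * spaceCov H ρ c.2 (grid d T n a').2
      ∂(pathMeasure b t T ε ω)]
  refine Finset.sum_congr rfl fun c _ => ?_
  rw [integral_comp_simpleFunc (pathMeasure b t T ε ω) (grid d T n) fun c' =>
    mollifiedCov H₀ η η c.1.1 c'.1 * spaceCov H ρ c.1.2 c'.2, Finset.mul_sum]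
  refine Finset.sum_congr rfl fun c' _ => ?_
  rw [mul_assoc]

namespace IsFieldAlongPath

variable {Ω : Type*} {mB : MeasurableSpace Ω} [mΩ : MeasurableSpace Ω] {d : ℕ} {P : Measure Ω}
  {H₀ : ℝ} {H : Fin d → ℝ} {ρ : EuclideanSpace ℝ (Fin d) → ℝ}
  {W : ℝ≥0 → EuclideanSpace ℝ (Fin d) → Ω → ℝ} {b : ℝ → Ω → EuclideanSpace ℝ (Fin d)}
  {t T γ C : ℝ}

lemma pathMeasure_eq_withDensity (h : IsFieldAlongPath mB P H₀ H ρ W b t T γ C) {ε : ℝ}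
    (hε : 0 < ε) (ω : Ω) : pathMeasure b t T ε ω =
      (timeSpace d t T).withDensity fun a => ENNReal.ofReal (heatKernel ε (b a.1 ω - a.2)) :=
  (withDensity_heatKernel_eq_map hε (volume.restrict (Set.Icc t T)) (h.measurable_path ω)).symm

lemma integral_pathMeasure (h : IsFieldAlongPath mB P H₀ H ρ W b t T γ C) {ε : ℝ} (hε : 0 < ε)
    (ω : Ω) (f : ℝ × EuclideanSpace ℝ (Fin d) → ℝ) :
    ∫ a, f a ∂(pathMeasure b t T ε ω) =
      ∫ a, heatKernel ε (b a.1 ω - a.2) * f a ∂(timeSpace d t T) := by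
  rw [h.pathMeasure_eq_withDensity hε, integral_withDensity_eq_integral_toReal_smul
    (measurable_heatKernel_sub ε (h.measurable_path ω)).ennreal_ofReal
    (ae_of_all _ fun _ => ENNReal.ofReal_lt_top)]
  refine integral_congr_ae (ae_of_all _ fun a => ?_)
  simp only [smul_eq_mul]
  rw [ENNReal.toReal_ofReal (heatKernel_nonneg hε.le _)]

lemma lintegral_pathMeasure (h : IsFieldAlongPath mB P H₀ H ρ W b t T γ C) {ε : ℝ} (hε : 0 < ε)
    (ω : Ω) {f : ℝ × EuclideanSpace ℝ (Fin d) → ℝ≥0∞} (hf : Measurable f) :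
    ∫⁻ a, f a ∂(pathMeasure b t T ε ω) =
      ∫⁻ a, ENNReal.ofReal (heatKernel ε (b a.1 ω - a.2)) * f a ∂(timeSpace d t T) := by
  rw [h.pathMeasure_eq_withDensity hε, lintegral_withDensity_eq_lintegral_mul _
    (measurable_heatKernel_sub ε (h.measurable_path ω)).ennreal_ofReal hf]
  rfl

lemma isGaussianProcess_timeMollified (h : IsFieldAlongPath mB P H₀ H ρ W b t T γ C) (η : ℝ) :
    IsGaussianProcess (fun (a : ℝ × EuclideanSpace ℝ (Fin d)) ω => timeMollified W η a.1 a.2 ω)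
      P := by
  classical
  refine IsGaussianProcess.of_isGaussianProcess h.field.gaussian fun a => ?_
  let I : Finset (ℝ≥0 × EuclideanSpace ℝ (Fin d)) := {(a.1.toNNReal, a.2), ((a.1 - η).toNNReal, a.2)}
  let i : I := ⟨(a.1.toNNReal, a.2), by simp [I]⟩
  let j : I := ⟨((a.1 - η).toNNReal, a.2), by simp [I]⟩
  refine ⟨I, η⁻¹ • ((ContinuousLinearMap.proj (R := ℝ) (φ := fun _ : I => ℝ) i) -
    ContinuousLinearMap.proj (R := ℝ) (φ := fun _ : I => ℝ) j), fun ω => ?_⟩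
  simp [timeMollified, i, j, div_eq_inv_mul]

lemma integral_timeMollified_eq_zero (h : IsFieldAlongPath mB P H₀ H ρ W b t T γ C) [IsProbabilityMeasure P]
    (η s : ℝ) (y : EuclideanSpace ℝ (Fin d)) : ∫ ω, timeMollified W η s y ω ∂P = 0 := by
  unfold timeMollified
  rw [integral_div, integral_sub ((h.field.memLp _ _).integrable (by norm_num))
    ((h.field.memLp _ _).integrable (by norm_num)), h.field.mean_zero, h.field.mean_zero]
  simp

lemma measurable_coef (h : IsFieldAlongPath mB P H₀ H ρ W b t T γ C) (ε : ℝ)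
    {A : Set (ℝ × EuclideanSpace ℝ (Fin d))} (hA : MeasurableSet A) :
    Measurable[mB] fun ω => (pathMeasure b t T ε ω).real A :=
  @measurable_pathMeasure_real Ω mB d b h.path.continuous h.path.measurable t T ε A hA

lemma measurable_gridIntegral (h : IsFieldAlongPath mB P H₀ H ρ W b t T γ C) (ε η : ℝ) (n : ℕ) :
    Measurable (gridIntegral W b t T ε η n) := by
  have e : gridIntegral W b t T ε η n = fun ω => _ := funext (gridIntegral_eq_sum W b t T ε η n)
  rw [e]
  refine Finset.measurable_sum _ fun c _ => ?_
  exact ((h.measurable_coef ε ((grid d T n).measurableSet_fiber _)).mono h.path.le le_rfl).mul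
    ((measurable_fieldSigma_timeMollified W η _ _).mono h.field.fieldSigma_le le_rfl)

/-- On the grid the integral is a finite sum of field values weighted by the masses that the path
gives to the cells. The Gaussian formula with independent random coefficients applies to it. -/
lemma lintegral_exp_gridIntegral [IsProbabilityMeasure P]
    (h : IsFieldAlongPath mB P H₀ H ρ W b t T γ C) (ε η : ℝ) (n : ℕ) (lam : ℝ) :
    ∫⁻ ω, ENNReal.ofReal (Real.exp (lam * gridIntegral W b t T ε η n ω)) ∂P =
      ∫⁻ ω, ENNReal.ofReal (Real.exp (lam ^ 2 / 2 * gridVariance H₀ H ρ b t T ε η n ω)) ∂P := by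
  have hG := (h.isGaussianProcess_timeMollified η).comp_right
    (fun c : (grid d T n).range => (c : ℝ × EuclideanSpace ℝ (Fin d)))
  have key := lintegral_exp_sum_of_indep (ι := (grid d T n).range) h.path.le
    h.field.fieldSigma_le h.indep
    (c := fun c ω => (pathMeasure b t T ε ω).real (grid d T n ⁻¹' {c.1}))
    (X := fun c ω => timeMollified W η c.1.1 c.1.2 ω)
    (fun c => h.measurable_coef ε ((grid d T n).measurableSet_fiber _))
    (fun c => measurable_fieldSigma_timeMollified W η _ _)
    (fun u => (hG.smul u).hasGaussianLaw_fun_sum (I := Finset.univ))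
    (fun c => h.field.memLp_timeMollified η _ _)
    (fun c => h.integral_timeMollified_eq_zero η _ _) lam
  simp_rw [gridIntegral_eq_sum, gridVariance_eq_sum]
  rw [key]
  simp_rw [h.field.integral_timeMollified_mul]

end IsFieldAlongPath

/-- A Schur test: `g(s) g(r) ≤ (g(s)² + g(r)²)/2`, and a symmetric kernel whose row integrals are at
most `M` maps each half to `M` times the integral of `g²/2`. The two Gaussian variables contribute
the square of a first moment. -/
lemma lintegral_lintegral_dominant_le {Ω : Type*} {d : ℕ} {b : ℝ → Ω → EuclideanSpace ℝ (Fin d)}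
    {γ t T : ℝ} (ht : 0 ≤ t) {k : ℝ × ℝ → ℝ} (hk : Measurable k) (hk0 : ∀ x, 0 ≤ k x)
    (hsymm : ∀ s r, k (s, r) = k (r, s)) {M : ℝ≥0∞}
    (hM : ∀ s ∈ Set.Icc 0 T, ∫⁻ r in Set.Icc 0 T, ENNReal.ofReal (k (s, r)) ≤ M) {ω : Ω}
    (hc : Continuous fun s => b s ω) :
    ∫⁻ a, ∫⁻ a', ENNReal.ofReal (dominant γ b k (ω, (a, a'))) ∂(timeHeat d t T) ∂(timeHeat d t T) ≤
      (∫⁻ z, ENNReal.ofReal (1 + ‖z‖) ∂(heatMeasure d)) ^ 2 * (M *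
        ∫⁻ s in Set.Icc 0 T, ENNReal.ofReal (growth γ (b s ω) ^ 2)) := by
  have hbm : Measurable fun s => b s ω := hc.measurable
  have hgm : Measurable fun s => growth γ (b s ω) := (measurable_growth γ).comp hbm
  set G := ∫⁻ z, ENNReal.ofReal (1 + ‖z‖) ∂(heatMeasure d) with hG_def
  have hG : G ≠ ∞ := lintegral_one_add_norm_heatMeasure_lt_top.ne
  have h0 : ∀ s, 0 ≤ growth γ (b s ω) := fun s => growth_nonneg _ _
  have inner : ∀ a : ℝ × EuclideanSpace ℝ (Fin d),
      ∫⁻ a', ENNReal.ofReal (dominant γ b k (ω, (a, a'))) ∂(timeHeat d t T) =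
      ENNReal.ofReal (1 + ‖a.2‖) * (G * ∫⁻ r in Set.Icc t T,
        ENNReal.ofReal (k (a.1, r) * (growth γ (b a.1 ω) * growth γ (b r ω)))) := by
    intro a
    have e : ∀ a' : ℝ × EuclideanSpace ℝ (Fin d), ENNReal.ofReal (dominant γ b k (ω, (a, a'))) =
        ENNReal.ofReal (1 + ‖a.2‖) * (ENNReal.ofReal (k (a.1, a'.1) * (growth γ (b a.1 ω) *
          growth γ (b a'.1 ω))) * ENNReal.ofReal (1 + ‖a'.2‖)) := by
      intro a'
      have := hk0 (a.1, a'.1)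
      have := h0 a.1
      have := h0 a'.1
      rw [← ENNReal.ofReal_mul (by positivity), ← ENNReal.ofReal_mul (by positivity)]
      congr 1
      simp only [dominant]; ring
    simp_rw [e]
    rw [lintegral_const_mul' _ _ (by finiteness), lintegral_prod_mul
      (f := fun r => ENNReal.ofReal (k (a.1, r) * (growth γ (b a.1 ω) * growth γ (b r ω))))
      (g := fun z => ENNReal.ofReal (1 + ‖z‖)) (by fun_prop) (by fun_prop), mul_comm G]
  simp_rw [inner]
  have hm2 : Measurable fun x : ℝ × ℝ => ENNReal.ofReal (k (x.1, x.2) *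
      (growth γ (b x.1 ω) * growth γ (b x.2 ω))) := by fun_prop
  have hm1 : Measurable fun s => ∫⁻ r in Set.Icc t T,
        ENNReal.ofReal (k (s, r) * (growth γ (b s ω) * growth γ (b r ω))) := hm2.lintegral_prod_right'
  have outer : ∫⁻ a : ℝ × EuclideanSpace ℝ (Fin d), ENNReal.ofReal (1 + ‖a.2‖) *
      (G * ∫⁻ r in Set.Icc t T,
        ENNReal.ofReal (k (a.1, r) * (growth γ (b a.1 ω) * growth γ (b r ω)))) ∂(timeHeat d t T) =
      G ^ 2 * ∫⁻ s in Set.Icc t T, ∫⁻ r in Set.Icc t T,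
        ENNReal.ofReal (k (s, r) * (growth γ (b s ω) * growth γ (b r ω))) := by
    have := lintegral_prod_mul (μ := volume.restrict (Set.Icc t T)) (ν := heatMeasure d)
      (f := fun s => G * ∫⁻ r in Set.Icc t T,
        ENNReal.ofReal (k (s, r) * (growth γ (b s ω) * growth γ (b r ω))))
      (g := fun z => ENNReal.ofReal (1 + ‖z‖)) (by fun_prop) (by fun_prop)
    simp_rw [mul_comm (ENNReal.ofReal (1 + ‖_‖))]
    rw [this, lintegral_const_mul _ hm1, ← hG_def]
    ring
  rw [outer]
  gcongr
  let φ : ℝ → ℝ≥0∞ := fun s => ENNReal.ofReal (growth γ (b s ω) ^ 2 / 2)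
  have hφ : Measurable φ := by fun_prop
  have hkm : Measurable fun x : ℝ × ℝ => ENNReal.ofReal (k (x.1, x.2)) := by fun_prop
  have hA : ∫⁻ s in Set.Icc 0 T, ∫⁻ r in Set.Icc 0 T, ENNReal.ofReal (k (s, r)) * φ s ≤
      M * ∫⁻ s in Set.Icc 0 T, φ s := by
    rw [← lintegral_const_mul _ hφ]
    refine lintegral_mono_ae ?_
    filter_upwards [ae_restrict_mem measurableSet_Icc] with s hs
    rw [lintegral_mul_const _ (by fun_prop)]
    gcongr
    exact hM s hs
  have hB : ∫⁻ s in Set.Icc 0 T, ∫⁻ r in Set.Icc 0 T, ENNReal.ofReal (k (s, r)) * φ r ≤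
      M * ∫⁻ s in Set.Icc 0 T, φ s := by
    rw [lintegral_lintegral_swap (by
      exact (hkm.mul (hφ.comp measurable_snd)).aemeasurable)]
    simp_rw [fun s r => hsymm s r]
    exact hA
  calc _ ≤ ∫⁻ s in Set.Icc 0 T, ∫⁻ r in Set.Icc 0 T,
        ENNReal.ofReal (k (s, r) * (growth γ (b s ω) * growth γ (b r ω))) :=
        (lintegral_mono_set (Set.Icc_subset_Icc_left ht)).trans
          (lintegral_mono fun s => lintegral_mono_set (Set.Icc_subset_Icc_left ht))
    _ ≤ ∫⁻ s in Set.Icc 0 T, ∫⁻ r in Set.Icc 0 T,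
        (ENNReal.ofReal (k (s, r)) * φ s + ENNReal.ofReal (k (s, r)) * φ r) := by
        refine lintegral_mono fun s => lintegral_mono fun r => ?_
        simp only [φ]
        rw [← mul_add, ← ENNReal.ofReal_add (by positivity) (by positivity),
          ← ENNReal.ofReal_mul (hk0 _)]
        refine ENNReal.ofReal_le_ofReal (mul_le_mul_of_nonneg_left ?_ (hk0 _))
        nlinarith [sq_nonneg (growth γ (b s ω) - growth γ (b r ω))]
    _ = (∫⁻ s in Set.Icc 0 T, ∫⁻ r in Set.Icc 0 T, ENNReal.ofReal (k (s, r)) * φ s) +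
        ∫⁻ s in Set.Icc 0 T, ∫⁻ r in Set.Icc 0 T, ENNReal.ofReal (k (s, r)) * φ r := by
        rw [← lintegral_add_left]
        · refine lintegral_congr fun s => ?_
          rw [lintegral_add_left (by fun_prop)]
        · exact (hkm.mul (hφ.comp measurable_fst)).lintegral_prod_right'
    _ ≤ M * (∫⁻ s in Set.Icc 0 T, φ s) + M * ∫⁻ s in Set.Icc 0 T, φ s := add_le_add hA hB
    _ = M * ∫⁻ s in Set.Icc 0 T, ENNReal.ofReal (growth γ (b s ω) ^ 2) := by
        rw [← mul_add, ← lintegral_add_left hφ]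
        congr 1
        refine lintegral_congr fun s => ?_
        simp only [φ]
        rw [← ENNReal.ofReal_add (by positivity) (by positivity), add_halves]

lemma growth_sq {d : ℕ} (γ : ℝ) (x : EuclideanSpace ℝ (Fin d)) :
    growth γ x ^ 2 = (1 + ‖x‖) ^ (2 * γ) := by
  rw [growth, ← Real.rpow_natCast, ← Real.rpow_mul (by positivity)]; push_cast; ring_nf

/-- Jensen's inequality for the exponential of a time integral. -/
lemma exp_setIntegral_Icc_le {T : ℝ} (hT : 0 < T) {f : ℝ → ℝ} (hf : Continuous f) :
    Real.exp (∫ s in Set.Icc 0 T, f s) ≤ T⁻¹ * ∫ s in Set.Icc 0 T, Real.exp (T * f s) := by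
  have hvol : volume.real (Set.Icc 0 T) = T := by simp [Measure.real, hT.le]
  have h := convexOn_exp.map_set_average_le (μ := volume) (t := Set.Icc 0 T)
    (f := fun s => T * f s) Real.continuous_exp.continuousOn isClosed_univ
    (by simp [hT]) (by simp) (by simp)
    (by fun_prop : Continuous fun s => T * f s).continuousOn.integrableOn_Icc
    (by fun_prop : Continuous fun s => Real.exp (T * f s)).continuousOn.integrableOn_Icc
  rw [setAverage_eq, setAverage_eq, hvol, integral_const_mul, smul_eq_mul, smul_eq_mul,
    inv_mul_cancel_left₀ hT.ne'] at h
  exact h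

/-- Jensen's inequality moves the exponential inside the time integral at the price of a factor `T`
in the exponent. Averaging the uniform one-time bound over `[0, T]` then returns the same constant.
-/
lemma IsTamePath.exists_lintegral_exp_integral_growth_le {Ω : Type*} {mB : MeasurableSpace Ω}
    [mΩ : MeasurableSpace Ω] {d : ℕ} {P : Measure Ω} [SFinite P] {T γ : ℝ}
    {b : ℝ → Ω → EuclideanSpace ℝ (Fin d)} (hb : IsTamePath mB P T γ b) (hγ : 0 ≤ γ) (hT : 0 < T)
    {K : ℝ} (hK : 0 ≤ K) :
    ∃ D : ℝ, ∫⁻ ω, ENNReal.ofReal (Real.exp (K * ∫ s in Set.Icc 0 T, growth γ (b s ω) ^ 2)) ∂P ≤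
      ENNReal.ofReal D := by
  obtain ⟨D, hD⟩ := hb.exp_moment (T * K) (by positivity)
  refine ⟨D, ?_⟩
  have hc : ∀ ω, Continuous fun s => growth γ (b s ω) := fun ω =>
    (continuous_growth hγ).comp (hb.continuous ω)
  have hm : Measurable fun q : Ω × ℝ => ENNReal.ofReal (Real.exp (T * (K * growth γ (b q.2 q.1) ^ 2))) := by
    have : Measurable fun q : Ω × ℝ => b q.2 q.1 := hb.measurable_comp measurable_snd measurable_fst
    have := (measurable_growth γ).comp this
    simp only [Function.comp_def] at this
    fun_prop
  calc _ ≤ ∫⁻ ω, (ENNReal.ofReal T⁻¹ * ∫⁻ s in Set.Icc 0 T,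
        ENNReal.ofReal (Real.exp (T * (K * growth γ (b s ω) ^ 2)))) ∂P := by
        refine lintegral_mono fun ω => ?_
        have hcω := hc ω
        have h := exp_setIntegral_Icc_le hT (f := fun s => K * growth γ (b s ω) ^ 2) (by fun_prop)
        rw [integral_const_mul] at h
        refine (ENNReal.ofReal_le_ofReal h).trans ?_
        rw [ENNReal.ofReal_mul (by positivity), ofReal_integral_eq_lintegral_ofReal
          (by fun_prop : Continuous fun s => Real.exp (T * (K * growth γ (b s ω) ^ 2))).continuousOn.integrableOn_Icc
          (ae_of_all _ fun _ => Real.exp_nonneg _)]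
    _ = ENNReal.ofReal T⁻¹ * ∫⁻ s in Set.Icc 0 T, ∫⁻ ω,
        ENNReal.ofReal (Real.exp (T * (K * growth γ (b s ω) ^ 2))) ∂P := by
        rw [lintegral_const_mul' _ _ (by finiteness), lintegral_lintegral_swap hm.aemeasurable]
    _ ≤ ENNReal.ofReal T⁻¹ * ∫⁻ s in Set.Icc 0 T, ENNReal.ofReal D := by
        refine mul_le_mul_right ?_ _
        refine lintegral_mono_ae ?_
        filter_upwards [ae_restrict_mem measurableSet_Icc] with s hs
        refine le_trans (le_of_eq ?_) (hD s hs)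
        refine lintegral_congr fun ω => ?_
        rw [growth_sq, mul_assoc]
    _ = ENNReal.ofReal D := by
        rw [lintegral_const, Measure.restrict_apply_univ, Real.volume_Icc, sub_zero,
          mul_comm (ENNReal.ofReal D), ← mul_assoc, ← ENNReal.ofReal_mul (by positivity),
          inv_mul_cancel₀ hT.ne', ENNReal.ofReal_one, one_mul]

namespace IsFieldAlongPath

variable {Ω : Type*} {mB : MeasurableSpace Ω} [mΩ : MeasurableSpace Ω] {d : ℕ} {P : Measure Ω}
  {H₀ : ℝ} {H : Fin d → ℝ} {ρ : EuclideanSpace ℝ (Fin d) → ℝ}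
  {W : ℝ≥0 → EuclideanSpace ℝ (Fin d) → Ω → ℝ} {b : ℝ → Ω → EuclideanSpace ℝ (Fin d)}
  {t T γ C : ℝ}

lemma abs_spaceCov_spaceGrid_le (h : IsFieldAlongPath mB P H₀ H ρ W b t T γ C) {ε : ℝ}
    (hε1 : ε ≤ 1) (n : ℕ)
    (q : Ω × ((ℝ × EuclideanSpace ℝ (Fin d)) × (ℝ × EuclideanSpace ℝ (Fin d)))) :
    |spaceCov H ρ (spaceGrid d n (b q.2.1.1 q.1 - Real.sqrt ε • q.2.1.2))
      (spaceGrid d n (b q.2.2.1 q.1 - Real.sqrt ε • q.2.2.2))| ≤ 16 * C ^ 2 * dominant γ b 1 q := by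
  have hs : Real.sqrt ε ≤ 1 := Real.sqrt_le_one.2 hε1
  -- The factor 4 is 2 for the spatial grid times 2 for `1 + √ε` with `ε ≤ 1`; squared, it gives 16.
  have hg : ∀ x z : EuclideanSpace ℝ (Fin d), C * growth γ (spaceGrid d n (x - Real.sqrt ε • z)) ≤
      C * (4 * (growth γ x * (1 + ‖z‖))) := fun x z => by
    refine mul_le_mul_of_nonneg_left ?_ h.const_nonneg
    have h1 := growth_spaceGrid_le h.growth_exponent n (x - Real.sqrt ε • z)
    have h2 := growth_sub_smul_le h.growth_exponent (ε := ε) x z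
    have h3 : 0 ≤ growth γ x * (1 + ‖z‖) := mul_nonneg (growth_nonneg _ _) (by positivity)
    nlinarith
  refine (h.field.abs_spaceCov_le h.hurst_time h.hurst_space h.deviation_le _ _).trans ?_
  have h1 := hg (b q.2.1.1 q.1) q.2.1.2
  refine (mul_le_mul h1 (hg (b q.2.2.1 q.1) q.2.2.2)
    (mul_nonneg h.const_nonneg (growth_nonneg _ _))
    ((mul_nonneg h.const_nonneg (growth_nonneg _ _)).trans h1)).trans (le_of_eq ?_)
  simp only [dominant, Pi.one_apply]; ring

lemma exists_gridVariance_le (h : IsFieldAlongPath mB P H₀ H ρ W b t T γ C) (hT : 0 ≤ T) :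
    ∃ K : ℝ, 0 ≤ K ∧ ∀ ε η : ℝ, ε ≤ 1 → 0 < η → ∀ᶠ n in atTop, ∀ ω,
      gridVariance H₀ H ρ b t T ε η n ω ≤ K * ∫ s in Set.Icc 0 T, growth γ (b s ω) ^ 2 := by
  obtain ⟨M, hM0, hM⟩ := exists_lintegral_singularKernel_le h.hurst_time hT
  have hH0 : 0 < H₀ := by linarith [h.hurst_time.1]
  have hks := measurable_singularKernel H₀
  set G := ∫⁻ z, ENNReal.ofReal (1 + ‖z‖) ∂(heatMeasure d) with hG_def
  have hG : G ≠ ∞ := lintegral_one_add_norm_heatMeasure_lt_top.ne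
  refine ⟨16 * C ^ 2 * (G.toReal ^ 2 * (M + T)), by positivity, fun ε η hε1 hη => ?_⟩
  -- The added 1 is the cost of the time grid; it raises the row integrals from `M` to `M + T`.
  let k : ℝ × ℝ → ℝ := fun x => singularKernel H₀ x + 1
  have hk : Measurable k := hks.add_const 1
  have hk0 : ∀ x, 0 ≤ k x := fun x => add_nonneg (singularKernel_nonneg hH0.le x) zero_le_one
  have hsymm : ∀ s r, k (s, r) = k (r, s) := fun s r => by
    simp only [k, singularKernel, abs_sub_comm s r]
  have hkM : ∀ s ∈ Set.Icc 0 T, ∫⁻ r in Set.Icc 0 T, ENNReal.ofReal (k (s, r)) ≤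
      ENNReal.ofReal (M + T) := fun s hs => by
    simp only [k]
    simp_rw [ENNReal.ofReal_add (singularKernel_nonneg hH0.le _) zero_le_one]
    rw [lintegral_add_right _ measurable_const, ENNReal.ofReal_add hM0 hT]
    refine add_le_add (hM s hs) (le_of_eq ?_)
    simp
  filter_upwards [eventually_abs_mollifiedCov_timeGrid_le hH0 η T] with n hn ω
  have hcω := h.path.continuous ω
  have hgc : Continuous fun s => growth γ (b s ω) := (continuous_growth h.growth_exponent.1).comp hcω
  have hI : Integrable (fun s => growth γ (b s ω) ^ 2) (volume.restrict (Set.Icc 0 T)) :=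
    (hgc.pow 2).continuousOn.integrableOn_Icc
  have hI0 : 0 ≤ ∫ s in Set.Icc 0 T, growth γ (b s ω) ^ 2 := integral_nonneg fun _ => sq_nonneg _
  rw [← ENNReal.ofReal_le_ofReal_iff (by positivity)]
  have hae : ∀ᵐ s ∂(volume.restrict (Set.Icc t T)), s ∈ Set.Icc 0 T := by
    filter_upwards [ae_restrict_mem measurableSet_Icc] with s hs using
      ⟨h.start_nonneg.trans hs.1, hs.2⟩
  have hae1 : ∀ᵐ a ∂(timeHeat d t T), a.1 ∈ Set.Icc 0 T :=
    Measure.quasiMeasurePreserving_fst.ae hae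
  have hae2 : ∀ a : ℝ × EuclideanSpace ℝ (Fin d), ∀ᵐ a' ∂(timeHeat d t T), a.1 ≠ a'.1 := fun a => by
    refine Measure.quasiMeasurePreserving_fst.ae (p := fun s => a.1 ≠ s) ?_
    filter_upwards [ae_restrict_of_ae (Measure.ae_ne volume a.1)] with s hs using hs.symm
  calc ENNReal.ofReal (gridVariance H₀ H ρ b t T ε η n ω)
      ≤ ‖gridVariance H₀ H ρ b t T ε η n ω‖ₑ := Real.ofReal_le_enorm _
    _ ≤ ∫⁻ a, ∫⁻ a', ‖mollifiedCov H₀ η η (grid d T n a).1 (grid d T n a').1 *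
          spaceCov H ρ (grid d T n a).2 (grid d T n a').2‖ₑ
          ∂(pathMeasure b t T ε ω) ∂(pathMeasure b t T ε ω) :=
        (enorm_integral_le_lintegral_enorm _).trans
          (lintegral_mono fun a => enorm_integral_le_lintegral_enorm _)
    _ ≤ ∫⁻ a, ∫⁻ a', ‖mollifiedCov H₀ η η (timeGrid T n a.1) (timeGrid T n a'.1) *
          spaceCov H ρ (spaceGrid d n (b a.1 ω - Real.sqrt ε • a.2))
            (spaceGrid d n (b a'.1 ω - Real.sqrt ε • a'.2))‖ₑ ∂(timeHeat d t T) ∂(timeHeat d t T) :=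
        -- For an upper bound the inequality form of the pushforward formula is enough and needs no
        -- measurability of the integrand.
        (lintegral_map_le _ _).trans (lintegral_mono fun a => lintegral_map_le _ _)
    _ ≤ ∫⁻ a, ∫⁻ a', ENNReal.ofReal (16 * C ^ 2) * ENNReal.ofReal (dominant γ b k (ω, (a, a')))
          ∂(timeHeat d t T) ∂(timeHeat d t T) := by
        refine lintegral_mono_ae ?_
        filter_upwards [hae1] with a ha
        refine lintegral_mono_ae ?_
        filter_upwards [hae1, hae2 a] with a' ha' hne
        rw [← ENNReal.ofReal_mul (by positivity), Real.enorm_eq_ofReal_abs]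
        refine ENNReal.ofReal_le_ofReal ?_
        rw [abs_mul, dominant_mul]
        have h1 : |mollifiedCov H₀ η η (timeGrid T n a.1) (timeGrid T n a'.1)| ≤ k (a.1, a'.1) :=
          (hn _ ha _ ha').trans (add_le_add
            (abs_mollifiedCov_le h.hurst_time hη hη ha.1 ha'.1 hne) le_rfl)
        refine (mul_le_mul h1 (h.abs_spaceCov_spaceGrid_le hε1 n (ω, (a, a')))
          (abs_nonneg _) (hk0 _)).trans (le_of_eq ?_)
        ring
    _ = ENNReal.ofReal (16 * C ^ 2) * ∫⁻ a, ∫⁻ a', ENNReal.ofReal (dominant γ b k (ω, (a, a')))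
          ∂(timeHeat d t T) ∂(timeHeat d t T) := by
        simp_rw [lintegral_const_mul' _ _ ENNReal.ofReal_ne_top]
    _ ≤ ENNReal.ofReal (16 * C ^ 2) * (G ^ 2 * (ENNReal.ofReal (M + T) *
          ∫⁻ s in Set.Icc 0 T, ENNReal.ofReal (growth γ (b s ω) ^ 2))) := by
        gcongr
        exact lintegral_lintegral_dominant_le h.start_nonneg hk hk0 hsymm hkM hcω
    _ = _ := by
        rw [← ofReal_integral_eq_lintegral_ofReal hI (ae_of_all _ fun _ => sq_nonneg _),
          ENNReal.ofReal_mul (p := 16 * C ^ 2 * _) (by positivity),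
          ENNReal.ofReal_mul (p := 16 * C ^ 2) (by positivity),
          ENNReal.ofReal_mul (p := G.toReal ^ 2) (by positivity), ENNReal.ofReal_pow ENNReal.toReal_nonneg,
          ENNReal.ofReal_toReal hG]
        ring

lemma exists_lintegral_exp_gridIntegral_le [IsProbabilityMeasure P]
    (h : IsFieldAlongPath mB P H₀ H ρ W b t T γ C) (hT : 0 < T) (lam : ℝ) :
    ∃ D : ℝ, ∀ ε η : ℝ, ε ≤ 1 → 0 < η → ∀ᶠ n in atTop,
      ∫⁻ ω, ENNReal.ofReal (Real.exp (lam * gridIntegral W b t T ε η n ω)) ∂P ≤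
        ENNReal.ofReal D := by
  obtain ⟨K, hK, hvar⟩ := h.exists_gridVariance_le hT.le
  obtain ⟨D, hD⟩ := h.path.exists_lintegral_exp_integral_growth_le h.growth_exponent.1 hT
    (K := lam ^ 2 / 2 * K) (by positivity)
  refine ⟨D, fun ε η hε1 hη => ?_⟩
  filter_upwards [hvar ε η hε1 hη] with n hn
  rw [h.lintegral_exp_gridIntegral]
  refine (lintegral_mono fun ω => ENNReal.ofReal_le_ofReal (Real.exp_le_exp.2 ?_)).trans hD
  rw [mul_assoc]
  exact mul_le_mul_of_nonneg_left (hn ω) (by positivity)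

end IsFieldAlongPath

/-! ### Removal of the grid and of the mollification -/

namespace IsFieldAlongPath

variable {Ω : Type*} {mB : MeasurableSpace Ω} [mΩ : MeasurableSpace Ω] {d : ℕ} {P : Measure Ω}
  {H₀ : ℝ} {H : Fin d → ℝ} {ρ : EuclideanSpace ℝ (Fin d) → ℝ}
  {W : ℝ≥0 → EuclideanSpace ℝ (Fin d) → Ω → ℝ} {b : ℝ → Ω → EuclideanSpace ℝ (Fin d)}
  {t T γ C : ℝ}

lemma lintegral_enorm_timeMollified_le [IsProbabilityMeasure P]
    (h : IsFieldAlongPath mB P H₀ H ρ W b t T γ C) {η : ℝ} (hη : 0 < η) (s : ℝ)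
    (y : EuclideanSpace ℝ (Fin d)) :
    ∫⁻ ω, ‖timeMollified W η s y ω‖ₑ ∂P ≤ ENNReal.ofReal (deviationConst H₀ C η * growth γ y) :=
  lintegral_enorm_le_of_sq_le (h.field.memLp_timeMollified η s y)
    (mul_nonneg (h.deviationConst_nonneg η) (growth_nonneg γ y))
    (h.integral_timeMollified_sq_le hη s y)

lemma lintegral_enorm_grid_sub_le [IsProbabilityMeasure P]
    (h : IsFieldAlongPath mB P H₀ H ρ W b t T γ C) {η : ℝ} (hη : 0 < η) (n : ℕ)
    (a : ℝ × EuclideanSpace ℝ (Fin d)) :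
    ∫⁻ ω, ‖timeMollified W η (grid d T n a).1 (grid d T n a).2 ω - timeMollified W η a.1 a.2 ω‖ₑ ∂P ≤
      ENNReal.ofReal (3 * deviationConst H₀ C η * growth γ a.2) := by
  have hA := h.deviationConst_nonneg η
  have hm : Measurable (timeMollified W η (grid d T n a).1 (grid d T n a).2) :=
    (measurable_fieldSigma_timeMollified W η _ _).mono h.field.fieldSigma_le le_rfl
  calc _ ≤ ∫⁻ ω, (‖timeMollified W η (grid d T n a).1 (grid d T n a).2 ω‖ₑ +
        ‖timeMollified W η a.1 a.2 ω‖ₑ) ∂P := lintegral_mono fun ω => enorm_sub_le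
    _ ≤ ENNReal.ofReal (deviationConst H₀ C η * growth γ (grid d T n a).2) +
        ENNReal.ofReal (deviationConst H₀ C η * growth γ a.2) := by
        rw [lintegral_add_left hm.enorm]
        exact add_le_add (h.lintegral_enorm_timeMollified_le hη _ _)
          (h.lintegral_enorm_timeMollified_le hη _ _)
    _ ≤ _ := by
        rw [← ENNReal.ofReal_add (mul_nonneg hA (growth_nonneg _ _))
          (mul_nonneg hA (growth_nonneg _ _))]
        refine ENNReal.ofReal_le_ofReal ?_
        have := mul_le_mul_of_nonneg_left (growth_spaceGrid_le h.growth_exponent n a.2) hA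
        rw [grid_apply]
        linarith

/-- The time-mollified field is mean-square continuous on `[0, T] × ℝ^d` because its covariance `c`
is continuous: the second moment of a difference is `c(x, x) - 2 c(x, y) + c(y, y)`. -/
lemma tendsto_lintegral_enorm_grid_sub [IsProbabilityMeasure P]
    (h : IsFieldAlongPath mB P H₀ H ρ W b t T γ C) (η : ℝ)
    {a : ℝ × EuclideanSpace ℝ (Fin d)} (ha : a.1 ∈ Set.Icc 0 T) :
    Tendsto (fun n => ∫⁻ ω, ‖timeMollified W η (grid d T n a).1 (grid d T n a).2 ω -
      timeMollified W η a.1 a.2 ω‖ₑ ∂P) atTop (𝓝 0) := by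
  let c : (ℝ × EuclideanSpace ℝ (Fin d)) → (ℝ × EuclideanSpace ℝ (Fin d)) → ℝ := fun x y =>
    mollifiedCov H₀ η η x.1 y.1 * spaceCov H ρ x.2 y.2
  have hc : Continuous fun q : (ℝ × EuclideanSpace ℝ (Fin d)) × (ℝ × EuclideanSpace ℝ (Fin d)) =>
      c q.1 q.2 :=
    ((continuous_mollifiedCov (by linarith [h.hurst_time.1] : 0 < H₀) η η).comp
      (f := fun q : (ℝ × EuclideanSpace ℝ (Fin d)) × (ℝ × EuclideanSpace ℝ (Fin d)) =>
        (q.1.1, q.2.1)) (by fun_prop)).mul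
      ((continuous_spaceCov h.hurst_space h.continuous_weight).comp
      (f := fun q : (ℝ × EuclideanSpace ℝ (Fin d)) × (ℝ × EuclideanSpace ℝ (Fin d)) =>
        (q.1.2, q.2.2)) (by fun_prop))
  have hX : ∀ x : ℝ × EuclideanSpace ℝ (Fin d), MemLp (timeMollified W η x.1 x.2) 2 P := fun x =>
    h.field.memLp_timeMollified η _ _
  have hi : ∀ x y : ℝ × EuclideanSpace ℝ (Fin d), Integrable (fun ω =>
      timeMollified W η x.1 x.2 ω * timeMollified W η y.1 y.2 ω) P := fun x y =>
    (hX x).integrable_mul (hX y)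
  have hsq : ∀ x y : ℝ × EuclideanSpace ℝ (Fin d), ∫ ω,
      (timeMollified W η x.1 x.2 ω - timeMollified W η y.1 y.2 ω) *
      (timeMollified W η x.1 x.2 ω - timeMollified W η y.1 y.2 ω) ∂P =
      c x x - 2 * c x y + c y y := by
    intro x y
    have e : ∀ ω, (timeMollified W η x.1 x.2 ω - timeMollified W η y.1 y.2 ω) *
      (timeMollified W η x.1 x.2 ω - timeMollified W η y.1 y.2 ω) =
      timeMollified W η x.1 x.2 ω * timeMollified W η x.1 x.2 ω -
      2 * (timeMollified W η x.1 x.2 ω * timeMollified W η y.1 y.2 ω) +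
      timeMollified W η y.1 y.2 ω * timeMollified W η y.1 y.2 ω := fun ω => by ring
    simp_rw [e]
    have hs : Integrable (fun ω => timeMollified W η x.1 x.2 ω * timeMollified W η x.1 x.2 ω -
      2 * (timeMollified W η x.1 x.2 ω * timeMollified W η y.1 y.2 ω)) P :=
      (hi x x).sub ((hi x y).const_mul 2)
    rw [integral_add hs (hi y y),
      integral_sub (hi x x) ((hi x y).const_mul 2), integral_const_mul]
    simp only [h.field.integral_timeMollified_mul, c]
  have hg : Tendsto (fun n => grid d T n a) atTop (𝓝 a) :=
    (tendsto_timeGrid ha).prodMk_nhds (tendsto_spaceGrid a.2)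
  have hlim : Tendsto (fun n => c (grid d T n a) (grid d T n a) - 2 * c (grid d T n a) a + c a a)
      atTop (𝓝 (c a a - 2 * c a a + c a a)) := by
    have h1 := (hc.tendsto (a, a)).comp (hg.prodMk_nhds hg)
    have h2 := (hc.tendsto (a, a)).comp (hg.prodMk_nhds (tendsto_const_nhds (x := a)))
    exact (h1.sub (h2.const_mul 2)).add_const _
  rw [show c a a - 2 * c a a + c a a = 0 by ring] at hlim
  have hsqrt := (ENNReal.continuous_ofReal.tendsto _).comp ((Real.continuous_sqrt.tendsto 0).comp hlim)
  rw [Real.sqrt_zero, ENNReal.ofReal_zero] at hsqrt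
  refine tendsto_of_tendsto_of_tendsto_of_le_of_le tendsto_const_nhds hsqrt (fun _ => zero_le)
    fun n => ?_
  refine lintegral_enorm_le_of_sq_le ((hX _).sub (hX a)) (Real.sqrt_nonneg _) ?_
  simp only [Pi.sub_apply]
  rw [hsq]
  change _ ≤ Real.sqrt _ ^ 2
  rw [Real.sq_sqrt]
  beta_reduce
  rw [← hsq]
  exact integral_nonneg fun ω => mul_self_nonneg _

lemma lintegral_growth_lt_top [IsProbabilityMeasure P]
    (h : IsFieldAlongPath mB P H₀ H ρ W b t T γ C) {ε : ℝ} (hε : 0 < ε) (K : ℝ) :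
    ∫⁻ q : Ω × (ℝ × EuclideanSpace ℝ (Fin d)),
      ENNReal.ofReal (heatKernel ε (b q.2.1 q.1 - q.2.2)) * ENNReal.ofReal (K * growth γ q.2.2)
      ∂(P.prod (timeSpace d t T)) < ∞ := by
  obtain ⟨D, hD⟩ := h.path.exists_lintegral_growth_le
  set G := ∫⁻ z, ENNReal.ofReal (1 + ‖z‖) ∂(heatMeasure d) with hG_def
  have hG : G ≠ ∞ := lintegral_one_add_norm_heatMeasure_lt_top.ne
  have hm : Measurable fun q : Ω × (ℝ × EuclideanSpace ℝ (Fin d)) =>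
      ENNReal.ofReal (heatKernel ε (b q.2.1 q.1 - q.2.2)) * ENNReal.ofReal (K * growth γ q.2.2) :=
    (h.measurable_heatKernel_comp ε measurable_snd measurable_fst).ennreal_ofReal.mul (by fun_prop)
  have hgm : Measurable fun q : Ω × ℝ => ENNReal.ofReal (growth γ (b q.2 q.1)) :=
    ((measurable_growth γ).comp
      (h.path.measurable_comp measurable_snd measurable_fst)).ennreal_ofReal
  have hgω : ∀ ω, Measurable fun s => ENNReal.ofReal (growth γ (b s ω)) := fun ω =>
    ((measurable_growth γ).comp (h.measurable_path ω)).ennreal_ofReal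
  have hae : ∀ᵐ s ∂(volume.restrict (Set.Icc t T)), s ∈ Set.Icc 0 T := by
    filter_upwards [ae_restrict_mem measurableSet_Icc] with s hs using
      ⟨h.start_nonneg.trans hs.1, hs.2⟩
  calc _ = ∫⁻ ω, ∫⁻ a, ENNReal.ofReal (K * growth γ (b a.1 ω - Real.sqrt ε • a.2))
        ∂(timeHeat d t T) ∂P := by
        rw [lintegral_prod _ hm.aemeasurable]
        refine lintegral_congr fun ω => ?_
        have hf : Measurable fun a : ℝ × EuclideanSpace ℝ (Fin d) =>
          ENNReal.ofReal (K * growth γ a.2) := by fun_prop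
        rw [← h.lintegral_pathMeasure hε ω hf, pathMeasure,
          lintegral_map hf (measurable_perturb ε (h.measurable_path ω))]
        rfl
    _ ≤ ∫⁻ ω, ENNReal.ofReal (|K| * (1 + Real.sqrt ε)) * ((∫⁻ s in Set.Icc t T,
        ENNReal.ofReal (growth γ (b s ω))) * G) ∂P := by
        refine lintegral_mono fun ω => ?_
        rw [hG_def, ← lintegral_prod_mul (hgω ω).aemeasurable (by fun_prop),
          ← lintegral_const_mul' _ _ ENNReal.ofReal_ne_top]
        refine lintegral_mono fun a => ?_
        rw [← ENNReal.ofReal_mul (growth_nonneg _ _), ← ENNReal.ofReal_mul (by positivity)]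
        refine ENNReal.ofReal_le_ofReal ?_
        calc _ ≤ |K| * growth γ (b a.1 ω - Real.sqrt ε • a.2) :=
              mul_le_mul_of_nonneg_right (le_abs_self K) (growth_nonneg _ _)
          _ ≤ |K| * ((1 + Real.sqrt ε) * (growth γ (b a.1 ω) * (1 + ‖a.2‖))) :=
              mul_le_mul_of_nonneg_left (growth_sub_smul_le h.growth_exponent _ _) (abs_nonneg _)
          _ = _ := by ring
    _ = ENNReal.ofReal (|K| * (1 + Real.sqrt ε)) * ((∫⁻ s in Set.Icc t T, ∫⁻ ω,
        ENNReal.ofReal (growth γ (b s ω)) ∂P) * G) := by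
        rw [lintegral_const_mul' _ _ ENNReal.ofReal_ne_top, lintegral_mul_const' _ _ hG,
          lintegral_lintegral_swap hgm.aemeasurable]
    _ ≤ ENNReal.ofReal (|K| * (1 + Real.sqrt ε)) * ((∫⁻ s in Set.Icc t T, ENNReal.ofReal D) * G) := by
        refine mul_le_mul_right (mul_le_mul_left ?_ _) _
        refine lintegral_mono_ae ?_
        filter_upwards [hae] with s hs
        refine (lintegral_mono fun ω => ENNReal.ofReal_le_ofReal ?_).trans (hD s hs s hs)
        -- As the growth weight is at least 1, it is bounded by its square, so the two-time estimate
        -- with equal times applies.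
        have : 1 ≤ growth γ (b s ω) := Real.one_le_rpow (by linarith [norm_nonneg (b s ω)])
          h.growth_exponent.1
        nlinarith
    _ < ∞ := by
        rw [lintegral_const]
        finiteness

/-- Integrability holds for every `ω`: on the grid the field takes finitely many values and the
smoothed occupation measure is finite. -/
lemma integrable_heatKernel_grid (h : IsFieldAlongPath mB P H₀ H ρ W b t T γ C) {ε : ℝ}
    (hε : 0 < ε) (η : ℝ) (n : ℕ) (ω : Ω) : Integrable (fun a => heatKernel ε (b a.1 ω - a.2) *
      timeMollified W η (grid d T n a).1 (grid d T n a).2 ω) (timeSpace d t T) := by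
  have hi : Integrable (fun a => timeMollified W η (grid d T n a).1 (grid d T n a).2 ω)
      (pathMeasure b t T ε ω) :=
    ((grid d T n).map fun c : ℝ × EuclideanSpace ℝ (Fin d) => timeMollified W η c.1 c.2 ω).integrable_of_isFiniteMeasure
  rw [h.pathMeasure_eq_withDensity hε, integrable_withDensity_iff_integrable_smul'
    (measurable_heatKernel_sub ε (h.measurable_path ω)).ennreal_ofReal
    (ae_of_all _ fun _ => ENNReal.ofReal_lt_top)] at hi
  refine hi.congr (ae_of_all _ fun a => ?_)
  simp only [smul_eq_mul]
  rw [ENNReal.toReal_ofReal (heatKernel_nonneg hε.le _)]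

/-- In `L¹` the error is linear in the field, so independence bounds it by the heat kernel against
the expected absolute grid error. That error tends to 0 pointwise and is dominated by a multiple of
the growth weight. -/
lemma tendsto_eLpNorm_gridIntegral_sub [IsProbabilityMeasure P]
    (h : IsFieldAlongPath mB P H₀ H ρ W b t T γ C) {ε η : ℝ} (hε : 0 < ε) (hη : 0 < η) :
    Tendsto (fun n => eLpNorm (gridIntegral W b t T ε η n - pathIntegral W b t T ε η) 1 P) atTop
      (𝓝 0) := by
  let κ : ℝ × EuclideanSpace ℝ (Fin d) → Ω → ℝ := fun a ω => heatKernel ε (b a.1 ω - a.2)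
  let Ξ : ℕ → ℝ × EuclideanSpace ℝ (Fin d) → Ω → ℝ := fun n a ω =>
    timeMollified W η (grid d T n a).1 (grid d T n a).2 ω - timeMollified W η a.1 a.2 ω
  have hκm : Measurable fun q : Ω × (ℝ × EuclideanSpace ℝ (Fin d)) => κ q.2 q.1 :=
    h.measurable_heatKernel_comp ε measurable_snd measurable_fst
  have hΞm : ∀ n, Measurable fun q : Ω × (ℝ × EuclideanSpace ℝ (Fin d)) => Ξ n q.2 q.1 := fun n =>
    (h.measurable_timeMollified_comp η ((grid d T n).measurable.comp measurable_snd)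
      measurable_fst).sub (h.measurable_timeMollified_comp η measurable_snd measurable_fst)
  have hEm : ∀ n, Measurable fun a => ∫⁻ ω, ‖Ξ n a ω‖ₑ ∂P := fun n =>
    Measurable.lintegral_prod_left'
      (f := fun q : Ω × (ℝ × EuclideanSpace ℝ (Fin d)) => ‖Ξ n q.2 q.1‖ₑ) (hΞm n).enorm
  have hm : ∀ n, Measurable fun q : Ω × (ℝ × EuclideanSpace ℝ (Fin d)) =>
      ‖κ q.2 q.1 * Ξ n q.2 q.1‖ₑ := fun n => (hκm.mul (hΞm n)).enorm
  have hbound : ∀ n, eLpNorm (gridIntegral W b t T ε η n - pathIntegral W b t T ε η) 1 P ≤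
      ∫⁻ q, ‖κ q.2 q.1‖ₑ * ∫⁻ ω, ‖Ξ n q.2 ω‖ₑ ∂P ∂(P.prod (timeSpace d t T)) := by
    intro n
    rw [← lintegral_prod_mul_of_indep (κ := κ) (Ξ := Ξ n) h.path.le h.field.fieldSigma_le h.indep
      (fun a => h.measurable_heatKernel_adapted ε a) hκm
      (fun a => (measurable_fieldSigma_timeMollified W η _ _).sub
        (measurable_fieldSigma_timeMollified W η _ _)) (hΞm n),
      lintegral_prod _ (hm n).aemeasurable, eLpNorm_one_eq_lintegral_enorm]
    refine lintegral_mono_ae ?_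
    filter_upwards [h.ae_integrable hε hη] with ω hω
    refine le_trans (le_of_eq ?_) (enorm_integral_le_lintegral_enorm _)
    congr 1
    rw [Pi.sub_apply, gridIntegral, h.integral_pathMeasure hε, pathIntegral,
      ← integral_sub (h.integrable_heatKernel_grid hε η n ω) hω]
    refine integral_congr_ae (ae_of_all _ fun a => ?_)
    simp only [κ, Ξ]; ring
  refine tendsto_of_tendsto_of_tendsto_of_le_of_le tendsto_const_nhds ?_ (fun _ => zero_le) hbound
  have hdct := tendsto_lintegral_of_dominated_convergence
    (μ := P.prod (timeSpace d t T))
    (F := fun n q => ‖κ q.2 q.1‖ₑ * ∫⁻ ω, ‖Ξ n q.2 ω‖ₑ ∂P) (f := fun _ => 0)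
    (fun q => ENNReal.ofReal (heatKernel ε (b q.2.1 q.1 - q.2.2)) *
      ENNReal.ofReal (3 * deviationConst H₀ C η * growth γ q.2.2))
    (fun n => hκm.enorm.mul ((hEm n).comp measurable_snd)) ?_
    (h.lintegral_growth_lt_top hε _).ne ?_
  · simpa using hdct
  · refine fun n => ae_of_all _ fun q => ?_
    simp only [κ]
    rw [Real.enorm_of_nonneg (heatKernel_nonneg hε.le _)]
    gcongr
    exact h.lintegral_enorm_grid_sub_le hη n q.2
  · have hq : ∀ᵐ q ∂(P.prod (timeSpace d t T)), q.2.1 ∈ Set.Icc 0 T := by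
      refine (Measure.quasiMeasurePreserving_fst.comp
        Measure.quasiMeasurePreserving_snd).ae (p := fun s => s ∈ Set.Icc 0 T) ?_
      filter_upwards [ae_restrict_mem measurableSet_Icc] with s hs using
        ⟨h.start_nonneg.trans hs.1, hs.2⟩
    filter_upwards [hq] with q hq
    have := ENNReal.Tendsto.const_mul (a := ‖κ q.2 q.1‖ₑ)
      (h.tendsto_lintegral_enorm_grid_sub η hq) (Or.inr enorm_ne_top)
    rwa [mul_zero] at this

lemma integrable_exp_of_tendsto [IsProbabilityMeasure P]
    (h : IsFieldAlongPath mB P H₀ H ρ W b t T γ C) (hT : 0 < T) {V : Ω → ℝ} (hV : MemLp V 2 P)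
    (hlim : Tendsto (fun p : ℝ × ℝ => eLpNorm (pathIntegral W b t T p.1 p.2 - V) 2 P)
      (𝓝[>] (0 : ℝ) ×ˢ 𝓝[>] (0 : ℝ)) (𝓝 0)) (lam : ℝ) :
    Integrable (fun ω => Real.exp (lam * V ω)) P := by
  obtain ⟨D, hD⟩ := h.exists_lintegral_exp_gridIntegral_le hT lam
  have hpath : ∀ ε η : ℝ, 0 < ε → ε ≤ 1 → 0 < η →
      ∫⁻ ω, ENNReal.ofReal (Real.exp (lam * pathIntegral W b t T ε η ω)) ∂P ≤
        ENNReal.ofReal D := fun ε η hε hε1 hη =>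
    lintegral_exp_le_of_tendstoInMeasure
      (fun n => (h.measurable_gridIntegral ε η n).aemeasurable)
      (tendstoInMeasure_of_tendsto_eLpNorm one_ne_zero
        (fun n => (h.measurable_gridIntegral ε η n).aestronglyMeasurable)
        (h.stronglyMeasurable_pathIntegral ε η).aestronglyMeasurable
        (h.tendsto_eLpNorm_gridIntegral_sub hε hη)) lam (hD ε η hε1 hη)
  -- The second Fatou step runs along `ε = η = 1/(n + 1)`. This sequence starts at 1, so `ε ≤ 1`
  -- holds throughout and the bound `D` is the same for all terms.
  have hseq : Tendsto (fun n : ℕ => 1 / ((n : ℝ) + 1)) atTop (𝓝[>] 0) :=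
    tendsto_nhdsWithin_iff.2 ⟨tendsto_one_div_add_atTop_nhds_zero_nat,
      Eventually.of_forall fun n => by simp only [Set.mem_Ioi]; positivity⟩
  have hlim' := hlim.comp (hseq.prodMk hseq)
  have hfin := lintegral_exp_le_of_tendstoInMeasure
    (fun n => (h.stronglyMeasurable_pathIntegral _ _).measurable.aemeasurable)
    (tendstoInMeasure_of_tendsto_eLpNorm two_ne_zero
      (fun n => (h.stronglyMeasurable_pathIntegral _ _).aestronglyMeasurable)
      hV.aestronglyMeasurable hlim') lam
    (Eventually.of_forall fun n => hpath _ _ (by positivity)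
      (by rw [div_le_one (by positivity)]; linarith [(Nat.cast_nonneg n : (0 : ℝ) ≤ n)])
      (by positivity))
  refine ⟨(Real.continuous_exp.measurable.comp_aemeasurable
    (hV.aestronglyMeasurable.aemeasurable.const_mul lam)).aestronglyMeasurable, ?_⟩
  rw [hasFiniteIntegral_iff_ofReal (ae_of_all _ fun _ => Real.exp_nonneg _)]
  exact hfin.trans_lt ENNReal.ofReal_lt_top

end IsFieldAlongPath

/-! ### Brownian paths are tame; conclusion -/

section BrownianPath

variable {Ω : Type*} [mΩ : MeasurableSpace Ω] {P : Measure Ω} {d : ℕ} {T : ℝ≥0}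
  {B : ℝ≥0 → Ω → EuclideanSpace ℝ (Fin d)}

/-- A Brownian motion independent of a random field has a continuous modification that is a tame
path for a σ-algebra independent of the field. -/
lemma IsStdBrownianUpTo.exists_isTamePath (hB : IsStdBrownianUpTo T B P)
    {W : ℝ≥0 → EuclideanSpace ℝ (Fin d) → Ω → ℝ}
    (hBW : IndepFun (fun (ω : Ω) (s : Set.Iic T) => B s ω)
      (fun (ω : Ω) (p : ℝ≥0 × EuclideanSpace ℝ (Fin d)) => W p.1 p.2 ω) P)
    {γ : ℝ} (hγ : γ ∈ Set.Ico (0 : ℝ) 1) :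
    ∃ (mB : MeasurableSpace Ω) (b : ℝ → Ω → EuclideanSpace ℝ (Fin d)),
      @IsTamePath Ω mB mΩ d P T γ b ∧ Indep mB (fieldSigma W) P ∧
        ∀ᵐ ω ∂P, ∀ s : ℝ≥0, s ≤ T → B s ω = b s ω := by
  obtain ⟨b, hbc, hbm, hBb, hbT⟩ := hB.exists_continuous_modification
  refine ⟨MeasurableSpace.comap (fun ω (s : Set.Iic T) => b (s : ℝ≥0) ω) inferInstance, b,
    ⟨?_, hbc, fun s => ?_, fun c hc => ?_⟩, ?_, hBb⟩
  · exact Measurable.comap_le (measurable_pi_lambda _ fun s => hbm _)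
  -- Extending the path by constants outside `[0, T]` makes every `b s` a function of the values at
  -- times in `[0, T]`, the only ones assumed independent of the field.
  · rw [hbT s]
    exact (measurable_pi_apply (⟨min s.toNNReal T, Set.mem_Iic.2 (min_le_right _ _)⟩ : Set.Iic T)).comp
      (comap_measurable (fun ω (s : Set.Iic T) => b (s : ℝ≥0) ω))
  · obtain ⟨D, hD⟩ := exists_lintegral_exp_rpow_le (d := d) T.2
      (by linarith [hγ.1] : 0 ≤ 2 * γ) (by linarith [hγ.2]) hc
    refine ⟨D, fun s hs => ?_⟩
    have hsT : s.toNNReal ≤ T := Real.toNNReal_le_iff_le_coe.2 hs.2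
    have hlaw := hB.hasLaw hsT
    rw [Real.coe_toNNReal s hs.1] at hlaw
    refine le_trans (le_of_eq ?_) (hD s hs)
    rw [← hlaw.map_eq, lintegral_map' (by fun_prop) hlaw.aemeasurable]
    refine lintegral_congr_ae ?_
    filter_upwards [hBb] with ω hω
    rw [hω _ hsT, Real.coe_toNNReal s hs.1]
  · rw [← IndepFun_iff_Indep]
    refine hBW.congr ?_ (ae_eq_refl _)
    filter_upwards [hBb] with ω hω
    ext1 s
    exact hω s s.2

end BrownianPath

namespace IsFieldAlongPath

variable {Ω : Type*} {mB : MeasurableSpace Ω} [mΩ : MeasurableSpace Ω] {d : ℕ} {P : Measure Ω}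
  {H₀ : ℝ} {H : Fin d → ℝ} {ρ : EuclideanSpace ℝ (Fin d) → ℝ}
  {W : ℝ≥0 → EuclideanSpace ℝ (Fin d) → Ω → ℝ} {b : ℝ → Ω → EuclideanSpace ℝ (Fin d)}
  {t T : ℝ≥0} {γ C : ℝ} {B : ℝ≥0 → Ω → EuclideanSpace ℝ (Fin d)}

/-- The iterated integral in the definition is a double integral only when Fubini applies, hence the
almost sure absolute integrability; the path is replaced by its modification at the same time. -/
lemma approxIntegral_ae_eq [IsProbabilityMeasure P] (h : IsFieldAlongPath mB P H₀ H ρ W b t T γ C)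
    (ht : t ≤ T) (hBb : ∀ᵐ ω ∂P, ∀ s : ℝ≥0, s ≤ T → B s ω = b s ω) {ε η : ℝ} (hε : 0 < ε)
    (hη : 0 < η) : approxIntegral W B t T ε η =ᵐ[P] pathIntegral W b t T ε η := by
  filter_upwards [hBb, h.ae_integrable hε hη] with ω hω hi
  rw [approxIntegral, pathIntegral, intervalIntegral.integral_of_le (NNReal.coe_le_coe.2 ht),
    ← integral_Icc_eq_integral_Ioc, integral_prod _ hi]
  refine setIntegral_congr_fun measurableSet_Icc fun s hs => ?_
  simp only [approxNoise]
  rw [hω _ (Real.toNNReal_le_iff_le_coe.2 hs.2), Real.coe_toNNReal s (t.2.trans hs.1)]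

lemma ae_integrable_of_ae_eq [IsProbabilityMeasure P]
    (h : IsFieldAlongPath mB P H₀ H ρ W b t T γ C)
    (hBb : ∀ᵐ ω ∂P, ∀ s : ℝ≥0, s ≤ T → B s ω = b s ω) {ε η : ℝ} (hε : 0 < ε) (hη : 0 < η) :
    ∀ᵐ ω ∂P, Integrable (fun q : ℝ × EuclideanSpace ℝ (Fin d) =>
        heatKernel ε (B q.1.toNNReal ω - q.2) * timeMollified W η q.1 q.2 ω)
      ((volume.restrict (Set.Icc (t : ℝ) (T : ℝ))).prod volume) := by
  filter_upwards [hBb, h.ae_integrable hε hη] with ω hω hi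
  refine hi.congr ?_
  have hae : ∀ᵐ a ∂(timeSpace d t T), a.1 ∈ Set.Icc (t : ℝ) T :=
    Measure.quasiMeasurePreserving_fst.ae (ae_restrict_mem measurableSet_Icc)
  filter_upwards [hae] with a ha
  rw [hω _ (Real.toNNReal_le_iff_le_coe.2 ha.2), Real.coe_toNNReal a.1 (t.2.trans ha.1)]

lemma tendsto_approxIntegral_iff [IsProbabilityMeasure P]
    (h : IsFieldAlongPath mB P H₀ H ρ W b t T γ C) (ht : t ≤ T)
    (hBb : ∀ᵐ ω ∂P, ∀ s : ℝ≥0, s ≤ T → B s ω = b s ω) (V : Ω → ℝ) :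
    Tendsto (fun p : ℝ × ℝ => eLpNorm (approxIntegral W B t T p.1 p.2 - V) 2 P)
      (𝓝[>] (0 : ℝ) ×ˢ 𝓝[>] (0 : ℝ)) (𝓝 0) ↔
    Tendsto (fun p : ℝ × ℝ => eLpNorm (pathIntegral W b t T p.1 p.2 - V) 2 P)
      (𝓝[>] (0 : ℝ) ×ˢ 𝓝[>] (0 : ℝ)) (𝓝 0) := by
  refine tendsto_congr' ?_
  filter_upwards [(eventually_mem_nhdsWithin (s := Set.Ioi (0 : ℝ))).prod_mk
    (eventually_mem_nhdsWithin (s := Set.Ioi (0 : ℝ)))] with p hp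
  exact eLpNorm_congr_ae ((h.approxIntegral_ae_eq ht hBb hp.1 hp.2).sub (ae_eq_refl V))

/-- The nonlinear stochastic integral along a path exists and has exponential moments. -/
lemma exists_and_forall_integrable_exp [IsProbabilityMeasure P]
    (h : IsFieldAlongPath mB P H₀ H ρ W b t T γ C) (hT : 0 < T) (ht : t ≤ T)
    (hBb : ∀ᵐ ω ∂P, ∀ s : ℝ≥0, s ≤ T → B s ω = b s ω) :
    (∃ V : Ω → ℝ, IsNonlinearIntegral W B t T P V) ∧
      ∀ V : Ω → ℝ, IsNonlinearIntegral W B t T P V →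
        ∀ lam : ℝ, Integrable (fun ω => Real.exp (lam * V ω)) P := by
  refine ⟨?_, fun V hV lam => h.integrable_exp_of_tendsto (NNReal.coe_pos.2 hT) hV.memLp
    ((h.tendsto_approxIntegral_iff ht hBb V).1 hV.tendsto) lam⟩
  obtain ⟨V, hV, hlim⟩ := h.exists_tendsto_pathIntegral
  exact ⟨V, fun ε η hε hη => h.ae_integrable_of_ae_eq hBb hε hη,
    fun ε η hε hη => (h.memLp_pathIntegral hε hη).ae_eq (h.approxIntegral_ae_eq ht hBb hε hη).symm,
    hV, (h.tendsto_approxIntegral_iff ht hBb V).2 hlim⟩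

end IsFieldAlongPath

/-- Existence and exponential moments of the nonlinear stochastic integral along a Brownian motion,
for a weight with a bound on the standard deviation of the field. -/
lemma IsStdBrownianUpTo.exists_and_forall_integrable_exp {Ω : Type*} [mΩ : MeasurableSpace Ω]
    {P : Measure Ω} [IsProbabilityMeasure P] {d : ℕ} {H₀ : ℝ} {H : Fin d → ℝ}
    {ρ : EuclideanSpace ℝ (Fin d) → ℝ} {W : ℝ≥0 → EuclideanSpace ℝ (Fin d) → Ω → ℝ}
    {t T : ℝ≥0} {γ C : ℝ} {B : ℝ≥0 → Ω → EuclideanSpace ℝ (Fin d)}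
    (hB : IsStdBrownianUpTo T B P) (hW : IsWeightedFractionalField H₀ H ρ W P)
    (hBW : IndepFun (fun (ω : Ω) (s : Set.Iic T) => B s ω)
      (fun (ω : Ω) (p : ℝ≥0 × EuclideanSpace ℝ (Fin d)) => W p.1 p.2 ω) P)
    (hH₀ : H₀ ∈ Set.Ioo (1 / 2 : ℝ) 1) (hH : ∀ i, H i ∈ Set.Ioo (1 / 2 : ℝ) 1)
    (hρ : Continuous ρ) (hC : 0 ≤ C) (hγ : γ ∈ Set.Ico (0 : ℝ) 1)
    (hdev : ∀ x, 0 ≤ ρ x * ∏ i, |x i| ^ (H i) ∧ ρ x * ∏ i, |x i| ^ (H i) ≤ C * growth γ x)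
    (hT : 0 < T) (ht : t ≤ T) :
    (∃ V : Ω → ℝ, IsNonlinearIntegral W B t T P V) ∧
      ∀ V : Ω → ℝ, IsNonlinearIntegral W B t T P V →
        ∀ lam : ℝ, Integrable (fun ω => Real.exp (lam * V ω)) P := by
  obtain ⟨mB, b, hb, hind, hBb⟩ := hB.exists_isTamePath hBW hγ
  exact @IsFieldAlongPath.exists_and_forall_integrable_exp Ω mB mΩ d P H₀ H ρ W b t T γ C B
    inferInstance (@IsFieldAlongPath.mk Ω mB mΩ d P H₀ H ρ W b t T γ C
      hW hb hind hH₀ hH hρ hC hγ hdev t.2) hT ht hBb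

end

theorem proposition2p2 {Ω : Type*} [MeasurableSpace Ω] (P : Measure Ω) [IsProbabilityMeasure P]
    (d : ℕ) (H₀ : ℝ) (H β : Fin d → ℝ)
    (hH₀ : H₀ ∈ Set.Ioo (1 / 2 : ℝ) 1) (hH : ∀ i, H i ∈ Set.Ioo (1 / 2 : ℝ) 1)
    -- the weight: continuous, of power decay with exponents `β i`, and `α = ∑ (2 H i - β i) < 2`
    (ρ : EuclideanSpace ℝ (Fin d) → ℝ) (hρ_cont : Continuous ρ)
    (hβ : ∀ i, β i ∈ Set.Ioo (0 : ℝ) 2) (hβH : ∀ i, β i < 2 * H i)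
    (C : ℝ) (hρ : ∀ x, 0 ≤ ρ x ∧ ρ x ≤ C * ∏ i, (1 + |x i|) ^ (-β i))
    (hα : ∑ i, (2 * H i - β i) < 2)
    -- the Brownian motion and the independent field
    (T : ℝ≥0) (hT : 0 < T)
    (B : ℝ≥0 → Ω → EuclideanSpace ℝ (Fin d)) (hB : IsStdBrownianUpTo T B P)
    (W : ℝ≥0 → EuclideanSpace ℝ (Fin d) → Ω → ℝ) (hW : IsWeightedFractionalField H₀ H ρ W P)
    (hBW : IndepFun (fun (ω : Ω) (s : Set.Iic T) => B s ω)
      (fun (ω : Ω) (p : ℝ≥0 × EuclideanSpace ℝ (Fin d)) => W p.1 p.2 ω) P)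
    (t : ℝ≥0) (ht : t ≤ T) :
    -- the integral `∫_t^T W(dr, B_r)` exists, and each version `V` of it satisfies the claim
    (∃ V : Ω → ℝ, IsNonlinearIntegral W B t T P V) ∧
      ∀ V : Ω → ℝ, IsNonlinearIntegral W B t T P V →
        ∀ lam : ℝ, Integrable (fun ω => Real.exp (lam * V ω)) P := by
  obtain ⟨hC, hdev⟩ := weight_mul_prod_le hβ hβH hH hρ
  -- Take `γ = α/2`, the growth exponent of the standard deviation; `α < 2` is exactly `γ < 1`,
  -- which makes `2γ` subquadratic.
  have hγ : (∑ i, (2 * H i - β i)) / 2 ∈ Set.Ico (0 : ℝ) 1 :=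
    ⟨div_nonneg (Finset.sum_nonneg fun i _ => by linarith [hβH i]) zero_le_two, by linarith⟩
  exact hB.exists_and_forall_integrable_exp hW hBW hH₀ hH hρ_cont hC hγ hdev hT ht
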